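/- Let $n\ge 2$ and $p\in[0,1)$. For a compact convex set $K\subset\mathbb R^n$ with non-empty interior, let $h_K(u)=\max_{x\in K}\langle x,u\rangle$ be its support function, let $\nu_K$ be its spherical Gauss map, defined on the set $\partial'K$ of boundary points with a unique exterior unit normal, and let $S_K(\eta)=\mathcal H^{n-1}(\nu_K^{-1}(\eta))$, for Borel sets $\eta\subset\mathbb S^{n-1}$, be its surface area measure, where $\mathcal H^k$ is the $k$-dimensional Hausdorff measure normalized to coincide with Lebesgue measure on $k$-dimensional affine subspaces. If $o\in K$, the $L_p$ surface area measure of $K$ is given by $dS_{p,K}=h_K^{1-p}\,dS_K$. If $S_K$ is absolutely continuous with respect to $\mathcal H^{n-1}$ on $\mathbb S^{n-1}$, let $f_K$ denote its density. Suppose that the following assertion is false for these $n$ and $p$: for every $\lambda>1$ there is a constant $C>0$ such that every compact convex set $L\subset\mathbb R^n$ with $o\in\operatorname{int}L$ whose surface area measure is absolutely continuous and satisfies $\lambda^{-1}\le h_L^{1-p}f_L\le\lambda$ almost everywhere on $\mathbb S^{n-1}$ has $h_L\le C$ on $\mathbb S^{n-1}$ and volume $V(L)\ge C^{-1}$. Then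 there exist a compact convex set $K\subset\mathbb R^n$ with non-empty interior and $o\in\partial K$, and a proper linear subspace $H$ of $\mathbb R^n$, such that $S_{p,K}$ is concentrated in $H$, i.e. $S_{p,K}(\mathbb S^{n-1}\setminus H)=0$, and such that the restriction of $S_{p,K}$ to the Borel subsets of $\mathbb S^{n-1}\cap H$ is absolutely continuous with respect to the spherical Lebesgue measure $\mathcal H^{\dim H-1}$ on $\mathbb S^{n-1}\cap H$, with a density that is bounded and bounded away from zero (almost everywhere). -/

import Mathlib

open MeasureTheory

noncomputable section

namespace LpMinkowski

/-- Euclidean `n`-space with its Euclidean norm and inner product. -/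
abbrev E (n : ℕ) : Type := EuclideanSpace ℝ (Fin n)

/-- The Euclidean unit sphere of `E n`. -/
abbrev Sphere (n : ℕ) : Type := Metric.sphere (0 : E n) 1

/-- The support function `h_K(u) = max {⟪x, u⟫ : x ∈ K}` (the supremum is attained for
nonempty compact `K`). -/
def supportFunction {n : ℕ} (K : Set (E n)) (u : E n) : ℝ :=
  sSup ((fun x : E n => inner ℝ x u) '' K)

/-- `u` is an exterior unit normal vector of `K` at the point `x`. -/
def IsUnitNormal {n : ℕ} (K : Set (E n)) (x : E n) (u : Sphere n) : Prop :=
  ∀ y ∈ K, inner ℝ (y - x) (u : E n) ≤ 0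

/-- The set of boundary points of `K` at which there is exactly one exterior unit normal. -/
def regularBoundary {n : ℕ} (K : Set (E n)) : Set (E n) :=
  {x | x ∈ frontier K ∧ ∃! u : Sphere n, IsUnitNormal K x u}

/-- The spherical Gauss map: it sends a regular boundary point to its exterior unit normal. -/
def gaussMap {n : ℕ} (K : Set (E n)) (x : regularBoundary K) : Sphere n :=
  x.2.2.choose

theorem isUnitNormal_iff_gaussMap {n : ℕ} (K : Set (E n)) (x : regularBoundary K)
    (u : Sphere n) : IsUnitNormal K x u ↔ gaussMap K x = u := by
  have h := x.2.2.choose_spec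
  refine ⟨fun hu => (h.2 u hu).symm, ?_⟩
  rintro rfl
  exact h.1

theorem continuous_gaussMap {n : ℕ} (K : Set (E n)) : Continuous (gaussMap K) := by
  rw [continuous_iff_isClosed]
  intro F hF
  have hG : IsClosed {q : regularBoundary K × Sphere n |
      IsUnitNormal K (q.1 : E n) q.2 ∧ q.2 ∈ F} := by
    refine IsClosed.inter (s₁ := {q : regularBoundary K × Sphere n |
      IsUnitNormal K (q.1 : E n) q.2}) ?_ (hF.preimage continuous_snd)
    have hset : {q : regularBoundary K × Sphere n | IsUnitNormal K (q.1 : E n) q.2} =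
        ⋂ y ∈ K, {q : regularBoundary K × Sphere n |
          inner ℝ (y - (q.1 : E n)) (q.2 : E n) ≤ 0} := by
      ext q
      simp [IsUnitNormal]
    rw [hset]
    refine isClosed_iInter fun y => isClosed_iInter fun _ => ?_
    exact isClosed_le (by fun_prop) continuous_const
  convert isClosedMap_fst_of_compactSpace _ hG using 1
  ext x
  simp only [Set.mem_preimage, Set.mem_image, Set.mem_ofPred_eq, Prod.exists]
  constructor
  · intro hx
    exact ⟨x, gaussMap K x, ⟨(isUnitNormal_iff_gaussMap K x _).2 rfl, hx⟩, rfl⟩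
  · rintro ⟨a, b, ⟨hab, hb⟩, rfl⟩
    rwa [(isUnitNormal_iff_gaussMap K a b).1 hab]

/-- The surface area measure `S_K`: the image under the Gauss map of the `(n-1)`-dimensional
Hausdorff measure on the regular boundary. `μHE[d]` is the Hausdorff measure normalized so that
it coincides with Lebesgue measure on `d`-dimensional affine subspaces. -/
def surfaceAreaMeasure {n : ℕ} (K : Set (E n)) : Measure (Sphere n) :=
  Measure.map (gaussMap K) (μHE[n - 1] : Measure (regularBoundary K))

/-- `S_K(η)` is the `(n-1)`-dimensional Hausdorff measure of the inverse image of `η` under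
the Gauss map, for every Borel set `η` of the sphere. -/
theorem surfaceAreaMeasure_apply {n : ℕ} (K : Set (E n)) {η : Set (Sphere n)}
    (hη : MeasurableSet η) :
    surfaceAreaMeasure K η =
      (μHE[n - 1] : Measure (E n)) ((fun x : regularBoundary K => (x : E n)) ''
        (gaussMap K ⁻¹' η)) := by
  rw [surfaceAreaMeasure, Measure.map_apply (continuous_gaussMap K).measurable hη]
  exact (isometry_subtype_coe.euclideanHausdorffMeasure_image _).symm

/-- The `L_p` surface area measure, `dS_{p,K} = h_K^{1-p} dS_K`. -/
def lpSurfaceAreaMeasure {n : ℕ} (p : ℝ) (K : Set (E n)) : Measure (Sphere n) :=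
  (surfaceAreaMeasure K).withDensity
    (fun u => ENNReal.ofReal (supportFunction K (u : E n) ^ (1 - p)))

/-- The spherical Lebesgue measure on the unit sphere of `E n`. -/
def sphericalMeasure (n : ℕ) : Measure (Sphere n) := μHE[n - 1]

/-- The great subsphere of unit vectors lying in the linear subspace `H`. -/
def subsphere {n : ℕ} (H : Submodule ℝ (E n)) : Set (Sphere n) := {u | (u : E n) ∈ H}

/-- The spherical Lebesgue measure on the unit sphere of the linear subspace `H`, i.e. the
`(dim H - 1)`-dimensional Hausdorff measure on it, viewed as a measure on the whole sphere. -/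
def subsphereMeasure {n : ℕ} (H : Submodule ℝ (E n)) : Measure (Sphere n) :=
  (μHE[Module.finrank ℝ H - 1] : Measure (Sphere n)).restrict (subsphere H)

/-- `μ` is absolutely continuous with respect to `ν`, and the nonnegative real function `f` is
(a version of) its density. -/
def HasDensity {α : Type*} [MeasurableSpace α] (μ ν : Measure α) (f : α → ℝ) : Prop :=
  Measurable f ∧ (∀ x, 0 ≤ f x) ∧ μ = ν.withDensity (fun x => ENNReal.ofReal (f x))

/-- The answer to the problem of Chen, Feng and Liu is affirmative in dimension `n` for the
exponent `p`. -/
def BoundedDensityAffirmative (n : ℕ) (p : ℝ) : Prop :=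
  ∀ l : ℝ, 1 < l → ∃ C : ℝ, 0 < C ∧
    ∀ L : ConvexBody (E n), (0 : E n) ∈ interior (L : Set (E n)) →
      ∀ f : Sphere n → ℝ,
        HasDensity (surfaceAreaMeasure (L : Set (E n))) (sphericalMeasure n) f →
        (∀ᵐ u : Sphere n ∂(sphericalMeasure n),
          l⁻¹ ≤ supportFunction (L : Set (E n)) (u : E n) ^ (1 - p) * f u ∧
          supportFunction (L : Set (E n)) (u : E n) ^ (1 - p) * f u ≤ l) →
        (∀ u : Sphere n, supportFunction (L : Set (E n)) (u : E n) ≤ C) ∧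
          C⁻¹ ≤ (volume (L : Set (E n))).toReal

end LpMinkowski

end

noncomputable section

namespace LpMinkowski

open Set Filter Topology
open scoped Pointwise Gradient ENNReal NNReal

/-! ### Gauge, exit points and outer normals of bodies containing the origin. -/

section

/-! Blow up a degenerating sequence by linear maps and pass to the limit. If the a priori bounds
fail for some `l`, there are bodies `L m` with density bounds `l` that become unbounded or lose
their volume. Write `L m = M m '' K m`, where `K m` contains the origin and the standard basis and
lies in a ball of radius `√n` (`exists_equiv_normalizing`). Write the adjoint of `M m` as `t m • B
m` with `‖B m‖ = 1`. After passing to a subsequence, `K m → K` in the Hausdorff distance and `B m →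
B ≠ 0`. The limit `K` is the required body and the range of `B` is the required subspace.

The estimates run through the cone-volume measure `coneVolume`, which transforms explicitly under
linear maps, is weakly continuous, and is comparable to `h dS`. The comparison, `coneVolume_bounds`,
loses a factor `8 ^ n`; this is harmless, since only boundedness of densities is claimed. It is
proved locally, by central projection of a small piece of the boundary to a hyperplane. The density
bounds say that `h dS` is comparable to `h ^ p dσ` on `L m`, with `σ` the spherical measure. Since
the support function of `L m` at `u` is `t m` times that of `K m` at `B m u`, the measure
`coneVolume (K m)` is comparable, up to a scalar `scale`, to the image of `h (B m u) ^ p dσ(u)`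
under `u ↦ nrm (B m u)`. Total masses keep the scalar away from zero and infinity. In the limit
`coneVolume K` is comparable to `h ^ p` times `rangeMeasure p B`, and the latter is comparable to
the spherical measure of the range of `B` (`exists_rangeMeasure_bounds`).

Dividing by `h ^ p` gives the statement on the `L_p` surface area measure, provided that `h > 0`
almost everywhere. This is `ae_supportFunction_pos`: the bodies `K m` have bounded surface area,
which controls the integral of `1 / h` against `coneVolume (K m)`, and as `p < 1` Fatou's lemma
excludes zeros of positive measure.

If `B` were invertible, the bounds on the scalar would confine `t m` to a compact subset of `(0,
∞)`, and `L m` could not degenerate (`range_ne_top`). So the range is a proper subspace that carries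
all normals of `K`. A body with the origin in its interior has normals outside any proper subspace
on a set of positive cone volume, hence the origin lies on the boundary (`zero_mem_frontier`). -/

/-- The scaling of a nonzero vector to a unit vector. -/
def nrm {n : ℕ} (v : E n) : E n := ‖v‖⁻¹ • v

/-- Convex bodies with nonempty interior that contain the origin. -/
structure IsBody {n : ℕ} (K : Set (E n)) : Prop where
  convex : Convex ℝ K
  isCompact : IsCompact K
  zero_mem : (0 : E n) ∈ K
  interior_nonempty : (interior K).Nonempty

/-- `v` is an outer normal vector of `K` at `x`. -/
def IsNormal {n : ℕ} (K : Set (E n)) (x v : E n) : Prop :=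
  ∀ y ∈ K, inner ℝ y v ≤ inner ℝ x v

/-- The interior points of `K`, except the origin, at which the gauge is differentiable. -/
def gaugeDiffSet {n : ℕ} (K : Set (E n)) : Set (E n) :=
  {x | x ∈ interior K ∧ x ≠ 0 ∧ DifferentiableAt ℝ (gauge K) x}

/-- The outer unit normal seen from `x`: the normalized gradient of the gauge. -/
def normalMap {n : ℕ} (K : Set (E n)) (x : E n) : E n := nrm (∇ (gauge K) x)

variable {n : ℕ} {K : Set (E n)}

theorem norm_nrm {v : E n} (hv : v ≠ 0) : ‖nrm v‖ = 1 := by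
  simp [nrm, norm_smul, hv]

theorem nrm_of_norm_eq_one {v : E n} (hv : ‖v‖ = 1) : nrm v = v := by
  simp [nrm, hv]

theorem nrm_smul {v : E n} {t : ℝ} (ht : 0 < t) : nrm (t • v) = nrm v := by
  simp only [nrm, norm_smul, Real.norm_eq_abs, abs_of_pos ht, smul_smul]
  congr 1
  field_simp

theorem measurable_nrm : Measurable (nrm (n := n)) := by
  unfold nrm; fun_prop

theorem continuousAt_nrm {v : E n} (hv : v ≠ 0) : ContinuousAt nrm v := by
  unfold nrm
  exact ((continuous_norm.continuousAt).inv₀ (norm_ne_zero_iff.2 hv)).smul continuousAt_id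

theorem isUnitNormal_iff_isNormal (K : Set (E n)) (x : E n) (u : Sphere n) :
    IsUnitNormal K x u ↔ IsNormal K x u := by
  simp [IsUnitNormal, IsNormal, inner_sub_left]

theorem isNormal_gaussMap (a : regularBoundary K) : IsNormal K (a : E n) (gaussMap K a : E n) :=
  (isUnitNormal_iff_isNormal _ _ _).1 ((isUnitNormal_iff_gaussMap K a _).2 rfl)

theorem measurableSet_gaugeDiffSet (K : Set (E n)) : MeasurableSet (gaugeDiffSet K) := by
  refine isOpen_interior.measurableSet.inter ((measurableSet_singleton 0).compl.inter ?_)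
  exact measurableSet_of_differentiableAt ℝ (gauge K)

namespace IsBody

theorem isClosed (hK : IsBody K) : IsClosed K := hK.isCompact.isClosed

theorem exists_norm_le (hK : IsBody K) : ∃ R : ℝ, 0 < R ∧ ∀ x ∈ K, ‖x‖ ≤ R := by
  obtain ⟨R, hR⟩ := hK.isCompact.isBounded.exists_norm_le
  exact ⟨max R 1, by positivity, fun x hx => (hR x hx).trans (le_max_left _ _)⟩

theorem gauge_le_of_smul_mem {x : E n} {t : ℝ} (ht : 0 < t) (hx : t • x ∈ K) :
    gauge K x ≤ t⁻¹ := by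
  refine gauge_le_of_mem (inv_nonneg.2 ht.le) ?_
  rw [mem_smul_set_iff_inv_smul_mem₀ (inv_ne_zero ht.ne')]
  simpa using hx

theorem gauge_pos (hK : IsBody K) {x : E n} (hx : x ∈ K) (h0 : x ≠ 0) : 0 < gauge K x := by
  obtain ⟨R, hR, hb⟩ := hK.exists_norm_le
  have : ‖x‖ / R ≤ gauge K x := by
    rw [gauge_def']
    refine le_csInf ⟨1, by simp, by simpa using hx⟩ ?_
    rintro r ⟨hr, hrx⟩
    have hr : 0 < r := hr
    have := hb _ hrx
    rw [norm_smul, norm_inv, Real.norm_eq_abs, abs_of_pos hr] at this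
    rw [div_le_iff₀ hR]
    rw [inv_mul_le_iff₀ hr] at this
    linarith
  exact lt_of_lt_of_le (by positivity) this

theorem inv_gauge_smul_mem (hK : IsBody K) {x : E n} (hx : x ∈ K) (h0 : x ≠ 0) :
    (gauge K x)⁻¹ • x ∈ K := by
  have hpos := hK.gauge_pos hx h0
  have hne : ({r : ℝ | r ∈ Ioi (0 : ℝ) ∧ r⁻¹ • x ∈ K}).Nonempty := ⟨1, by simp, by simpa using hx⟩
  have hbdd : BddBelow {r : ℝ | r ∈ Ioi (0 : ℝ) ∧ r⁻¹ • x ∈ K} := ⟨0, fun r hr => le_of_lt hr.1⟩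
  obtain ⟨u, -, hu, hmem⟩ := exists_seq_tendsto_sInf hne hbdd
  rw [← gauge_def'] at hu
  refine hK.isClosed.mem_of_tendsto ((hu.inv₀ hpos.ne').smul_const x) ?_
  exact Eventually.of_forall fun k => (hmem k).2

theorem gauge_le_one {x : E n} (hx : x ∈ K) : gauge K x ≤ 1 := gauge_le_one_of_mem hx

theorem norm_le_gauge_mul (hK : IsBody K) {R : ℝ} (hR : ∀ x ∈ K, ‖x‖ ≤ R) {x : E n} (hx : x ∈ K) :
    ‖x‖ ≤ gauge K x * R := by
  by_cases h0 : x = 0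
  · simp [h0]
  have hpos := hK.gauge_pos hx h0
  have := hR _ (hK.inv_gauge_smul_mem hx h0)
  rw [norm_smul, norm_inv, Real.norm_eq_abs, abs_of_pos hpos, inv_mul_le_iff₀ hpos] at this
  exact this

theorem exists_add_smul_mem {x : E n} (hx : x ∈ interior K) (v : E n) :
    ∃ δ : ℝ, 0 < δ ∧ x + δ • v ∈ K := by
  have hc : ContinuousAt (fun t : ℝ => x + t • v) 0 := by fun_prop
  have : ∀ᶠ t in 𝓝 (0 : ℝ), x + t • v ∈ K := by
    apply hc.eventually
    simpa using mem_interior_iff_mem_nhds.1 hx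
  obtain ⟨ε, hε, h⟩ := Metric.eventually_nhds_iff.1 this
  exact ⟨ε / 2, by positivity, h (by simp [abs_of_pos hε, hε])⟩

theorem inner_lt_of_isNormal {x y v : E n} (hx : x ∈ interior K) (hv : v ≠ 0)
    (h : IsNormal K y v) : inner ℝ x v < inner ℝ y v := by
  obtain ⟨δ, hδ, hm⟩ := exists_add_smul_mem hx v
  have := h _ hm
  rw [inner_add_left, inner_smul_left] at this
  have h2 : 0 < inner ℝ v v := real_inner_self_pos.2 hv
  simp only [conj_trivial] at this
  nlinarith

/-- A point on the ray through an interior point at which `K` has a normal is the exit point. -/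
theorem eq_inv_gauge_of_isNormal (hK : IsBody K) {x v : E n} (hx : x ∈ interior K) {t : ℝ}
    (ht : 0 < t) (htx : t • x ∈ K) (hv : v ≠ 0) (h : IsNormal K (t • x) v) :
    0 < inner ℝ x v ∧ t = (gauge K x)⁻¹ := by
  have h1 := inner_lt_of_isNormal hx hv h
  have h0 := h 0 hK.zero_mem
  rw [inner_smul_left] at h0 h1
  simp only [inner_zero_left, conj_trivial] at h0 h1
  have hpos : 0 < inner ℝ x v := by
    rcases (nonneg_of_mul_nonneg_right h0 ht).eq_or_lt with h2 | h2
    · rw [← h2] at h1; simp at h1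
    · exact h2
  have hx0 : x ≠ 0 := by rintro rfl; simp at hpos
  refine ⟨hpos, le_antisymm ?_ ?_⟩
  · have hg := gauge_le_of_smul_mem ht htx
    exact (le_inv_comm₀ ht (hK.gauge_pos (interior_subset hx) hx0)).2 hg
  · have := h _ (hK.inv_gauge_smul_mem (interior_subset hx) hx0)
    rw [inner_smul_left, inner_smul_left] at this
    simp only [conj_trivial] at this
    exact le_of_mul_le_mul_right this hpos

/-- Separate `y` from the open convex set `interior K`; the inequality extends to `K` because a
convex set with interior points lies in the closure of its interior. -/
theorem exists_isNormal (hK : IsBody K) {y : E n} (hy : y ∉ interior K) :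
    ∃ v : E n, ‖v‖ = 1 ∧ IsNormal K y v := by
  obtain ⟨f, hf⟩ := geometric_hahn_banach_open_point hK.convex.interior isOpen_interior hy
  set w := (InnerProductSpace.toDual ℝ (E n)).symm f with hw
  have hfw : ∀ z, f z = inner ℝ z w := fun z => by
    rw [real_inner_comm, hw, InnerProductSpace.toDual_symm_apply]
  obtain ⟨z0, hz0⟩ := hK.interior_nonempty
  have hw0 : w ≠ 0 := by
    intro h0
    have := hf z0 hz0
    simp [hfw, h0] at this
  refine ⟨nrm w, norm_nrm hw0, fun z hz => ?_⟩
  have hle : inner ℝ z w ≤ inner ℝ y w := by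
    have hcl : z ∈ closure (interior K) := by
      rw [hK.convex.closure_interior_eq_closure_of_nonempty_interior hK.interior_nonempty]
      exact subset_closure hz
    have hclosed : IsClosed {z : E n | inner ℝ z w ≤ inner ℝ y w} :=
      isClosed_le (by fun_prop) continuous_const
    refine closure_minimal (fun z hz => ?_) hclosed hcl
    have := hf z hz
    rw [hfw, hfw] at this
    exact this.le
  simp only [nrm, inner_smul_right]
  gcongr

theorem inv_gauge_smul_notMem_interior (hK : IsBody K) {x : E n} (hx : x ∈ K) (h0 : x ≠ 0) :
    (gauge K x)⁻¹ • x ∉ interior K := by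
  intro hint
  have hpos := hK.gauge_pos hx h0
  obtain ⟨δ, hδ, hm⟩ := exists_add_smul_mem hint x
  rw [← add_smul] at hm
  have := gauge_le_of_smul_mem (by positivity) hm
  rw [le_inv_comm₀ hpos (by positivity)] at this
  linarith

theorem inv_gauge_smul_mem_frontier (hK : IsBody K) {x : E n} (hx : x ∈ K) (h0 : x ≠ 0) :
    (gauge K x)⁻¹ • x ∈ frontier K := by
  rw [hK.isClosed.frontier_eq]
  exact ⟨hK.inv_gauge_smul_mem hx h0, hK.inv_gauge_smul_notMem_interior hx h0⟩

/-- At a differentiability point of the gauge the exit point has a single unit normal. -/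
theorem eq_normalMap (hK : IsBody K) {x v : E n} (hx : x ∈ gaugeDiffSet K) (hv : ‖v‖ = 1)
    (h : IsNormal K ((gauge K x)⁻¹ • x) v) : v = normalMap K x := by
  obtain ⟨hxi, hx0, hd⟩ := hx
  have hv0 : v ≠ 0 := by rintro rfl; simp at hv
  have hxK := interior_subset hxi
  have hpos := hK.gauge_pos hxK hx0
  have hip := (hK.eq_inv_gauge_of_isNormal hxi (inv_pos.2 hpos) (hK.inv_gauge_smul_mem hxK hx0)
    hv0 h).1
  set c := inner ℝ ((gauge K x)⁻¹ • x) v with hc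
  have hcpos : 0 < c := by
    rw [hc, inner_smul_left]; simp only [conj_trivial]; positivity
  have hcx : c * gauge K x = inner ℝ x v := by
    rw [hc, inner_smul_left]; simp only [conj_trivial]; field_simp
  -- The supporting inequality at the exit point of `z` says that this function is nonnegative, and
  -- it vanishes at `x`. Hence `v` is a positive multiple of the gradient of the gauge.
  have hmin : IsLocalMin (fun z => c * gauge K z - inner ℝ z v) x := by
    have hev : ∀ᶠ z in 𝓝 x, z ∈ K ∧ z ≠ 0 :=
      Eventually.and (mem_interior_iff_mem_nhds.1 hxi) (isOpen_ne.mem_nhds hx0)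
    filter_upwards [hev] with z hz
    rw [hcx, sub_self]
    have hz' := h _ (hK.inv_gauge_smul_mem hz.1 hz.2)
    have hgz := hK.gauge_pos hz.1 hz.2
    rw [← hc, inner_smul_left] at hz'
    simp only [conj_trivial] at hz'
    rw [inv_mul_le_iff₀ hgz] at hz'
    linarith
  have hgrad : HasGradientAt (gauge K) (∇ (gauge K) x) x := hd.hasGradientAt
  have hder : HasFDerivAt (fun z => c * gauge K z - inner ℝ z v)
      (c • (InnerProductSpace.toDual ℝ (E n) (∇ (gauge K) x)) - InnerProductSpace.toDual ℝ (E n) v)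
      x := by
    have h1 := (hgrad.hasFDerivAt).const_mul c
    have h2 : HasFDerivAt (fun z : E n => inner ℝ z v) (InnerProductSpace.toDual ℝ (E n) v) x := by
      have := (InnerProductSpace.toDual ℝ (E n) v).hasFDerivAt (x := x)
      refine this.congr_of_eventuallyEq (Eventually.of_forall fun z => ?_)
      simp [real_inner_comm]
    exact h1.sub h2
  have hz := hmin.hasFDerivAt_eq_zero hder
  have hv' : v = c • ∇ (gauge K) x := by
    apply (InnerProductSpace.toDual ℝ (E n)).injective
    rw [sub_eq_zero] at hz
    rw [← hz]
    simp
  rw [normalMap, ← nrm_smul hcpos, ← hv', nrm_of_norm_eq_one hv]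

theorem norm_normalMap (hK : IsBody K) {x : E n} (hx : x ∈ gaugeDiffSet K) :
    ‖normalMap K x‖ = 1 ∧ IsNormal K ((gauge K x)⁻¹ • x) (normalMap K x) := by
  obtain ⟨v, hv, h⟩ := hK.exists_isNormal
    (hK.inv_gauge_smul_notMem_interior (interior_subset hx.1) hx.2.1)
  have := hK.eq_normalMap hx hv h
  exact ⟨this ▸ hv, this ▸ h⟩

theorem exit_mem_regularBoundary (hK : IsBody K) {x : E n} (hx : x ∈ gaugeDiffSet K) :
    (gauge K x)⁻¹ • x ∈ regularBoundary K := by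
  refine ⟨hK.inv_gauge_smul_mem_frontier (interior_subset hx.1) hx.2.1,
    ⟨normalMap K x, by simpa using (hK.norm_normalMap hx).1⟩,
    (isUnitNormal_iff_isNormal _ _ _).2 (hK.norm_normalMap hx).2, fun u hu => ?_⟩
  ext1
  exact hK.eq_normalMap hx (by simp) ((isUnitNormal_iff_isNormal _ _ _).1 hu)

theorem gaussMap_exit (hK : IsBody K) {x : E n} (hx : x ∈ gaugeDiffSet K) :
    (gaussMap K ⟨_, hK.exit_mem_regularBoundary hx⟩ : E n) = normalMap K x := by
  have := (isUnitNormal_iff_gaussMap K ⟨_, hK.exit_mem_regularBoundary hx⟩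
    ⟨normalMap K x, by simpa using (hK.norm_normalMap hx).1⟩).1
    ((isUnitNormal_iff_isNormal _ _ _).2 (hK.norm_normalMap hx).2)
  rw [this]

/-- The origin may lie on the boundary, so `K` need not be absorbing and the gauge is only well
behaved locally. Here `y` is a convex combination of `x` and of the point `z` of `K` at distance `δ`
from `x` in the direction of `y`; the latter has weight `‖y - x‖ / δ` and gauge at most one. -/
theorem gauge_sub_le (hK : IsBody K) {x y : E n} {δ : ℝ} (hδ : 0 < δ)
    (hball : Metric.closedBall x δ ⊆ K) (hx : x ≠ 0) (hxy : ‖y - x‖ ≤ δ) :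
    gauge K y ≤ gauge K x + ‖y - x‖ / δ := by
  have hxK : x ∈ K := hball (Metric.mem_closedBall_self hδ.le)
  by_cases hyx : y = x
  · simp [hyx]
  have hη : 0 < ‖y - x‖ := norm_pos_iff.2 (sub_ne_zero.2 hyx)
  set η := ‖y - x‖ with hηd
  set z := x + (δ / η) • (y - x) with hz
  have hzK : z ∈ K := by
    apply hball
    rw [hz, mem_closedBall_iff_norm]
    simp only [add_sub_cancel_left, norm_smul, norm_div, Real.norm_eq_abs, abs_of_pos hδ,
      abs_of_pos hη, ← hηd]
    field_simp; exact le_rfl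
  have hg := hK.gauge_pos hxK hx
  have hgK := hK.inv_gauge_smul_mem hxK hx
  set g := gauge K x
  set s := (1 - η / δ) * g + η / δ with hs
  have hηδ : η / δ ≤ 1 := (div_le_one hδ).2 hxy
  have hηδ' : 0 < η / δ := by positivity
  have hspos : 0 < s := by
    have : 0 ≤ (1 - η / δ) * g := mul_nonneg (by linarith) hg.le
    linarith
  have hmem : s⁻¹ • y ∈ K := by
    have := hK.convex hgK hzK (a := (1 - η / δ) * g / s) (b := (η / δ) / s)
      (div_nonneg (mul_nonneg (by linarith) hg.le) hspos.le) (by positivity)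
      (by rw [← add_div, ← hs, div_self hspos.ne'])
    convert this using 1
    rw [hz, smul_smul, smul_add, smul_smul, smul_sub]
    have e1 : (1 - η / δ) * g / s * g⁻¹ = s⁻¹ - s⁻¹ * (η / δ) := by field_simp
    have e2 : η / δ / s * (δ / η) = s⁻¹ := by field_simp
    have e3 : η / δ / s = s⁻¹ * (η / δ) := by field_simp
    rw [e1, e2, e3]
    module
  have := gauge_le_of_smul_mem (inv_pos.2 hspos) hmem
  rw [inv_inv] at this
  refine this.trans ?_
  rw [hs]
  nlinarith

theorem exists_lipschitzOnWith_gauge (hK : IsBody K) {x : E n} (hx : x ∈ interior K) (h0 : x ≠ 0) :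
    ∃ r > 0, ∃ C, LipschitzOnWith C (gauge K) (Metric.ball x r) := by
  have hopen : interior K ∩ {0}ᶜ ∈ 𝓝 x :=
    (isOpen_interior.inter isOpen_compl_singleton).mem_nhds ⟨hx, h0⟩
  obtain ⟨δ, hδ, hb⟩ := Metric.mem_nhds_iff.1 hopen
  refine ⟨δ / 4, by positivity, ⟨(δ / 2)⁻¹, by positivity⟩, ?_⟩
  refine LipschitzOnWith.of_le_add_mul _ fun y hy z hz => ?_
  rw [Metric.mem_ball] at hy hz
  have hsub : Metric.closedBall z (δ / 2) ⊆ K := fun w hw => by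
    rw [Metric.mem_closedBall] at hw
    refine interior_subset (hb ?_).1
    rw [Metric.mem_ball]
    linarith [dist_triangle w z x]
  have hz0 : z ≠ 0 := (hb (show z ∈ Metric.ball x δ by rw [Metric.mem_ball]; linarith)).2
  have hyz : ‖y - z‖ ≤ δ / 2 := by
    rw [← dist_eq_norm]; linarith [dist_triangle_right y z x]
  have := hK.gauge_sub_le (by positivity) hsub hz0 hyz
  simp only [dist_eq_norm] at this ⊢
  rw [div_eq_inv_mul] at this
  exact this

/-- Rademacher's theorem, applied on small balls where the gauge is Lipschitz. -/
theorem ae_differentiableAt_gauge (hK : IsBody K) :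
    volume ((interior K \ {0}) \ gaugeDiffSet K) = 0 := by
  refine measure_null_of_locally_null _ fun x hx => ?_
  obtain ⟨r, hr, C, hC⟩ := hK.exists_lipschitzOnWith_gauge hx.1.1 hx.1.2
  refine ⟨_, inter_mem self_mem_nhdsWithin (mem_nhdsWithin_of_mem_nhds (Metric.ball_mem_nhds x hr)),
    ?_⟩
  have := hC.ae_differentiableWithinAt_of_mem (μ := volume)
  rw [ae_iff] at this
  refine measure_mono_null ?_ this
  rintro y ⟨⟨hy, hnd⟩, hyb⟩
  simp only [mem_ofPred_eq, Classical.not_imp]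
  refine ⟨hyb, fun hd => hnd ⟨hy.1, hy.2, ?_⟩⟩
  exact hd.differentiableAt (Metric.isOpen_ball.mem_nhds hyb)

theorem volume_gaugeDiffSet (hK : IsBody K) (hn : 0 < n) : volume (gaugeDiffSet K) = volume K := by
  have : Nonempty (Fin n) := ⟨⟨0, hn⟩⟩
  have : Nontrivial (E n) := inferInstance
  apply le_antisymm (measure_mono fun x hx => interior_subset hx.1)
  have hsub : K ⊆ gaugeDiffSet K ∪ ((interior K \ {0}) \ gaugeDiffSet K) ∪ frontier K ∪ {0} := by
    intro x hx
    by_cases h0 : x = 0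
    · simp [h0]
    by_cases hxi : x ∈ interior K
    · by_cases hd : x ∈ gaugeDiffSet K
      · simp [hd]
      · simp [hd, hxi, h0]
    · left; right
      rw [hK.isClosed.frontier_eq]; exact ⟨hx, hxi⟩
  refine (measure_mono hsub).trans ?_
  refine (measure_union_le _ _).trans ?_
  rw [measure_singleton, add_zero]
  refine (measure_union_le _ _).trans ?_
  rw [hK.convex.addHaar_frontier volume, add_zero]
  refine (measure_union_le _ _).trans ?_
  rw [hK.ae_differentiableAt_gauge, add_zero]

theorem mem_of_mem_regularBoundary (hK : IsBody K) {a : E n} (ha : a ∈ regularBoundary K) :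
    a ∈ K := by
  have := frontier_subset_closure ha.1
  rwa [hK.isClosed.closure_eq] at this

/-- Below a regular boundary point whose tangent plane misses the origin, the open segment to the
origin is interior. -/
theorem smul_mem_interior_of_regular (hK : IsBody K) (a : regularBoundary K)
    (hpos : 0 < inner ℝ (a : E n) (gaussMap K a : E n)) {t : ℝ} (h0 : 0 < t) (h1 : t < 1) :
    t • (a : E n) ∈ interior K := by
  by_contra hni
  obtain ⟨v, hv, hN⟩ := hK.exists_isNormal hni
  have haK := hK.mem_of_mem_regularBoundary a.2
  have hz := hN 0 hK.zero_mem
  have ha := hN _ haK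
  rw [inner_smul_left] at hz ha
  simp only [inner_zero_left, conj_trivial] at hz ha
  -- Testing the normal `v` at `t • a` against the origin and against `a` forces `⟪a, v⟫ = 0`. Then
  -- `v` is also a normal at `a`, so it is the Gauss image, contradicting `hpos`.
  have hav : inner ℝ (a : E n) v = 0 := by
    have := nonneg_of_mul_nonneg_right hz h0
    nlinarith
  have hNa : IsNormal K (a : E n) v := fun y hy => by
    have := hN y hy
    rw [inner_smul_left] at this
    simpa [hav] using this
  have := (isUnitNormal_iff_gaussMap K a ⟨v, by simpa using hv⟩).1
    ((isUnitNormal_iff_isNormal _ _ _).2 hNa)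
  rw [this] at hpos
  simp [hav] at hpos

theorem gauge_smul_of_regular (hK : IsBody K) (a : regularBoundary K)
    (hpos : 0 < inner ℝ (a : E n) (gaussMap K a : E n)) {t : ℝ} (h0 : 0 < t) (h1 : t < 1) :
    gauge K (t • (a : E n)) = t := by
  have hi := hK.smul_mem_interior_of_regular a hpos h0 h1
  have hv0 : (gaussMap K a : E n) ≠ 0 := by
    intro h; rw [h] at hpos; simp at hpos
  have e : t⁻¹ • (t • (a : E n)) = a := by rw [smul_smul, inv_mul_cancel₀ h0.ne', one_smul]
  have := (hK.eq_inv_gauge_of_isNormal hi (inv_pos.2 h0)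
    (by rw [e]; exact hK.mem_of_mem_regularBoundary a.2) hv0
    (by rw [e]; exact isNormal_gaussMap a)).2
  exact (inv_injective this).symm

end IsBody

theorem supportFunction_eq_of_isNormal {a u : E n} (ha : a ∈ K) (h : IsNormal K a u) :
    supportFunction K u = inner ℝ a u := by
  refine IsGreatest.csSup_eq ⟨⟨a, ha, rfl⟩, ?_⟩
  rintro _ ⟨y, hy, rfl⟩
  exact h y hy

end

/-! ### Hausdorff measure under Lipschitz maps, volumes of cones, central projection. -/

section

variable {n : ℕ} {K : Set (E n)}

section Hausdorff

theorem euclideanHausdorffMeasure_image_le {X Y : Type*} [EMetricSpace X] [MeasurableSpace X]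
    [BorelSpace X] [EMetricSpace Y] [MeasurableSpace Y] [BorelSpace Y] {f : X → Y} {s : Set X}
    {C : ℝ≥0} (hf : LipschitzOnWith C f s) (d : ℕ) :
    (μHE[d] : Measure Y) (f '' s) ≤ (C : ℝ≥0∞) ^ d * (μHE[d] : Measure X) s := by
  simp only [Measure.euclideanHausdorffMeasure_def, Measure.smul_apply]
  have := hf.hausdorffMeasure_image_le (d := d) (Nat.cast_nonneg d)
  rw [ENNReal.rpow_natCast] at this
  rw [ENNReal.smul_def, ENNReal.smul_def, smul_eq_mul, smul_eq_mul, mul_left_comm]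
  gcongr

theorem euclideanHausdorffMeasure_le_image {X Y : Type*} [EMetricSpace X] [MeasurableSpace X]
    [BorelSpace X] [EMetricSpace Y] [MeasurableSpace Y] [BorelSpace Y] {f : X → Y} {s : Set X}
    {C : ℝ≥0} (hf : ∀ x ∈ s, ∀ y ∈ s, edist x y ≤ C * edist (f x) (f y)) (d : ℕ) :
    (μHE[d] : Measure X) s ≤ (C : ℝ≥0∞) ^ d * (μHE[d] : Measure Y) (f '' s) := by
  rcases s.eq_empty_or_nonempty with rfl | ⟨x0, -⟩
  · simp
  have : Nonempty X := ⟨x0⟩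
  have hinj : InjOn f s := fun x hx y hy hxy => by
    have := hf x hx y hy
    rw [hxy, edist_self, mul_zero] at this
    exact edist_le_zero.1 this
  have hleft : LeftInvOn (Function.invFunOn f s) f s := hinj.leftInvOn_invFunOn
  have hlip : LipschitzOnWith C (Function.invFunOn f s) (f '' s) := by
    rintro _ ⟨x, hx, rfl⟩ _ ⟨y, hy, rfl⟩
    rw [hleft hx, hleft hy]
    exact hf x hx y hy
  have := euclideanHausdorffMeasure_image_le hlip d
  rwa [hleft.image_image] at this

end Hausdorff

section Cone

/-- The part of the open cone over `Q` strictly between the hyperplanes at heights `0` and `s`. -/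
def coneOver (u : E n) (Q : Set (E n)) (s : ℝ) : Set (E n) :=
  {x | 0 < inner ℝ x u ∧ inner ℝ x u < s ∧ (inner ℝ x u : ℝ)⁻¹ • x ∈ Q}

theorem volume_eq_lintegral_slices {u : E n} (hu : ‖u‖ = 1) {t : Set (E n)}
    (ht : MeasurableSet t) :
    volume t = ∫⁻ s : ℝ, (μHE[n - 1] : Measure (E n)) (t ∩ {x | inner ℝ x u = s}) := by
  have hu0 : u ≠ 0 := by rintro rfl; simp at hu
  have h := EuclideanGeometry.euclideanHausdorffMeasure_eq_lintegral (0 : E n) hu0 ht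
  rw [InnerProductSpace.euclideanHausdorffMeasure_eq_volume] at h
  rw [h]
  have : ‖u‖ₑ = 1 := by simp [← ofReal_norm, hu]
  rw [this, one_mul, finrank_euclideanSpace_fin]
  refine lintegral_congr fun s => ?_
  congr 2
  ext x
  have hsu : (inner ℝ (s • u) u : ℝ) = s := by
    rw [inner_smul_left]; simp [hu]
  simp only [SetLike.mem_coe, AffineSubspace.mem_mk', mem_ofPred_eq, vsub_eq_sub, vadd_eq_add,
    add_zero, Submodule.mem_orthogonal_singleton_iff_inner_left, inner_sub_left, hsu, sub_eq_zero]

theorem measurableSet_coneOver (u : E n) {Q : Set (E n)} (hQ : MeasurableSet Q) (s : ℝ) :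
    MeasurableSet (coneOver u Q s) := by
  have h : Measurable fun x : E n => (inner ℝ x u : ℝ) := by fun_prop
  exact (measurableSet_lt measurable_const h).inter
    ((measurableSet_lt h measurable_const).inter ((h.inv.smul measurable_id) hQ))

/-- The slice at height `r < s` is contained in `r • Q`; bounding `r` by `s` before integrating
costs only a dimensional factor. `Q` will be an image set, not known to be measurable, hence the
measurable hull. -/
theorem volume_coneOver_le {u : E n} (hn : 0 < n) (hu : ‖u‖ = 1) (Q : Set (E n)) (s : ℝ) :
    volume (coneOver u Q s) ≤ ENNReal.ofReal s ^ n * (μHE[n - 1] : Measure (E n)) Q := by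
  set m : Measure (E n) := μHE[n - 1] with hm
  set Q' := toMeasurable m Q
  have hQ' : MeasurableSet Q' := measurableSet_toMeasurable _ _
  have hsub : coneOver u Q s ⊆ coneOver u Q' s :=
    fun x hx => ⟨hx.1, hx.2.1, subset_toMeasurable _ _ hx.2.2⟩
  refine (measure_mono hsub).trans ?_
  rw [volume_eq_lintegral_slices hu (measurableSet_coneOver u hQ' s), ← measure_toMeasurable Q]
  have hle : ∀ r : ℝ, m (coneOver u Q' s ∩ {x | inner ℝ x u = r}) ≤
      (Ioo 0 s).indicator (fun _ => ENNReal.ofReal s ^ (n - 1) * m Q') r := by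
    intro r
    by_cases hr : r ∈ Ioo 0 s
    · rw [indicator_of_mem hr]
      have hsub : coneOver u Q' s ∩ {x | inner ℝ x u = r} ⊆ r • Q' := by
        rintro x ⟨hx, hxr⟩
        have hxr : inner ℝ x u = r := hxr
        rw [mem_smul_set_iff_inv_smul_mem₀ hr.1.ne', ← hxr]
        exact hx.2.2
      refine (measure_mono hsub).trans ?_
      rw [hm, Measure.euclideanHausdorffMeasure_smul₀ _ hr.1.ne', ENNReal.smul_def, smul_eq_mul]
      gcongr
      push_cast
      gcongr
      rw [← enorm_eq_nnnorm, ← ofReal_norm, Real.norm_eq_abs, abs_of_pos hr.1]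
      exact ENNReal.ofReal_le_ofReal hr.2.le
    · rw [indicator_of_notMem hr, nonpos_iff_eq_zero]
      convert measure_empty (μ := m)
      ext x
      simp only [mem_inter_iff, mem_ofPred_eq, mem_empty_iff_false, iff_false, not_and]
      rintro hx rfl
      exact hr ⟨hx.1, hx.2.1⟩
  refine (lintegral_mono hle).trans ?_
  rw [lintegral_indicator_const measurableSet_Ioo, Real.volume_Ioo, sub_zero, mul_right_comm,
    ← pow_succ, Nat.sub_add_cancel hn]

/-- Only the slices at heights in `(s / 2, s)` are kept, so that each is at least as large as the
one at `s / 2`. -/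
theorem le_volume_coneOver {u : E n} (hn : 0 < n) (hu : ‖u‖ = 1) {Q : Set (E n)}
    (hQ : ∀ y ∈ Q, inner ℝ y u = (1 : ℝ)) {s : ℝ} (hs : 0 < s) :
    ENNReal.ofReal (s / 2) ^ n * (μHE[n - 1] : Measure (E n)) Q ≤ volume (coneOver u Q s) := by
  set m : Measure (E n) := μHE[n - 1] with hm
  rw [← measure_toMeasurable (coneOver u Q s),
    volume_eq_lintegral_slices hu (measurableSet_toMeasurable _ _)]
  have hle : ∀ r : ℝ, (Ioo (s / 2) s).indicator (fun _ => ENNReal.ofReal (s / 2) ^ (n - 1) * m Q) r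
      ≤ m (toMeasurable volume (coneOver u Q s) ∩ {x | inner ℝ x u = r}) := by
    intro r
    by_cases hr : r ∈ Ioo (s / 2) s
    · rw [indicator_of_mem hr]
      have hr0 : 0 < r := by linarith [hr.1]
      have hsub : r • Q ⊆ toMeasurable volume (coneOver u Q s) ∩ {x | inner ℝ x u = r} := by
        rintro _ ⟨y, hy, rfl⟩
        have e : inner ℝ (r • y) u = r := by rw [inner_smul_left, hQ y hy]; simp
        refine ⟨subset_toMeasurable _ _ ?_, e⟩
        show 0 < inner ℝ (r • y) u ∧ inner ℝ (r • y) u < s ∧ (inner ℝ (r • y) u : ℝ)⁻¹ • r • y ∈ Q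
        rw [e, smul_smul, inv_mul_cancel₀ hr0.ne', one_smul]
        exact ⟨hr0, hr.2, hy⟩
      refine le_trans ?_ (measure_mono hsub)
      rw [hm, Measure.euclideanHausdorffMeasure_smul₀ _ hr0.ne', ENNReal.smul_def, smul_eq_mul]
      gcongr
      push_cast
      gcongr
      rw [← enorm_eq_nnnorm, ← ofReal_norm, Real.norm_eq_abs, abs_of_pos hr0]
      exact ENNReal.ofReal_le_ofReal hr.1.le
    · rw [indicator_of_notMem hr]; exact zero_le
  refine le_trans (le_of_eq ?_) (lintegral_mono hle)
  rw [lintegral_indicator_const measurableSet_Ioo, Real.volume_Ioo, mul_right_comm,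
    show s - s / 2 = s / 2 by ring, ← pow_succ, Nat.sub_add_cancel hn]

end Cone

section Bridge

/-- The density `⟨a, ν(a)⟩`, i.e. the support function at the normal of a regular point. -/
def normalHeight (K : Set (E n)) (a : regularBoundary K) : ℝ :=
  inner ℝ (a : E n) (gaussMap K a : E n)

theorem continuous_normalHeight (K : Set (E n)) : Continuous (normalHeight K) := by
  unfold normalHeight
  exact continuous_subtype_val.inner (continuous_subtype_val.comp (continuous_gaussMap K))

theorem continuous_gauge_restrict (K : Set (E n)) :
    Continuous fun x : gaugeDiffSet K => gauge K (x : E n) :=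
  continuous_iff_continuousAt.2 fun x =>
    ContinuousAt.comp (g := gauge K) x.2.2.2.continuousAt continuous_subtype_val.continuousAt

namespace IsBody

/-- The radial map from the differentiability set of the gauge to the regular boundary. -/
def exit (hK : IsBody K) (x : gaugeDiffSet K) : regularBoundary K :=
  ⟨(gauge K (x : E n))⁻¹ • (x : E n), hK.exit_mem_regularBoundary x.2⟩

theorem continuous_exit (hK : IsBody K) : Continuous hK.exit := by
  have h := (continuous_gauge_restrict K).inv₀
    fun x => (hK.gauge_pos (interior_subset x.2.1) x.2.2.1).ne'
  exact Continuous.subtype_mk (h.smul continuous_subtype_val) _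

/-- The cone measure on the regular boundary. -/
def coneMeasure (hK : IsBody K) : Measure (regularBoundary K) :=
  Measure.map hK.exit (Measure.comap Subtype.val volume)

theorem coneMeasure_apply (hK : IsBody K) {A : Set (regularBoundary K)} (hA : MeasurableSet A) :
    hK.coneMeasure A = volume (Subtype.val '' (hK.exit ⁻¹' A)) := by
  rw [coneMeasure, Measure.map_apply hK.continuous_exit.measurable hA,
    (MeasurableEmbedding.subtype_coe (measurableSet_gaugeDiffSet K)).comap_apply]

theorem normalHeight_exit_pos (hK : IsBody K) (x : gaugeDiffSet K) :
    0 < normalHeight K (hK.exit x) := by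
  have h0 := hK.gauge_pos (interior_subset x.2.1) x.2.2.1
  have hv : normalMap K (x : E n) ≠ 0 := by
    intro h; have := (hK.norm_normalMap x.2).1; simp [h] at this
  have := (hK.eq_inv_gauge_of_isNormal x.2.1 (inv_pos.2 h0)
    (hK.inv_gauge_smul_mem (interior_subset x.2.1) x.2.2.1) hv (hK.norm_normalMap x.2).2).1
  rw [normalHeight, exit, hK.gaussMap_exit x.2, inner_smul_left]
  simp only [conj_trivial]
  positivity

/-- Each of two boundary points lies below the tangent plane of the other; replacing both normals by
the nearby `u` costs `ε ‖a - b‖`. So a boundary piece with normals close to `u` is a Lipschitz graph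
over a hyperplane orthogonal to `u`. -/
theorem abs_inner_sub_le (a b : regularBoundary K) (hK : IsBody K) (u : E n) {ε : ℝ}
    (ha : ‖(gaussMap K a : E n) - u‖ ≤ ε) (hb : ‖(gaussMap K b : E n) - u‖ ≤ ε) :
    |(inner ℝ ((a : E n) - b) u : ℝ)| ≤ ε * ‖(a : E n) - b‖ := by
  have key : ∀ a b : regularBoundary K, ‖(gaussMap K b : E n) - u‖ ≤ ε →
      (inner ℝ ((a : E n) - b) u : ℝ) ≤ ε * ‖(a : E n) - b‖ := by
    intro a b hb
    have h1 := isNormal_gaussMap b a (hK.mem_of_mem_regularBoundary a.2)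
    have h2 : (inner ℝ ((a : E n) - b) u : ℝ) =
        inner ℝ ((a : E n) - b) (gaussMap K b : E n) -
          inner ℝ ((a : E n) - b) ((gaussMap K b : E n) - u) := by
      rw [← inner_sub_right]; simp
    have h3 := abs_real_inner_le_norm ((a : E n) - b) ((gaussMap K b : E n) - u)
    have h4 := neg_le_of_abs_le h3
    have h5 : (inner ℝ ((a : E n) - b) (gaussMap K b : E n) : ℝ) ≤ 0 := by
      rw [inner_sub_left]; linarith
    have h6 : ‖(a : E n) - b‖ * ‖(gaussMap K b : E n) - u‖ ≤ ‖(a : E n) - b‖ * ε := by gcongr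
    rw [h2]; linarith
  rw [abs_le]
  refine ⟨?_, key a b hb⟩
  have := key b a ha
  rw [← neg_sub (a : E n) b, inner_neg_left, norm_neg] at this
  linarith

/-- The central projection to a hyperplane almost parallel to the tangent planes is bi-Lipschitz. -/
theorem central_projection_bounds {a b u : E n} {h R ε : ℝ} (hh : 0 < h) (hR : 0 < R)
    (hε : ε = h / (4 * R)) (ha : |inner ℝ a u - h| ≤ h / 4) (hb : |inner ℝ b u - h| ≤ h / 4)
    (hbR : ‖b‖ ≤ R) (hab : |(inner ℝ (a - b) u : ℝ)| ≤ ε * ‖a - b‖) :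
    ‖(inner ℝ a u : ℝ)⁻¹ • a - (inner ℝ b u : ℝ)⁻¹ • b‖ ≤ (2 / h) * ‖a - b‖ ∧
      ‖a - b‖ ≤ (2 * h) * ‖(inner ℝ a u : ℝ)⁻¹ • a - (inner ℝ b u : ℝ)⁻¹ • b‖ := by
  rw [inner_sub_left] at hab
  set α : ℝ := inner ℝ a u
  set β : ℝ := inner ℝ b u
  rw [abs_le] at ha hb
  have hα : 0 < α := by linarith
  have hβ : 0 < β := by linarith
  have e : α⁻¹ • a - β⁻¹ • b = α⁻¹ • ((a - b) - ((α - β) * β⁻¹) • b) := by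
    rw [smul_sub, smul_sub, smul_smul, sub_sub, ← add_smul]
    congr 2
    field_simp; ring
  -- The choice of `ε` makes this error equal to a third: `β ≥ 3h/4` and `ε · 4/(3h) · R = 1/3`. Up
  -- to it, the difference of the projections is `α⁻¹ • (a - b)`.
  have hsmall : ‖((α - β) * β⁻¹) • b‖ ≤ ‖a - b‖ / 3 := by
    rw [norm_smul, norm_mul, norm_inv, Real.norm_eq_abs, Real.norm_eq_abs, abs_of_pos hβ]
    have hβ' : β⁻¹ ≤ (3 / 4 * h)⁻¹ := by
      apply inv_anti₀ (by positivity); linarith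
    have hε0 : 0 ≤ ε := by rw [hε]; positivity
    calc |α - β| * β⁻¹ * ‖b‖ ≤ (ε * ‖a - b‖) * (3 / 4 * h)⁻¹ * R := by gcongr
      _ = ‖a - b‖ / 3 := by rw [hε]; field_simp
  have hn : ‖α⁻¹ • a - β⁻¹ • b‖ = α⁻¹ * ‖(a - b) - ((α - β) * β⁻¹) • b‖ := by
    rw [e, norm_smul, norm_inv, Real.norm_eq_abs, abs_of_pos hα]
  have hup := norm_sub_le (a - b) (((α - β) * β⁻¹) • b)
  have hlo := norm_sub_norm_le (a - b) (((α - β) * β⁻¹) • b)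
  rw [hn]
  set N := ‖(a - b) - ((α - β) * β⁻¹) • b‖
  constructor
  · rw [inv_mul_le_iff₀ hα]
    have : N ≤ 4 / 3 * ‖a - b‖ := by linarith
    refine this.trans ?_
    rw [← mul_assoc]
    gcongr
    rw [mul_div_assoc', le_div_iff₀ hh]; linarith
  · have h1 : 2 / 3 * ‖a - b‖ ≤ N := by linarith
    rw [← mul_assoc, ← div_eq_mul_inv]
    have h2 : 3 / 2 ≤ 2 * h / α := by rw [le_div_iff₀ hα]; linarith
    have h0 : 0 ≤ N := norm_nonneg _
    nlinarith

end IsBody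

end Bridge

end

/-! ### Comparison of the cone measure with the height-weighted boundary measure. -/

section

variable {n : ℕ} {K : Set (E n)}

/-- By second countability, countably many of the sets `U` cover `P`; the comparison is summed over
a disjoint refinement. -/
theorem measure_le_of_locally_le {X : Type*} [TopologicalSpace X] [SecondCountableTopology X]
    [MeasurableSpace X] [BorelSpace X] {μ ν : Measure X} {P : Set X} (hP : MeasurableSet P)
    (hPc : μ Pᶜ = 0)
    (h : ∀ a ∈ P, ∃ U : Set X, IsOpen U ∧ a ∈ U ∧ ∀ A ⊆ U, MeasurableSet A → μ A ≤ ν A) :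
    μ ≤ ν := by
  choose! U hUo hUa hU using h
  obtain ⟨T, hTP, hTc, hTU⟩ := TopologicalSpace.isOpen_biUnion_countable P U hUo
  have hPT : P ⊆ ⋃ a ∈ T, U a := by
    rw [hTU]
    exact fun a ha => mem_biUnion ha (hUa a ha)
  refine Measure.le_iff.2 fun s hs => ?_
  have hs1 : μ s = μ (s ∩ P) := by
    refine le_antisymm ?_ (measure_mono inter_subset_left)
    calc μ s ≤ μ (s ∩ P ∪ Pᶜ) := measure_mono fun x hx => by
          by_cases hxP : x ∈ P
          · exact Or.inl ⟨hx, hxP⟩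
          · exact Or.inr hxP
      _ ≤ μ (s ∩ P) + μ Pᶜ := measure_union_le _ _
      _ = μ (s ∩ P) := by rw [hPc, add_zero]
  rw [hs1]
  rcases T.eq_empty_or_nonempty with rfl | hTn
  · have : s ∩ P = ∅ := by
      ext x; simp only [mem_inter_iff, mem_empty_iff_false, iff_false, not_and]
      intro _ hx; simpa using hPT hx
    rw [this, measure_empty]; exact zero_le
  obtain ⟨f, rfl⟩ := hTc.exists_eq_range hTn
  set V : ℕ → Set X := disjointed fun i => U (f i)
  have hVm : ∀ i, MeasurableSet (V i) :=
    MeasurableSet.disjointed fun i => (hUo _ (hTP ⟨i, rfl⟩)).measurableSet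
  have hdis : Pairwise (Function.onFun Disjoint fun i => s ∩ P ∩ V i) := fun i j hij =>
    (disjoint_disjointed _ hij).mono inter_subset_right inter_subset_right
  have hcov : s ∩ P = ⋃ i, s ∩ P ∩ V i := by
    rw [← inter_iUnion, iUnion_disjointed, eq_comm, inter_eq_left]
    intro x hx
    simpa using hPT hx.2
  calc μ (s ∩ P) = ∑' i, μ (s ∩ P ∩ V i) := by
        conv_lhs => rw [hcov]
        exact measure_iUnion hdis fun i => (hs.inter hP).inter (hVm i)
    _ ≤ ∑' i, ν (s ∩ P ∩ V i) := by
        refine ENNReal.tsum_le_tsum fun i => ?_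
        exact hU _ (hTP ⟨i, rfl⟩) _ (inter_subset_right.trans (disjointed_subset _ _))
          ((hs.inter hP).inter (hVm i))
    _ = ν (s ∩ P) := by
        conv_rhs => rw [hcov]
        exact (measure_iUnion hdis fun i => (hs.inter hP).inter (hVm i)).symm
    _ ≤ ν s := measure_mono inter_subset_left

/-- The Hausdorff measure on the regular boundary weighted by the height of the tangent planes. -/
def heightMeasure (K : Set (E n)) : Measure (regularBoundary K) :=
  (μHE[n - 1] : Measure (regularBoundary K)).withDensity
    fun a => ENNReal.ofReal (normalHeight K a)

namespace IsBody

/-- Near `a` the boundary is almost flat at height `h`. Project a piece `A` centrally to a set `Q`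
in the hyperplane `⟪x, u⟫ = 1`: the projection scales lengths by about `1 / h`, and the cone over
`Q` up to height about `h` has volume of order `h ^ n` times the measure of `Q`. Altogether this is
of order `h` times the measure of `A`. -/
theorem exists_neighborhood (hK : IsBody K) (hn : 0 < n) (a : regularBoundary K)
    (ha : 0 < normalHeight K a) :
    ∃ U : Set (regularBoundary K), IsOpen U ∧ a ∈ U ∧ ∀ A ⊆ U, MeasurableSet A →
      hK.coneMeasure A ≤ ((8 ^ n : ℝ≥0∞) • heightMeasure K) A ∧
      heightMeasure K A ≤ ((8 ^ n : ℝ≥0∞) • hK.coneMeasure) A := by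
  obtain ⟨R, hR, hKR⟩ := hK.exists_norm_le
  set h := normalHeight K a with hh
  set u : E n := (gaussMap K a : E n) with hu
  have hu1 : ‖u‖ = 1 := by simp [hu]
  set ε : ℝ := h / (4 * R) with hε
  have hε0 : 0 < ε := by positivity
  set U : Set (regularBoundary K) := {b | ‖(gaussMap K b : E n) - u‖ < ε ∧
    |inner ℝ (b : E n) u - h| < h / 4 ∧ |normalHeight K b - h| < h / 4} with hU
  have hg : Continuous fun b : regularBoundary K => (gaussMap K b : E n) :=
    continuous_subtype_val.comp (continuous_gaussMap K)
  have hnh := continuous_normalHeight K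
  have hUo : IsOpen U := by
    have h1 : IsOpen {b | ‖(gaussMap K b : E n) - u‖ < ε} :=
      isOpen_lt (by fun_prop) continuous_const
    have h2 : IsOpen {b : regularBoundary K | |inner ℝ (b : E n) u - h| < h / 4} :=
      isOpen_lt (by fun_prop) continuous_const
    have h3 : IsOpen {b | |normalHeight K b - h| < h / 4} :=
      isOpen_lt (by fun_prop) continuous_const
    exact h1.inter (h2.inter h3)
  refine ⟨U, hUo, ?_, fun A hAU hA => ?_⟩
  · refine ⟨by simpa [hu] using hε0, ?_, ?_⟩
    · have : inner ℝ (a : E n) u = h := rfl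
      rw [this]; simpa using ha
    · simpa [hh] using ha
  set π : E n → E n := fun x => (inner ℝ x u : ℝ)⁻¹ • x with hπ
  set B : Set (E n) := Subtype.val '' A with hB
  set Q : Set (E n) := π '' B with hQ
  set m : ℝ≥0∞ := (μHE[n - 1] : Measure (regularBoundary K)) A with hm
  have hmB : (μHE[n - 1] : Measure (E n)) B = m :=
    isometry_subtype_coe.euclideanHausdorffMeasure_image _
  have hinner : ∀ b ∈ A, 3 / 4 * h < inner ℝ (b : E n) u ∧ inner ℝ (b : E n) u < 5 / 4 * h := by
    intro b hb
    have := abs_lt.1 (hAU hb).2.1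
    constructor <;> linarith
  have hheight : ∀ b ∈ A, 3 / 4 * h < normalHeight K b ∧ normalHeight K b < 5 / 4 * h := by
    intro b hb
    have := abs_lt.1 (hAU hb).2.2
    constructor <;> linarith
  have hbounds : ∀ x ∈ B, ∀ y ∈ B,
      ‖π x - π y‖ ≤ (2 / h) * ‖x - y‖ ∧ ‖x - y‖ ≤ (2 * h) * ‖π x - π y‖ := by
    rintro _ ⟨b, hb, rfl⟩ _ ⟨c, hc, rfl⟩
    exact central_projection_bounds ha hR hε (hAU hb).2.1.le (hAU hc).2.1.le
      (hKR _ (hK.mem_of_mem_regularBoundary c.2))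
      (abs_inner_sub_le b c hK u (hAU hb).1.le (hAU hc).1.le)
  have hQle : (μHE[n - 1] : Measure (E n)) Q ≤ ENNReal.ofReal (2 / h) ^ (n - 1) * m := by
    rw [← hmB]
    refine euclideanHausdorffMeasure_image_le (C := (2 / h).toNNReal) ?_ _
    refine LipschitzOnWith.of_dist_le_mul fun x hx y hy => ?_
    rw [dist_eq_norm, dist_eq_norm, Real.coe_toNNReal _ (by positivity)]
    exact (hbounds x hx y hy).1
  have hleQ : m ≤ ENNReal.ofReal (2 * h) ^ (n - 1) * (μHE[n - 1] : Measure (E n)) Q := by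
    rw [← hmB]
    refine euclideanHausdorffMeasure_le_image (C := (2 * h).toNNReal) (fun x hx y hy => ?_) _
    rw [edist_dist, edist_dist, dist_eq_norm, dist_eq_norm]
    change _ ≤ ENNReal.ofReal (2 * h) * _
    rw [← ENNReal.ofReal_mul (by positivity)]
    exact ENNReal.ofReal_le_ofReal (hbounds x hx y hy).2
  have hQ1 : ∀ y ∈ Q, inner ℝ y u = (1 : ℝ) := by
    rintro _ ⟨_, ⟨b, hb, rfl⟩, rfl⟩
    have := (hinner b hb).1
    rw [hπ, inner_smul_left]
    simp only [conj_trivial]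
    exact inv_mul_cancel₀ (by linarith : 0 < inner ℝ (b : E n) u).ne'
  -- A point that exits through `b ∈ A` is `g • b` with `g ≤ 1`, so its height is below `5h/4`.
  have hup : hK.coneMeasure A ≤ volume (coneOver u Q (2 * h)) := by
    rw [hK.coneMeasure_apply hA]
    refine measure_mono ?_
    rintro _ ⟨x, hx, rfl⟩
    have hx' : hK.exit x ∈ A := hx
    have hg0 := hK.gauge_pos (interior_subset x.2.1) x.2.2.1
    have hg1 := gauge_le_one (interior_subset x.2.1)
    set g := gauge K (x : E n)
    set b := hK.exit x
    have hxb : (x : E n) = g • (b : E n) := by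
      change _ = g • (g⁻¹ • (x : E n))
      rw [smul_smul, mul_inv_cancel₀ hg0.ne', one_smul]
    have hi := hinner b hx'
    have hipos : 0 < inner ℝ (b : E n) u := by linarith
    have hxu : inner ℝ (x : E n) u = g * inner ℝ (b : E n) u := by
      rw [hxb, inner_smul_left]; simp
    refine ⟨by rw [hxu]; positivity, by rw [hxu]; nlinarith, (b : E n), ⟨b, hx', rfl⟩, ?_⟩
    rw [hπ, hxu, hxb, smul_smul]
    simp only
    congr 1
    field_simp
  -- A point of the cone of height below `h / 2` is `t • b` with `b ∈ A` and `t < 1`, since `b` has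
  -- height above `3h/4`. It is therefore interior and exits through `b`.
  have hlo : volume (coneOver u Q (h / 2)) ≤ hK.coneMeasure A := by
    rw [hK.coneMeasure_apply hA]
    have hsub : coneOver u Q (h / 2) ⊆ Subtype.val '' (hK.exit ⁻¹' A) ∪
        ((interior K \ {0}) \ gaugeDiffSet K) := by
      rintro x ⟨hx0, hxh, _, ⟨b, hb, rfl⟩, hbx⟩
      have hi := hinner b hb
      have hipos : 0 < inner ℝ (b : E n) u := by linarith
      set t := (inner ℝ x u : ℝ) / inner ℝ (b : E n) u with ht
      have hxt : x = t • (b : E n) := by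
        have := congrArg (fun y => (inner ℝ x u : ℝ) • y) hbx
        simp only [hπ, smul_smul] at this
        rw [mul_inv_cancel₀ hx0.ne', one_smul] at this
        rw [← this, ht, div_eq_mul_inv]
      have ht0 : 0 < t := by positivity
      have ht1 : t < 1 := by rw [ht, div_lt_one hipos]; linarith
      have hbpos : 0 < normalHeight K b := by have := (hheight b hb).1; linarith
      have hint := hK.smul_mem_interior_of_regular b hbpos ht0 ht1
      have hgt := hK.gauge_smul_of_regular b hbpos ht0 ht1
      rw [← hxt] at hint hgt
      have hxne : x ≠ 0 := by rintro rfl; simp at hx0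
      by_cases hd : x ∈ gaugeDiffSet K
      · refine Or.inl ⟨⟨x, hd⟩, ?_, rfl⟩
        have : hK.exit ⟨x, hd⟩ = b := by
          ext1
          change (gauge K x)⁻¹ • x = b
          rw [hgt, hxt, smul_smul, inv_mul_cancel₀ ht0.ne', one_smul]
        simpa [this] using hb
      · exact Or.inr ⟨⟨hint, hxne⟩, hd⟩
    refine (measure_mono hsub).trans ((measure_union_le _ _).trans ?_)
    rw [hK.ae_differentiableAt_gauge, add_zero]
  have hM1 : heightMeasure K A = ∫⁻ b in A, ENNReal.ofReal (normalHeight K b)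
      ∂(μHE[n - 1] : Measure (regularBoundary K)) := withDensity_apply _ hA
  have hM1le : heightMeasure K A ≤ ENNReal.ofReal (2 * h) * m := by
    rw [hM1, ← setLIntegral_const]
    refine setLIntegral_mono' hA fun b hb => ENNReal.ofReal_le_ofReal ?_
    have := (hheight b hb).2; linarith
  have hM1ge : ENNReal.ofReal (h / 2) * m ≤ heightMeasure K A := by
    rw [hM1, ← setLIntegral_const]
    refine setLIntegral_mono' hA fun b hb => ENNReal.ofReal_le_ofReal ?_
    have := (hheight b hb).1; linarith
  have hvup := volume_coneOver_le hn hu1 Q (2 * h)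
  have hvlo := le_volume_coneOver hn hu1 hQ1 (half_pos ha)
  have h8 : (8 : ℝ≥0∞) ^ n = ENNReal.ofReal (8 ^ n) := by
    rw [ENNReal.ofReal_pow (by norm_num)]; simp
  obtain ⟨d, rfl⟩ : ∃ d, n = d + 1 := ⟨n - 1, by omega⟩
  simp only [Nat.add_sub_cancel] at *
  -- The factor `8 ^ n` comes from the second bound, where `(2h) ^ n` is compared with `(h/4) ^ n`;
  -- the first only needs `4 ^ n`.
  rw [Measure.smul_apply, Measure.smul_apply, smul_eq_mul, smul_eq_mul, h8]
  constructor
  · calc hK.coneMeasure A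
        ≤ ENNReal.ofReal (2 * h) ^ (d + 1) * (ENNReal.ofReal (2 / h) ^ d * m) :=
          hup.trans (hvup.trans (by gcongr))
      _ = ENNReal.ofReal (4 ^ (d + 1)) * (ENNReal.ofReal (h / 2) * m) := by
          rw [← ENNReal.ofReal_pow (by positivity), ← ENNReal.ofReal_pow (by positivity),
            ← mul_assoc, ← mul_assoc, ← ENNReal.ofReal_mul (by positivity),
            ← ENNReal.ofReal_mul (by positivity)]
          congr 2
          rw [mul_pow, div_pow, pow_succ, pow_succ, pow_succ, show (4 : ℝ) = 2 * 2 by norm_num,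
            mul_pow]
          field_simp
      _ ≤ ENNReal.ofReal (8 ^ (d + 1)) * heightMeasure K A := by
          gcongr; norm_num
  · calc heightMeasure K A
        ≤ ENNReal.ofReal (2 * h) * (ENNReal.ofReal (2 * h) ^ d *
            (μHE[d] : Measure (E (d + 1))) Q) := hM1le.trans (by gcongr)
      _ = ENNReal.ofReal (8 ^ (d + 1)) * (ENNReal.ofReal (h / 2 / 2) ^ (d + 1) *
            (μHE[d] : Measure (E (d + 1))) Q) := by
          rw [← ENNReal.ofReal_pow (by positivity), ← ENNReal.ofReal_pow (by positivity),
            ← mul_assoc, ← mul_assoc, ← ENNReal.ofReal_mul (by positivity),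
            ← ENNReal.ofReal_mul (by positivity)]
          congr 2
          rw [← mul_pow, ← pow_succ']
          congr 1
          ring
      _ ≤ ENNReal.ofReal (8 ^ (d + 1)) * hK.coneMeasure A := by
          gcongr; exact hvlo.trans hlo

/-- Boundary points whose tangent plane contains the origin are null for both measures: interior
points never exit there, and the height density vanishes. At all other points the local comparison
applies. -/
theorem coneMeasure_bounds (hK : IsBody K) (hn : 0 < n) :
    hK.coneMeasure ≤ (8 ^ n : ℝ≥0∞) • heightMeasure K ∧
      heightMeasure K ≤ (8 ^ n : ℝ≥0∞) • hK.coneMeasure := by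
  have hP : MeasurableSet {a : regularBoundary K | 0 < normalHeight K a} :=
    (isOpen_lt continuous_const (continuous_normalHeight K)).measurableSet
  constructor
  · refine measure_le_of_locally_le hP ?_ fun a ha => ?_
    · rw [hK.coneMeasure_apply hP.compl]
      convert measure_empty (μ := (volume : Measure (E n)))
      ext x
      simp only [mem_image, mem_preimage, mem_compl_iff, mem_ofPred_eq, mem_empty_iff_false,
        iff_false, not_exists, not_and]
      exact fun y hy => absurd (hK.normalHeight_exit_pos y) hy
    · obtain ⟨U, h1, h2, h3⟩ := hK.exists_neighborhood hn a ha
      exact ⟨U, h1, h2, fun A hA hm => (h3 A hA hm).1⟩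
  · refine measure_le_of_locally_le hP ?_ fun a ha => ?_
    · rw [heightMeasure, withDensity_apply _ hP.compl]
      rw [setLIntegral_congr_fun (g := fun _ => 0) hP.compl fun a ha => ?_]
      · simp
      · simp only [mem_compl_iff, mem_ofPred_eq, not_lt] at ha
        simp [ha]
    · obtain ⟨U, h1, h2, h3⟩ := hK.exists_neighborhood hn a ha
      exact ⟨U, h1, h2, fun A hA hm => (h3 A hA hm).2⟩

end IsBody

/-- The cone-volume measure: the image of Lebesgue measure on `K` under the normal map. -/
def coneVolume (K : Set (E n)) : Measure (E n) :=
  Measure.map (normalMap K) (volume.restrict (gaugeDiffSet K))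

/-- The surface area measure, viewed as a measure on the ambient space. -/
def surfaceMeasure (K : Set (E n)) : Measure (E n) :=
  Measure.map Subtype.val (surfaceAreaMeasure K)

theorem measurable_normalMap (K : Set (E n)) : Measurable (normalMap K) := by
  refine measurable_nrm.comp ?_
  unfold gradient
  exact (InnerProductSpace.toDual ℝ (E n)).symm.continuous.measurable.comp
    (measurable_fderiv ℝ (gauge K))

theorem continuous_supportFunction (hK : IsCompact K) (hne : K.Nonempty) :
    Continuous (supportFunction K) := by
  obtain ⟨R, hR⟩ := hK.isBounded.exists_norm_le
  have hbdd : ∀ u, BddAbove ((fun x : E n => (inner ℝ x u : ℝ)) '' K) := fun u =>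
    (hK.image (by fun_prop)).bddAbove
  refine (LipschitzWith.of_le_add_mul ⟨max R 0, le_max_right _ _⟩ fun u v => ?_).continuous
  refine csSup_le (hne.image _) ?_
  rintro _ ⟨x, hx, rfl⟩
  have h1 : (inner ℝ x v : ℝ) ≤ supportFunction K v := le_csSup (hbdd v) ⟨x, hx, rfl⟩
  have h2 : (inner ℝ x u : ℝ) = inner ℝ x v + inner ℝ x (u - v) := by rw [← inner_add_right]; simp
  have h3 : (inner ℝ x (u - v) : ℝ) ≤ max R 0 * dist u v := by
    rw [dist_eq_norm]
    refine (real_inner_le_norm _ _).trans ?_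
    gcongr
    exact (hR x hx).trans (le_max_left _ _)
  change _ ≤ supportFunction K v + max R 0 * dist u v
  linarith

namespace IsBody

theorem continuous_supportFunction (hK : IsBody K) : Continuous (supportFunction K) :=
  LpMinkowski.continuous_supportFunction hK.isCompact ⟨0, hK.zero_mem⟩

theorem map_coneMeasure (hK : IsBody K) :
    Measure.map (fun a => (gaussMap K a : E n)) hK.coneMeasure = coneVolume K := by
  have hg : Measurable fun a : regularBoundary K => (gaussMap K a : E n) :=
    (continuous_subtype_val.comp (continuous_gaussMap K)).measurable
  rw [coneMeasure, Measure.map_map hg hK.continuous_exit.measurable, coneVolume,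
    ← map_comap_subtype_coe (measurableSet_gaugeDiffSet K),
    Measure.map_map (measurable_normalMap K) measurable_subtype_coe]
  congr 1
  ext1 x
  exact hK.gaussMap_exit x.2

theorem map_heightMeasure (hK : IsBody K) :
    Measure.map (fun a => (gaussMap K a : E n)) (heightMeasure K) =
      (surfaceMeasure K).withDensity fun u => ENNReal.ofReal (supportFunction K u) := by
  have hg : Measurable fun a : regularBoundary K => (gaussMap K a : E n) :=
    (continuous_subtype_val.comp (continuous_gaussMap K)).measurable
  have hh := hK.continuous_supportFunction.measurable
  ext s hs
  rw [Measure.map_apply hg hs, heightMeasure, withDensity_apply _ (hg hs),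
    withDensity_apply _ hs, surfaceMeasure, surfaceAreaMeasure,
    Measure.map_map measurable_subtype_coe (continuous_gaussMap K).measurable,
    setLIntegral_map hs (by fun_prop) (measurable_subtype_coe.comp
      (continuous_gaussMap K).measurable)]
  refine lintegral_congr fun a => ?_
  rw [normalHeight, ← supportFunction_eq_of_isNormal (hK.mem_of_mem_regularBoundary a.2)
    (isNormal_gaussMap a)]
  rfl

/-- The cone-volume measure is comparable to the surface area measure weighted by the support
function. -/
theorem coneVolume_bounds (hK : IsBody K) (hn : 0 < n) :
    coneVolume K ≤ (8 ^ n : ℝ≥0∞) • (surfaceMeasure K).withDensity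
        (fun u => ENNReal.ofReal (supportFunction K u)) ∧
      (surfaceMeasure K).withDensity (fun u => ENNReal.ofReal (supportFunction K u)) ≤
        (8 ^ n : ℝ≥0∞) • coneVolume K := by
  have hg : Measurable fun a : regularBoundary K => (gaussMap K a : E n) :=
    (continuous_subtype_val.comp (continuous_gaussMap K)).measurable
  rw [← hK.map_coneMeasure, ← hK.map_heightMeasure, ← Measure.map_smul, ← Measure.map_smul]
  exact ⟨Measure.map_mono (hK.coneMeasure_bounds hn).1 hg,
    Measure.map_mono (hK.coneMeasure_bounds hn).2 hg⟩

end IsBody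

end

/-! ### Support functions, the unit ball, translations and linear maps. -/

section

variable {n : ℕ} {K : Set (E n)}

section Support

theorem bddAbove_inner (hK : IsCompact K) (u : E n) :
    BddAbove ((fun x : E n => (inner ℝ x u : ℝ)) '' K) :=
  (hK.image (by fun_prop)).bddAbove

theorem inner_le_supportFunction (hK : IsCompact K) {x : E n} (hx : x ∈ K) (u : E n) :
    (inner ℝ x u : ℝ) ≤ supportFunction K u :=
  le_csSup (bddAbove_inner hK u) ⟨x, hx, rfl⟩

theorem supportFunction_le (hne : K.Nonempty) {u : E n} {c : ℝ}
    (h : ∀ x ∈ K, (inner ℝ x u : ℝ) ≤ c) : supportFunction K u ≤ c := by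
  refine csSup_le (hne.image _) ?_
  rintro _ ⟨x, hx, rfl⟩
  exact h x hx

theorem supportFunction_smul {u : E n} {t : ℝ} (ht : 0 ≤ t) :
    supportFunction K (t • u) = t * supportFunction K u := by
  unfold supportFunction
  rw [← smul_eq_mul, ← Real.sSup_smul_of_nonneg ht]
  congr 1
  ext y
  simp [mem_smul_set, inner_smul_right]

theorem supportFunction_image (M : E n →L[ℝ] E n) (u : E n) :
    supportFunction (M '' K) u = supportFunction K (M.adjoint u) := by
  unfold supportFunction
  rw [image_image]
  simp [ContinuousLinearMap.adjoint_inner_right]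

namespace IsBody

theorem supportFunction_nonneg (hK : IsBody K) (u : E n) : 0 ≤ supportFunction K u := by
  simpa using inner_le_supportFunction hK.isCompact hK.zero_mem u

theorem supportFunction_pos (hK : IsBody K) (h0 : (0 : E n) ∈ interior K) {u : E n} (hu : u ≠ 0) :
    0 < supportFunction K u := by
  obtain ⟨δ, hδ, hm⟩ := exists_add_smul_mem h0 u
  rw [zero_add] at hm
  refine lt_of_lt_of_le ?_ (inner_le_supportFunction hK.isCompact hm u)
  rw [inner_smul_left]
  exact mul_pos hδ (real_inner_self_pos.2 hu)

theorem image_equiv (hK : IsBody K) (M : E n ≃L[ℝ] E n) : IsBody (M '' K) where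
  convex := hK.convex.linear_image M.toLinearEquiv.toLinearMap
  isCompact := hK.isCompact.image M.continuous
  zero_mem := ⟨0, hK.zero_mem, map_zero M⟩
  interior_nonempty := by
    have := M.toHomeomorph.image_interior K
    change M '' interior K = _ at this
    change (interior (M.toHomeomorph '' K)).Nonempty
    rw [← this]
    exact hK.interior_nonempty.image _

end IsBody

end Support

theorem surfaceMeasure_compl_sphere (K : Set (E n)) :
    surfaceMeasure K (Metric.sphere (0 : E n) 1)ᶜ = 0 := by
  rw [surfaceMeasure, Measure.map_apply measurable_subtype_coe
    Metric.isClosed_sphere.measurableSet.compl]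
  convert measure_empty (μ := surfaceAreaMeasure K)
  ext x
  simp

theorem surfaceMeasure_univ (K : Set (E n)) : surfaceMeasure K univ = surfaceAreaMeasure K univ := by
  rw [surfaceMeasure, Measure.map_apply measurable_subtype_coe MeasurableSet.univ, preimage_univ]

theorem ae_surfaceMeasure_norm (K : Set (E n)) : ∀ᵐ u ∂(surfaceMeasure K), ‖u‖ = 1 := by
  have := surfaceMeasure_compl_sphere K
  rw [ae_iff]
  convert this using 2
  ext x; simp

theorem IsBody.coneVolume_univ (hK : IsBody K) (hn : 0 < n) : coneVolume K univ = volume K := by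
  rw [coneVolume, Measure.map_apply (measurable_normalMap K) MeasurableSet.univ, preimage_univ,
    Measure.restrict_apply_univ, hK.volume_gaugeDiffSet hn]

section Ball

/-- The image of Lebesgue measure on the unit ball under normalization. -/
def ballMeasure (n : ℕ) : Measure (E n) :=
  Measure.map nrm (volume.restrict (Metric.closedBall (0 : E n) 1))

/-- The spherical Lebesgue measure, viewed as a measure on the ambient space. -/
def sphereMeasure (n : ℕ) : Measure (E n) := Measure.map Subtype.val (sphericalMeasure n)

theorem isBody_closedBall (n : ℕ) : IsBody (Metric.closedBall (0 : E n) 1) where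
  convex := convex_closedBall _ _
  isCompact := isCompact_closedBall _ _
  zero_mem := by simp
  interior_nonempty := ⟨0, mem_interior_iff_mem_nhds.2 (Metric.closedBall_mem_nhds _ one_pos)⟩

theorem isNormal_closedBall {v : E n} (hv : ‖v‖ = 1) :
    IsNormal (Metric.closedBall (0 : E n) 1) v v := by
  intro y hy
  rw [mem_closedBall_zero_iff] at hy
  have := real_inner_le_norm y v
  rw [hv, mul_one] at this
  rw [real_inner_self_eq_norm_sq, hv]
  linarith

/-- The gauge of the unit ball is the norm, and the normal seen from `x` is `x / ‖x‖`. -/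
theorem coneVolume_closedBall (hn : 0 < n) :
    coneVolume (Metric.closedBall (0 : E n) 1) = ballMeasure n := by
  have hB := isBody_closedBall n
  have hg : ∀ x : E n, gauge (Metric.closedBall (0 : E n) 1) x = ‖x‖ := fun x => by
    rw [gauge_closedBall zero_le_one, div_one]
  have hnm : ∀ x ∈ gaugeDiffSet (Metric.closedBall (0 : E n) 1),
      normalMap (Metric.closedBall (0 : E n) 1) x = nrm x := by
    intro x hx
    refine (hB.eq_normalMap hx (norm_nrm hx.2.1) ?_).symm
    rw [hg]
    exact isNormal_closedBall (norm_nrm hx.2.1)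
  have hae : (gaugeDiffSet (Metric.closedBall (0 : E n) 1) : Set (E n)) =ᵐ[volume]
      Metric.closedBall (0 : E n) 1 := by
    refine ae_eq_of_subset_of_measure_ge (fun x hx => interior_subset hx.1)
      (hB.volume_gaugeDiffSet hn).ge (measurableSet_gaugeDiffSet _).nullMeasurableSet ?_
    exact measure_closedBall_lt_top.ne
  rw [ballMeasure, ← Measure.restrict_congr_set hae, coneVolume]
  refine Measure.map_congr ?_
  rw [EventuallyEq, ae_restrict_iff' (measurableSet_gaugeDiffSet _)]
  exact Eventually.of_forall hnm

theorem isNormal_closedBall_iff {x u : E n} (hx : ‖x‖ = 1) (hu : ‖u‖ = 1)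
    (h : IsNormal (Metric.closedBall (0 : E n) 1) x u) : u = x := by
  have := h u (by simp [hu])
  rw [real_inner_self_eq_norm_sq, hu] at this
  have h2 : inner ℝ x u = (1 : ℝ) :=
    le_antisymm (by simpa [hx, hu] using real_inner_le_norm x u) (by linarith)
  exact ((inner_eq_one_iff_of_norm_eq_one hx hu).1 h2).symm

theorem surfaceAreaMeasure_closedBall (n : ℕ) :
    surfaceAreaMeasure (Metric.closedBall (0 : E n) 1) = sphericalMeasure n := by
  ext η hη
  rw [surfaceAreaMeasure_apply _ hη, sphericalMeasure,
    ← isometry_subtype_coe.euclideanHausdorffMeasure_image η]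
  congr 1
  have hfr : frontier (Metric.closedBall (0 : E n) 1) = Metric.sphere 0 1 :=
    frontier_closedBall _ one_ne_zero
  have hnorm : ∀ x : regularBoundary (Metric.closedBall (0 : E n) 1), ‖(x : E n)‖ = 1 := by
    intro x
    have := x.2.1
    rw [hfr] at this
    simpa using this
  have hgm : ∀ x : regularBoundary (Metric.closedBall (0 : E n) 1),
      (gaussMap _ x : E n) = x := fun x =>
    isNormal_closedBall_iff (hnorm x) (by simp) (isNormal_gaussMap x)
  ext x
  constructor
  · rintro ⟨y, hy, rfl⟩
    exact ⟨gaussMap _ y, hy, hgm y⟩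
  · rintro ⟨y, hy, rfl⟩
    have hy1 : ‖(y : E n)‖ = 1 := by simp
    have hreg : (y : E n) ∈ regularBoundary (Metric.closedBall (0 : E n) 1) := by
      refine ⟨by rw [hfr]; exact y.2, y,
        (isUnitNormal_iff_isNormal _ _ _).2 (isNormal_closedBall hy1), fun u hu => ?_⟩
      ext1
      exact isNormal_closedBall_iff hy1 (by simp) ((isUnitNormal_iff_isNormal _ _ _).1 hu)
    refine ⟨⟨y, hreg⟩, ?_, rfl⟩
    have : gaussMap _ ⟨(y : E n), hreg⟩ = y := Subtype.ext (hgm ⟨y, hreg⟩)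
    simpa [this] using hy

/-- The general comparison `coneVolume_bounds` applied to the unit ball, whose support function is
one on the sphere. It takes the place of polar coordinates in all later computations. -/
theorem ballMeasure_bounds (hn : 0 < n) :
    ballMeasure n ≤ (8 ^ n : ℝ≥0∞) • sphereMeasure n ∧
      sphereMeasure n ≤ (8 ^ n : ℝ≥0∞) • ballMeasure n := by
  have hS : surfaceMeasure (Metric.closedBall (0 : E n) 1) = sphereMeasure n := by
    rw [surfaceMeasure, surfaceAreaMeasure_closedBall, sphereMeasure]
  have h := (isBody_closedBall n).coneVolume_bounds hn
  have hd : (surfaceMeasure (Metric.closedBall (0 : E n) 1)).withDensity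
      (fun u => ENNReal.ofReal (supportFunction (Metric.closedBall (0 : E n) 1) u)) =
      sphereMeasure n := by
    rw [← hS]
    conv_rhs => rw [← withDensity_one (μ := surfaceMeasure (Metric.closedBall (0 : E n) 1))]
    refine withDensity_congr_ae ?_
    filter_upwards [ae_surfaceMeasure_norm (Metric.closedBall (0 : E n) 1)] with u hu
    rw [supportFunction_eq_of_isNormal (a := u) (by simp [hu]) (isNormal_closedBall hu),
      real_inner_self_eq_norm_sq, hu]
    simp
  rwa [hd, coneVolume_closedBall hn] at h

theorem ae_sphereMeasure_norm (n : ℕ) : ∀ᵐ u ∂(sphereMeasure n), ‖u‖ = 1 := by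
  have := ae_surfaceMeasure_norm (Metric.closedBall (0 : E n) 1)
  rwa [surfaceMeasure, surfaceAreaMeasure_closedBall] at this

theorem isFiniteMeasure_sphereMeasure (hn : 0 < n) : IsFiniteMeasure (sphereMeasure n) := by
  have : IsFiniteMeasure (ballMeasure n) := by
    unfold ballMeasure
    have : IsFiniteMeasure (volume.restrict (Metric.closedBall (0 : E n) 1)) :=
      ⟨by rw [Measure.restrict_apply_univ]; exact measure_closedBall_lt_top⟩
    exact Measure.isFiniteMeasure_map _ _
  have h2 : IsFiniteMeasure ((8 ^ n : ℝ≥0∞) • ballMeasure n) :=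
    Measure.smul_finite _ (by finiteness)
  exact isFiniteMeasure_of_le _ (ballMeasure_bounds hn).2

end Ball

section Translate

theorem regularBoundary_sub (K : Set (E n)) (z : E n) :
    regularBoundary ((fun x => x - z) '' K) = (fun x => x - z) '' regularBoundary K := by
  have hfr : frontier ((fun x => x - z) '' K) = (fun x => x - z) '' frontier K :=
    ((Homeomorph.subRight z).image_frontier K).symm
  have hn : ∀ x u, IsUnitNormal ((fun x => x - z) '' K) (x - z) u ↔ IsUnitNormal K x u := by
    intro x u
    simp [IsUnitNormal]
  ext y
  obtain ⟨x, rfl⟩ : ∃ x, y = x - z := ⟨y + z, by simp⟩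
  have hmem : ∀ S : Set (E n), x - z ∈ (fun x => x - z) '' S ↔ x ∈ S := fun S => by simp
  rw [hmem]
  simp only [regularBoundary, mem_ofPred_eq, hfr, hmem, hn]

theorem surfaceAreaMeasure_univ (K : Set (E n)) :
    surfaceAreaMeasure K univ = (μHE[n - 1] : Measure (E n)) (regularBoundary K) := by
  rw [surfaceAreaMeasure_apply _ MeasurableSet.univ]
  simp

theorem surfaceAreaMeasure_univ_sub (K : Set (E n)) (z : E n) :
    surfaceAreaMeasure ((fun x => x - z) '' K) univ = surfaceAreaMeasure K univ := by
  rw [surfaceAreaMeasure_univ, surfaceAreaMeasure_univ, regularBoundary_sub]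
  exact (IsometryEquiv.subRight z).isometry.euclideanHausdorffMeasure_image _

/-- The surface area of a convex body is bounded by its volume over its inradius. -/
theorem IsBody.surfaceMeasure_univ_le (hK : IsBody K) (hn : 0 < n) {z : E n} {r : ℝ} (hr : 0 < r)
    (hz : Metric.closedBall z r ⊆ K) :
    ENNReal.ofReal r * surfaceMeasure K univ ≤ 8 ^ n * volume K := by
  set K' := (fun x => x - z) '' K with hK'
  have hb : Metric.closedBall (0 : E n) r ⊆ K' := by
    intro x hx
    refine ⟨x + z, hz ?_, by simp⟩
    simpa using hx
  have hK'b : IsBody K' :=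
    { convex := by
        have := hK.convex.translate (-z)
        simpa [hK', sub_eq_neg_add] using this
      isCompact := hK.isCompact.image (by fun_prop)
      zero_mem := hb (by simp [hr.le])
      interior_nonempty := ⟨0, mem_interior_iff_mem_nhds.2
        (mem_of_superset (Metric.closedBall_mem_nhds _ hr) hb)⟩ }
  have hvol : volume K' = volume K := by
    rw [hK']
    have := measure_preimage_add_right (volume : Measure (E n)) z K
    rw [← this]
    congr 1
    ext x
    constructor
    · rintro ⟨y, hy, rfl⟩; simpa using hy
    · intro hx; exact ⟨x + z, hx, by simp⟩
  -- Surface area is translation invariant, so the ball may be centred at the origin; then the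
  -- support function is at least `r` on the unit sphere.
  rw [surfaceMeasure_univ, ← surfaceAreaMeasure_univ_sub K z, ← surfaceMeasure_univ]
  calc ENNReal.ofReal r * surfaceMeasure K' univ
      = ∫⁻ _, ENNReal.ofReal r ∂(surfaceMeasure K') := by rw [lintegral_const]
    _ ≤ ∫⁻ u, ENNReal.ofReal (supportFunction K' u) ∂(surfaceMeasure K') := by
        refine lintegral_mono_ae ?_
        filter_upwards [ae_surfaceMeasure_norm K'] with u hu
        refine ENNReal.ofReal_le_ofReal ?_
        have hm : r • u ∈ K' := hb (by simp [norm_smul, hu, abs_of_pos hr])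
        have := inner_le_supportFunction hK'b.isCompact hm u
        rwa [inner_smul_left, real_inner_self_eq_norm_sq, hu, one_pow, mul_one] at this
    _ = (surfaceMeasure K').withDensity (fun u => ENNReal.ofReal (supportFunction K' u)) univ := by
        rw [withDensity_apply _ MeasurableSet.univ, Measure.restrict_univ]
    _ ≤ ((8 ^ n : ℝ≥0∞) • coneVolume K') univ := (hK'b.coneVolume_bounds hn).2 _
    _ = 8 ^ n * volume K := by
        rw [Measure.smul_apply, hK'b.coneVolume_univ hn, hvol, smul_eq_mul]

end Translate

section Linear

theorem gauge_image_equiv (M : E n ≃L[ℝ] E n) (K : Set (E n)) (x : E n) :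
    gauge (M '' K) (M x) = gauge K x := by
  rw [gauge_def', gauge_def']
  congr 1
  ext r
  rw [mem_ofPred_eq, mem_ofPred_eq, ← map_smul, M.injective.mem_set_image]

theorem image_gaugeDiffSet (M : E n ≃L[ℝ] E n) (K : Set (E n)) :
    gaugeDiffSet (M '' K) = M '' gaugeDiffSet K := by
  have hint : interior (M '' K) = M '' interior K := (M.toHomeomorph.image_interior K).symm
  ext y
  obtain ⟨x, rfl⟩ := M.surjective y
  rw [M.injective.mem_set_image]
  simp only [gaugeDiffSet, mem_ofPred_eq, hint, M.injective.mem_set_image, ne_eq,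
    EmbeddingLike.map_eq_zero_iff]
  have hcomp : gauge K = gauge (M '' K) ∘ M := by
    ext x; exact (gauge_image_equiv M K x).symm
  rw [hcomp, ContinuousLinearEquiv.comp_right_differentiableAt_iff]

theorem adjoint_injective (M : E n ≃L[ℝ] E n) {u : E n}
    (h : (M : E n →L[ℝ] E n).adjoint u = 0) : u = 0 := by
  have := ContinuousLinearMap.adjoint_inner_right (M : E n →L[ℝ] E n) (M.symm u) u
  rw [h] at this
  simpa using this.symm

/-- The map `M` carries exit points to exit points, and normals are pulled back by the adjoint;
uniqueness of the normal does the rest. -/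
theorem IsBody.normalMap_image (hK : IsBody K) (M : E n ≃L[ℝ] E n) {x : E n}
    (hx : x ∈ gaugeDiffSet K) :
    normalMap K x = nrm ((M : E n →L[ℝ] E n).adjoint (normalMap (M '' K) (M x))) := by
  have hMK := hK.image_equiv M
  have hMx : M x ∈ gaugeDiffSet (M '' K) := by
    rw [image_gaugeDiffSet]; exact ⟨x, hx, rfl⟩
  obtain ⟨h1, hN⟩ := hMK.norm_normalMap hMx
  rw [gauge_image_equiv] at hN
  set w := normalMap (M '' K) (M x)
  have hw : w ≠ 0 := by intro h; simp [h] at h1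
  have hMw : (M : E n →L[ℝ] E n).adjoint w ≠ 0 := fun h => hw (adjoint_injective M h)
  refine (hK.eq_normalMap hx (norm_nrm hMw) fun y hy => ?_).symm
  have := hN (M y) ⟨y, hy, rfl⟩
  rw [← map_smul] at this
  simp only [nrm, inner_smul_right, ContinuousLinearMap.adjoint_inner_right]
  gcongr
  exact this

/-- Behaviour of the cone-volume measure under linear maps. -/
theorem IsBody.lintegral_coneVolume_image (hK : IsBody K) (M : E n ≃L[ℝ] E n) {φ : E n → ℝ≥0∞}
    (hφ : Measurable φ) :
    ENNReal.ofReal |LinearMap.det (M : E n →ₗ[ℝ] E n)| * ∫⁻ u, φ u ∂(coneVolume K) =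
      ∫⁻ u, φ (nrm ((M : E n →L[ℝ] E n).adjoint u)) ∂(coneVolume (M '' K)) := by
  have hψ : Measurable fun u => φ (nrm ((M : E n →L[ℝ] E n).adjoint u)) :=
    hφ.comp (measurable_nrm.comp (ContinuousLinearMap.continuous _).measurable)
  rw [coneVolume, lintegral_map hφ (measurable_normalMap K), coneVolume,
    lintegral_map hψ (measurable_normalMap _), image_gaugeDiffSet]
  have hder : ∀ x ∈ gaugeDiffSet K,
      HasFDerivWithinAt M (M : E n →L[ℝ] E n) (gaugeDiffSet K) x :=
    fun x _ => (M : E n →L[ℝ] E n).hasFDerivWithinAt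
  rw [lintegral_image_eq_lintegral_abs_det_fderiv_mul volume (measurableSet_gaugeDiffSet K) hder
    M.injective.injOn, ← lintegral_const_mul' _ _ ENNReal.ofReal_ne_top]
  refine setLIntegral_congr_fun (measurableSet_gaugeDiffSet K) fun x hx => ?_
  rw [← hK.normalMap_image M hx]
  rfl

end Linear

end

/-! ### Transfer of the density bounds through linear maps. -/

section

variable {n : ℕ} {K : Set (E n)}

section MeasureLemmas

variable {α β : Type*} [MeasurableSpace α] [MeasurableSpace β]

theorem withDensity_le_withDensity_of_le {μ ν : Measure α} (h : μ ≤ ν) (f : α → ℝ≥0∞) :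
    μ.withDensity f ≤ ν.withDensity f := by
  refine Measure.le_iff.2 fun s hs => ?_
  rw [withDensity_apply _ hs, withDensity_apply _ hs]
  exact lintegral_mono' (Measure.restrict_mono_measure h s) le_rfl

theorem withDensity_map {μ : Measure α} {f : α → β} (hf : Measurable f) {g : β → ℝ≥0∞}
    (hg : Measurable g) : (Measure.map f μ).withDensity g = Measure.map f (μ.withDensity (g ∘ f)) := by
  ext s hs
  rw [withDensity_apply _ hs, setLIntegral_map hs hg hf, Measure.map_apply hf hs,
    withDensity_apply _ (hf hs)]
  rfl

theorem lintegral_le_of_le_smul {μ ν : Measure α} {c : ℝ≥0∞} (h : μ ≤ c • ν) (f : α → ℝ≥0∞) :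
    ∫⁻ x, f x ∂μ ≤ c * ∫⁻ x, f x ∂ν := by
  refine (lintegral_mono' h le_rfl).trans ?_
  rw [lintegral_smul_measure, smul_eq_mul]

/-- Finite Borel measures are compared by their integrals of nonnegative continuous functions. -/
theorem measure_le_of_forall_lintegral_le {X : Type*} [MeasurableSpace X] [PseudoEMetricSpace X]
    [BorelSpace X] {μ ν : Measure X} [IsFiniteMeasure μ] [IsFiniteMeasure ν]
    (h : ∀ f : X → ℝ≥0, Continuous f → (∀ x, f x ≤ 1) →
      ∫⁻ x, (f x : ℝ≥0∞) ∂μ ≤ ∫⁻ x, (f x : ℝ≥0∞) ∂ν) : μ ≤ ν := by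
  have hclosed : ∀ F : Set X, IsClosed F → μ F ≤ ν F := by
    intro F hF
    have hpos : ∀ k : ℕ, 0 < (1 : ℝ) / (k + 1) := fun k => by positivity
    have hlim := tendsto_one_div_add_atTop_nhds_zero_nat (𝕜 := ℝ)
    refine le_of_tendsto_of_tendsto' (tendsto_lintegral_thickenedIndicator_of_isClosed μ hF hpos hlim)
      (tendsto_lintegral_thickenedIndicator_of_isClosed ν hF hpos hlim) fun k => ?_
    exact h _ (BoundedContinuousFunction.continuous _) fun x => thickenedIndicator_le_one _ F x
  refine Measure.le_iff.2 fun s hs => ?_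
  rw [hs.measure_eq_iSup_isClosed_of_ne_top (measure_ne_top _ _)]
  exact iSup₂_le fun F hFs => iSup_le fun hF => (hclosed F hF).trans (measure_mono hFs)

end MeasureLemmas

theorem norm_smul_nrm (v : E n) : ‖v‖ • nrm v = v := by
  by_cases hv : v = 0
  · simp [hv]
  · rw [nrm, smul_smul, mul_inv_cancel₀ (norm_ne_zero_iff.2 hv), one_smul]

theorem supportFunction_nrm (K : Set (E n)) (v : E n) :
    ‖v‖ * supportFunction K (nrm v) = supportFunction K v := by
  rw [← supportFunction_smul (norm_nonneg _), norm_smul_nrm]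

section Data

variable {L : Set (E n)} {p l : ℝ} {f : Sphere n → ℝ}

/-- Two-sided bounds on the density of the `L_p` surface area measure. -/
theorem IsBody.weighted_surface_bounds (hL : IsBody L) (h0 : (0 : E n) ∈ interior L) (hl : 1 < l)
    (hf : HasDensity (surfaceAreaMeasure L) (sphericalMeasure n) f)
    (hb : ∀ᵐ u : Sphere n ∂(sphericalMeasure n),
      l⁻¹ ≤ supportFunction L (u : E n) ^ (1 - p) * f u ∧
      supportFunction L (u : E n) ^ (1 - p) * f u ≤ l) :
    (surfaceMeasure L).withDensity (fun u => ENNReal.ofReal (supportFunction L u)) ≤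
        ENNReal.ofReal l •
          (sphereMeasure n).withDensity (fun u => ENNReal.ofReal (supportFunction L u ^ p)) ∧
      (sphereMeasure n).withDensity (fun u => ENNReal.ofReal (supportFunction L u ^ p)) ≤
        ENNReal.ofReal l •
          (surfaceMeasure L).withDensity (fun u => ENNReal.ofReal (supportFunction L u)) := by
  have hh : Measurable (supportFunction L) := hL.continuous_supportFunction.measurable
  have hm1 : Measurable fun u => ENNReal.ofReal (supportFunction L u) := by fun_prop
  have hmp : Measurable fun u => ENNReal.ofReal (supportFunction L u ^ p) := by fun_prop
  obtain ⟨hfm, hf0, hfe⟩ := hf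
  have hfm' : Measurable fun u => ENNReal.ofReal (f u) := by fun_prop
  rw [surfaceMeasure, sphereMeasure, hfe, withDensity_map measurable_subtype_coe hm1,
    withDensity_map measurable_subtype_coe hmp,
    ← withDensity_mul _ hfm' (hm1.comp measurable_subtype_coe), ← Measure.map_smul,
    ← Measure.map_smul, ← withDensity_smul _ (hmp.comp measurable_subtype_coe),
    ← withDensity_smul _ (hfm'.mul (hm1.comp measurable_subtype_coe))]
  have hl0 : 0 < l := by linarith
  -- Splitting off `h ^ p` from `h · f` leaves exactly the quantity that is bounded by `l` and
  -- `l⁻¹`. Positivity of `h` is used, so the origin must be interior.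
  have key : ∀ u : Sphere n, supportFunction L u ^ p * (supportFunction L u ^ (1 - p) * f u) =
      f u * supportFunction L u := by
    intro u
    have hu0 : (u : E n) ≠ 0 := by
      intro h; have : ‖(u : E n)‖ = 1 := by simp
      simp [h] at this
    have hpos := hL.supportFunction_pos h0 hu0
    rw [← mul_assoc, ← Real.rpow_add hpos]
    simp [mul_comm]
  have hpn : ∀ u : Sphere n, 0 ≤ supportFunction L u ^ p :=
    fun u => Real.rpow_nonneg (hL.supportFunction_nonneg _) _
  refine ⟨Measure.map_mono (withDensity_mono ?_) measurable_subtype_coe,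
    Measure.map_mono (withDensity_mono ?_) measurable_subtype_coe⟩
  · filter_upwards [hb] with u hu
    simp only [Pi.mul_apply, Function.comp, Pi.smul_apply, smul_eq_mul]
    rw [← ENNReal.ofReal_mul (hf0 u), ← ENNReal.ofReal_mul hl0.le]
    refine ENNReal.ofReal_le_ofReal ?_
    rw [← key u, mul_comm l]
    exact mul_le_mul_of_nonneg_left hu.2 (hpn u)
  · filter_upwards [hb] with u hu
    simp only [Pi.mul_apply, Function.comp, Pi.smul_apply, smul_eq_mul]
    rw [← ENNReal.ofReal_mul (hf0 u), ← ENNReal.ofReal_mul hl0.le]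
    refine ENNReal.ofReal_le_ofReal ?_
    rw [← key u, mul_left_comm]
    have h1 : 1 ≤ l * (supportFunction L u ^ (1 - p) * f u) := by
      have := mul_le_mul_of_nonneg_left hu.1 hl0.le
      rwa [mul_inv_cancel₀ hl0.ne'] at this
    exact le_mul_of_one_le_right (hpn u) h1

/-- The image of the spherical measure with density `‖B u‖ ^ p` under `u ↦ B u / ‖B u‖`. -/
def rangeMeasure (p : ℝ) (B : E n →L[ℝ] E n) : Measure (E n) :=
  Measure.map (fun u => nrm (B u))
    ((sphereMeasure n).withDensity fun u => ENNReal.ofReal (‖B u‖ ^ p))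

/-- By homogeneity `‖B u‖ * h (nrm (B u)) = h (B u)`; this is why `rangeMeasure` carries the weight
`‖B u‖ ^ p`. -/
theorem lintegral_rangeMeasure (hK : IsBody K) (p : ℝ) (B : E n →L[ℝ] E n) {φ : E n → ℝ≥0∞}
    (hφ : Measurable φ) :
    ∫⁻ u, φ u ∂((rangeMeasure p B).withDensity
        fun u => ENNReal.ofReal (supportFunction K u ^ p)) =
      ∫⁻ u, φ (nrm (B u)) * ENNReal.ofReal (supportFunction K (B u) ^ p) ∂(sphereMeasure n) := by
  have hh : Measurable (supportFunction K) := hK.continuous_supportFunction.measurable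
  have hBm : Measurable fun u => nrm (B u) := measurable_nrm.comp B.continuous.measurable
  have hmp : Measurable fun u => ENNReal.ofReal (supportFunction K u ^ p) := by fun_prop
  have hB : Measurable fun u => ENNReal.ofReal (‖B u‖ ^ p) := by fun_prop
  rw [rangeMeasure, withDensity_map hBm hmp, ← withDensity_mul _ hB (hmp.comp hBm),
    lintegral_map hφ hBm]
  refine (lintegral_withDensity_eq_lintegral_mul _ (hB.mul (hmp.comp hBm))
    (hφ.comp hBm)).trans ?_
  refine lintegral_congr fun u => ?_
  simp only [Pi.mul_apply, Function.comp]
  rw [mul_comm, ← ENNReal.ofReal_mul (Real.rpow_nonneg (norm_nonneg _) _),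
    ← Real.mul_rpow (norm_nonneg _) (hK.supportFunction_nonneg _), supportFunction_nrm]

/-- Comparison of the cone-volume measure of a linear image of a body with density bounds with the
image of the spherical measure. -/
theorem IsBody.coneVolume_linear_bounds (hn : 0 < n) (hK : IsBody K) (h0 : (0 : E n) ∈ interior K)
    (hl : 1 < l) (M : E n ≃L[ℝ] E n)
    (hf : HasDensity (surfaceAreaMeasure (M '' K)) (sphericalMeasure n) f)
    (hb : ∀ᵐ u : Sphere n ∂(sphericalMeasure n),
      l⁻¹ ≤ supportFunction (M '' K) (u : E n) ^ (1 - p) * f u ∧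
      supportFunction (M '' K) (u : E n) ^ (1 - p) * f u ≤ l)
    {B : E n →L[ℝ] E n} {t : ℝ} (ht : 0 < t) (hB : (M : E n →L[ℝ] E n).adjoint = t • B)
    {φ : E n → ℝ≥0∞} (hφ : Measurable φ) :
    (∫⁻ u, φ u ∂(coneVolume K) ≤ 8 ^ n * ENNReal.ofReal l *
      (ENNReal.ofReal (t ^ p / |LinearMap.det (M : E n →ₗ[ℝ] E n)|) *
      ∫⁻ u, φ (nrm (B u)) * ENNReal.ofReal (supportFunction K (B u) ^ p) ∂(sphereMeasure n))) ∧
    ENNReal.ofReal (t ^ p / |LinearMap.det (M : E n →ₗ[ℝ] E n)|) *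
      ∫⁻ u, φ (nrm (B u)) * ENNReal.ofReal (supportFunction K (B u) ^ p) ∂(sphereMeasure n) ≤
      8 ^ n * ENNReal.ofReal l * ∫⁻ u, φ u ∂(coneVolume K) := by
  set D := |LinearMap.det (M : E n →ₗ[ℝ] E n)| with hD
  have hD0 : 0 < D := abs_pos.2 M.toLinearEquiv.isUnit_det'.ne_zero
  have hL := hK.image_equiv M
  have hL0 : (0 : E n) ∈ interior (M '' K) := by
    have : M '' interior K = interior (M '' K) := M.toHomeomorph.image_interior K
    rw [← this]; exact ⟨0, h0, map_zero M⟩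
  obtain ⟨hw1, hw2⟩ := hL.weighted_surface_bounds hL0 hl hf hb
  obtain ⟨hc1, hc2⟩ := hL.coneVolume_bounds hn
  have hlin := hK.lintegral_coneVolume_image M hφ
  have hnB : ∀ u, nrm ((M : E n →L[ℝ] E n).adjoint u) = nrm (B u) := fun u => by
    rw [hB, smul_apply, nrm_smul ht]
  simp only [hnB] at hlin
  have hmB : Measurable fun u => φ (nrm (B u)) :=
    hφ.comp (measurable_nrm.comp B.continuous.measurable)
  have hh : Measurable (supportFunction (M '' K)) := hL.continuous_supportFunction.measurable
  have hmp : Measurable fun u => ENNReal.ofReal (supportFunction (M '' K) u ^ p) := by fun_prop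
  set I := ∫⁻ u, φ (nrm (B u)) * ENNReal.ofReal (supportFunction K (B u) ^ p) ∂(sphereMeasure n)
  -- The support function of `M '' K` at `u` is `t` times that of `K` at `B u`, which produces the
  -- factor `t ^ p`; the determinant enters through the change of variables in `hlin`.
  have hI : ∫⁻ u, φ (nrm (B u)) ∂((sphereMeasure n).withDensity
      (fun u => ENNReal.ofReal (supportFunction (M '' K) u ^ p))) = ENNReal.ofReal (t ^ p) * I := by
    rw [lintegral_withDensity_eq_lintegral_mul _ hmp hmB,
      ← lintegral_const_mul' _ _ ENNReal.ofReal_ne_top]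
    refine lintegral_congr fun u => ?_
    have e : supportFunction (M '' K) u = t * supportFunction K (B u) := by
      have := supportFunction_image (K := K) (M : E n →L[ℝ] E n) u
      rw [hB, smul_apply, supportFunction_smul ht.le] at this
      exact this
    simp only [Pi.mul_apply]
    rw [e, Real.mul_rpow ht.le (hK.supportFunction_nonneg _),
      ENNReal.ofReal_mul (Real.rpow_nonneg ht.le _)]
    ring
  have hDne : ENNReal.ofReal D ≠ 0 := by simpa using hD0
  have hq : ENNReal.ofReal (t ^ p / D) * I = (ENNReal.ofReal D)⁻¹ * (ENNReal.ofReal (t ^ p) * I) := by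
    rw [ENNReal.ofReal_div_of_pos hD0, div_eq_mul_inv]; ring
  have hJ : ∫⁻ u, φ u ∂(coneVolume K) =
      (ENNReal.ofReal D)⁻¹ * ∫⁻ u, φ (nrm (B u)) ∂(coneVolume (M '' K)) := by
    rw [← hlin, ← mul_assoc, ENNReal.inv_mul_cancel hDne ENNReal.ofReal_ne_top, one_mul]
  rw [hq, ← hI, hJ]
  constructor
  · rw [mul_left_comm]
    gcongr
    rw [mul_assoc]
    refine (lintegral_le_of_le_smul hc1 _).trans ?_
    gcongr
    exact lintegral_le_of_le_smul hw1 _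
  · rw [mul_left_comm]
    gcongr
    rw [mul_comm (8 ^ n : ℝ≥0∞), mul_assoc]
    refine (lintegral_le_of_le_smul hw2 _).trans ?_
    gcongr
    exact lintegral_le_of_le_smul hc2 _

/-- The total surface area controls the integral of the reciprocal of the support function. -/
theorem IsBody.lintegral_inv_supportFunction_le (hn : 0 < n) (hK : IsBody K) :
    ∫⁻ u, (ENNReal.ofReal (supportFunction K u))⁻¹ ∂(coneVolume K) ≤
      8 ^ n * surfaceMeasure K univ := by
  have hh : Measurable (supportFunction K) := hK.continuous_supportFunction.measurable
  have hm1 : Measurable fun u => ENNReal.ofReal (supportFunction K u) := by fun_prop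
  refine (lintegral_le_of_le_smul (hK.coneVolume_bounds hn).1 _).trans ?_
  gcongr
  refine (lintegral_withDensity_eq_lintegral_mul _ hm1 hm1.inv).trans_le ?_
  rw [← lintegral_one]
  refine lintegral_mono_ae ?_
  -- The product of `h` with its inverse is one or, where `h = 0`, it is `0 * ⊤ = 0`.
  filter_upwards with u
  exact ENNReal.mul_inv_le_one _

end Data

end

/-! ### Hausdorff convergence and limits of the integrals. -/

section

variable {n : ℕ} {K : Set (E n)} {Ks : ℕ → Set (E n)}

/-- Convergence of sets in the Hausdorff distance. -/
def BodyTendsto (Ks : ℕ → Set (E n)) (K : Set (E n)) : Prop :=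
  ∃ d : ℕ → ℝ, Tendsto d atTop (𝓝 0) ∧ ∀ m, (∀ x ∈ Ks m, ∃ y ∈ K, ‖x - y‖ ≤ d m) ∧
    ∀ y ∈ K, ∃ x ∈ Ks m, ‖x - y‖ ≤ d m

namespace BodyTendsto

theorem abs_supportFunction_sub_le {A B : Set (E n)} (hA : IsBody A) (hB : IsBody B) {d : ℝ}
    (h1 : ∀ x ∈ A, ∃ y ∈ B, ‖x - y‖ ≤ d) (h2 : ∀ y ∈ B, ∃ x ∈ A, ‖x - y‖ ≤ d) (u : E n) :
    |supportFunction A u - supportFunction B u| ≤ d * ‖u‖ := by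
  have key : ∀ A B : Set (E n), IsBody A → IsBody B → (∀ x ∈ A, ∃ y ∈ B, ‖x - y‖ ≤ d) →
      supportFunction A u ≤ supportFunction B u + d * ‖u‖ := by
    intro A B hA hB h
    refine supportFunction_le ⟨0, hA.zero_mem⟩ fun x hx => ?_
    obtain ⟨y, hy, hxy⟩ := h x hx
    have e : (inner ℝ x u : ℝ) = inner ℝ y u + inner ℝ (x - y) u := by
      rw [← inner_add_left]; simp
    have h3 := inner_le_supportFunction hB.isCompact hy u
    have h4 : (inner ℝ (x - y) u : ℝ) ≤ d * ‖u‖ := (real_inner_le_norm _ _).trans (by gcongr)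
    linarith
  have h3 := key A B hA hB h1
  have h4 := key B A hB hA fun y hy => by
    obtain ⟨x, hx, hxy⟩ := h2 y hy
    exact ⟨x, hx, by rwa [norm_sub_rev]⟩
  rw [abs_le]; constructor <;> linarith

theorem tendsto_supportFunction (h : BodyTendsto Ks K) (hKs : ∀ m, IsBody (Ks m)) (hK : IsBody K)
    {u : ℕ → E n} {u' : E n} (hu : Tendsto u atTop (𝓝 u')) :
    Tendsto (fun m => supportFunction (Ks m) (u m)) atTop (𝓝 (supportFunction K u')) := by
  obtain ⟨d, hd, hdm⟩ := h
  have h1 : Tendsto (fun m => supportFunction (Ks m) (u m) - supportFunction K (u m)) atTop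
      (𝓝 0) := by
    refine squeeze_zero_norm (fun m => ?_) (by simpa using hd.mul hu.norm)
    exact abs_supportFunction_sub_le (hKs m) hK (hdm m).1 (hdm m).2 (u m)
  have h2 := (hK.continuous_supportFunction.tendsto u').comp hu
  simpa using h1.add h2

/-- If `x` is not interior to `Ks m`, a normal `v` there keeps the point `x + (ε / 2) • v` of `K` at
distance at least `ε / 2` from `Ks m`. -/
theorem eventually_mem_interior (h : BodyTendsto Ks K) (hKs : ∀ m, IsBody (Ks m)) {x : E n}
    (hx : x ∈ interior K) : ∀ᶠ m in atTop, x ∈ interior (Ks m) := by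
  obtain ⟨d, hd, hdm⟩ := h
  obtain ⟨ε, hε, hb⟩ := Metric.mem_nhds_iff.1 (mem_interior_iff_mem_nhds.1 hx)
  filter_upwards [hd.eventually_lt_const (half_pos hε)] with m hm
  by_contra hni
  obtain ⟨v, hv, hN⟩ := (hKs m).exists_isNormal hni
  have hxv : x + (ε / 2) • v ∈ K := hb (by simp [norm_smul, hv, abs_of_pos hε, hε])
  obtain ⟨y, hy, hyd⟩ := (hdm m).2 _ hxv
  have h1 := hN y hy
  have h2 : (inner ℝ y v : ℝ) = inner ℝ x v + ε / 2 + inner ℝ (y - (x + (ε / 2) • v)) v := by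
    rw [inner_sub_left, inner_add_left, inner_smul_left, real_inner_self_eq_norm_sq, hv]
    simp
  have h3 := neg_le_of_abs_le (abs_real_inner_le_norm (y - (x + (ε / 2) • v)) v)
  rw [hv, mul_one] at h3
  linarith

theorem eventually_notMem (h : BodyTendsto Ks K) (hK : IsBody K) {x : E n} (hx : x ∉ K) :
    ∀ᶠ m in atTop, x ∉ Ks m := by
  obtain ⟨d, hd, hdm⟩ := h
  obtain ⟨ε, hε, hb⟩ := Metric.mem_nhds_iff.1 (hK.isClosed.isOpen_compl.mem_nhds hx)
  filter_upwards [hd.eventually_lt_const hε] with m hm hxm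
  obtain ⟨y, hy, hxy⟩ := (hdm m).1 x hxm
  refine hb (?_ : y ∈ Metric.ball x ε) hy
  rw [mem_ball_iff_norm, norm_sub_rev]
  linarith

/-- Compactness and uniqueness: along any ultrafilter the exit factors and the normals converge, the
limits give a point of `K` on the ray through `x` with a normal of `K` there, and at a
differentiability point of the gauge such a pair is unique. -/
theorem tendsto_normalMap (h : BodyTendsto Ks K) (hKs : ∀ m, IsBody (Ks m)) (hK : IsBody K)
    {R : ℝ} (hR : ∀ m, ∀ x ∈ Ks m, ‖x‖ ≤ R) {x : E n} (hx : x ∈ gaugeDiffSet K)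
    (hxs : ∀ᶠ m in atTop, x ∈ gaugeDiffSet (Ks m)) :
    Tendsto (fun m => normalMap (Ks m) x) atTop (𝓝 (normalMap K x)) := by
  obtain ⟨d, hd, hdm⟩ := h
  rw [tendsto_iff_ultrafilter]
  intro F hF
  have hxF : ∀ᶠ m in (F : Filter ℕ), x ∈ gaugeDiffSet (Ks m) := hF hxs
  have hx0 : 0 < ‖x‖ := norm_pos_iff.2 hx.2.1
  have hdF : Tendsto d F (𝓝 0) := hd.mono_left hF
  have hpair : ∀ᶠ m in (F : Filter ℕ), ((gauge (Ks m) x)⁻¹, normalMap (Ks m) x) ∈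
      Icc 1 (R / ‖x‖) ×ˢ Metric.sphere (0 : E n) 1 := by
    filter_upwards [hxF] with m hm
    have hmK := interior_subset hm.1
    have hg := (hKs m).gauge_pos hmK hm.2.1
    refine ⟨⟨(one_le_inv₀ hg).2 (IsBody.gauge_le_one hmK), ?_⟩,
      by simpa using ((hKs m).norm_normalMap hm).1⟩
    have := (hKs m).norm_le_gauge_mul (hR m) hmK
    rw [le_div_iff₀ hx0, inv_mul_le_iff₀ hg]
    exact this
  obtain ⟨⟨s, w⟩, ⟨hs, hw⟩, hlim⟩ := (isCompact_Icc.prod (isCompact_sphere (0 : E n) 1)).ultrafilter_le_nhds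
    (F.map fun m => ((gauge (Ks m) x)⁻¹, normalMap (Ks m) x))
    (by rw [Ultrafilter.coe_map]; exact tendsto_principal.2 hpair)
  rw [Ultrafilter.coe_map] at hlim
  have hlim : Tendsto (fun m => ((gauge (Ks m) x)⁻¹, normalMap (Ks m) x)) F (𝓝 (s, w)) := hlim
  have hts : Tendsto (fun m => (gauge (Ks m) x)⁻¹) F (𝓝 s) :=
    (continuous_fst.tendsto (s, w)).comp hlim
  have htw : Tendsto (fun m => normalMap (Ks m) x) F (𝓝 w) :=
    (continuous_snd.tendsto (s, w)).comp hlim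
  have hw1 : ‖w‖ = 1 := by simpa using hw
  have hw0 : w ≠ 0 := by rintro rfl; simp at hw1
  have hsx : s • x ∈ K := by
    by_contra hsx
    obtain ⟨ε, hε, hb⟩ := Metric.mem_nhds_iff.1 (hK.isClosed.isOpen_compl.mem_nhds hsx)
    have h1 : Tendsto (fun m => (gauge (Ks m) x)⁻¹ • x) F (𝓝 (s • x)) := hts.smul_const x
    have h2 := h1.eventually (Metric.ball_mem_nhds _ (half_pos hε))
    obtain ⟨m, hm1, hm2, hm3⟩ := (h2.and (hxF.and (hdF.eventually_lt_const (half_pos hε)))).exists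
    obtain ⟨y, hy, hyd⟩ := (hdm m).1 _
      ((hKs m).inv_gauge_smul_mem (interior_subset hm2.1) hx.2.1)
    refine hb (?_ : y ∈ Metric.ball (s • x) ε) hy
    rw [Metric.mem_ball]
    rw [← dist_eq_norm] at hyd
    linarith [dist_triangle_left y (s • x) ((gauge (Ks m) x)⁻¹ • x)]
  have hN : IsNormal K (s • x) w := by
    intro y hy
    choose z hz hzd using fun m => (hdm m).2 y hy
    have hzl : Tendsto z F (𝓝 y) := by
      rw [tendsto_iff_norm_sub_tendsto_zero]
      exact squeeze_zero (fun _ => norm_nonneg _) hzd hdF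
    refine le_of_tendsto_of_tendsto (hzl.inner htw) ((hts.smul_const x).inner htw) ?_
    filter_upwards [hxF] with m hm
    exact ((hKs m).norm_normalMap hm).2 _ (hz m)
  have hs0 : 0 < s := lt_of_lt_of_le one_pos hs.1
  have hse := (hK.eq_inv_gauge_of_isNormal hx.1 hs0 hsx hw0 hN).2
  rw [hse] at hN
  rw [← hK.eq_normalMap hx hw1 hN]
  exact htw

/-- Weak continuity of the cone-volume measure. -/
theorem tendsto_lintegral_coneVolume (hn : 0 < n) (h : BodyTendsto Ks K)
    (hKs : ∀ m, IsBody (Ks m)) (hK : IsBody K) {R : ℝ} (hR : ∀ m, ∀ x ∈ Ks m, ‖x‖ ≤ R)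
    {φ : E n → ℝ≥0} (hφ : Continuous φ) (hφ1 : ∀ x, φ x ≤ 1) :
    Tendsto (fun m => ∫⁻ u, (φ u : ℝ≥0∞) ∂(coneVolume (Ks m))) atTop
      (𝓝 (∫⁻ u, (φ u : ℝ≥0∞) ∂(coneVolume K))) := by
  have : Nonempty (Fin n) := ⟨⟨0, hn⟩⟩
  have : Nontrivial (E n) := inferInstance
  have hφm : Measurable fun u => (φ u : ℝ≥0∞) := hφ.measurable.coe_nnreal_ennreal
  have he : ∀ A : Set (E n), ∫⁻ u, (φ u : ℝ≥0∞) ∂(coneVolume A) =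
      ∫⁻ x, (gaugeDiffSet A).indicator (fun x => (φ (normalMap A x) : ℝ≥0∞)) x := by
    intro A
    rw [coneVolume, lintegral_map hφm (measurable_normalMap A),
      lintegral_indicator (measurableSet_gaugeDiffSet A)]
  simp only [he]
  refine tendsto_lintegral_of_dominated_convergence
    ((Metric.closedBall (0 : E n) R).indicator fun _ => 1) (fun m => ?_) (fun m => ?_) ?_ ?_
  · exact (hφm.comp (measurable_normalMap _)).indicator (measurableSet_gaugeDiffSet _)
  · filter_upwards with x
    by_cases hx : x ∈ gaugeDiffSet (Ks m)
    · rw [indicator_of_mem hx, indicator_of_mem (by simpa using hR m x (interior_subset hx.1))]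
      exact_mod_cast hφ1 _
    · rw [indicator_of_notMem hx]
      exact zero_le
  · rw [lintegral_indicator_const Metric.isClosed_closedBall.measurableSet, one_mul]
    exact measure_closedBall_lt_top.ne
  -- Almost every `x` is either outside `K`, hence eventually outside `Ks m`, or a differentiability
  -- point for `K` and eventually for `Ks m`, where the normals converge.
  · have h1 : ∀ᵐ x : E n, x ∉ frontier K := by
      rw [ae_iff]; simpa using hK.convex.addHaar_frontier volume
    have h2 : ∀ᵐ x : E n, x ∉ (interior K \ {0}) \ gaugeDiffSet K := by
      exact measure_eq_zero_iff_ae_notMem.1 hK.ae_differentiableAt_gauge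
    have h3 : ∀ᵐ x : E n, ∀ m, x ∉ (interior (Ks m) \ {0}) \ gaugeDiffSet (Ks m) := by
      rw [ae_all_iff]; intro m
      exact measure_eq_zero_iff_ae_notMem.1 (hKs m).ae_differentiableAt_gauge
    have h4 : ∀ᵐ x : E n, x ≠ 0 := by
      rw [ae_iff]; simp
    filter_upwards [h1, h2, h3, h4] with x hx1 hx2 hx3 hx4
    by_cases hxK : x ∈ K
    · have hxi : x ∈ interior K := by
        by_contra hni
        exact hx1 (by rw [hK.isClosed.frontier_eq]; exact ⟨hxK, hni⟩)
      have hxd : x ∈ gaugeDiffSet K := by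
        by_contra hnd
        exact hx2 ⟨⟨hxi, hx4⟩, hnd⟩
      have hev : ∀ᶠ m in atTop, x ∈ gaugeDiffSet (Ks m) := by
        filter_upwards [h.eventually_mem_interior hKs hxi] with m hm
        by_contra hnd
        exact hx3 m ⟨⟨hm, hx4⟩, hnd⟩
      rw [indicator_of_mem hxd]
      have hl := ((ENNReal.continuous_coe.comp hφ).tendsto _).comp
        (h.tendsto_normalMap hKs hK hR hxd hev)
      refine hl.congr' ?_
      filter_upwards [hev] with m hm
      rw [indicator_of_mem hm]; rfl
    · rw [indicator_of_notMem fun hd => hxK (interior_subset hd.1)]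
      refine tendsto_const_nhds.congr' ?_
      filter_upwards [h.eventually_notMem hK hxK] with m hm
      rw [indicator_of_notMem fun hd => hm (interior_subset hd.1)]

end BodyTendsto

theorem supportFunction_le_mul_norm (hK : IsBody K) {R : ℝ} (hR : ∀ x ∈ K, ‖x‖ ≤ R) (u : E n) :
    supportFunction K u ≤ R * ‖u‖ :=
  supportFunction_le ⟨0, hK.zero_mem⟩ fun x hx =>
    (real_inner_le_norm _ _).trans (by gcongr; exact hR x hx)

theorem nrm_zero : nrm (0 : E n) = 0 := by simp [nrm]

/-- Sets that are null for the normalization of Lebesgue measure are null for the sphere. -/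
theorem ae_sphereMeasure_of_ae {q : E n → Prop} (hn : 0 < n)
    (hm : MeasurableSet {u | q u}) (h : ∀ᵐ x : E n, q (nrm x)) : ∀ᵐ u ∂(sphereMeasure n), q u := by
  have h2 : ∀ᵐ u ∂(ballMeasure n), q u := by
    rw [ballMeasure, ae_map_iff measurable_nrm.aemeasurable hm]
    exact ae_restrict_of_ae h
  have h3 : sphereMeasure n ≪ ballMeasure n :=
    (Measure.absolutelyContinuous_of_le (ballMeasure_bounds hn).2).trans
      (Measure.smul_absolutelyContinuous)
  exact h3.ae_le h2

/-- The kernel is a proper subspace, hence null for Lebesgue measure. -/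
theorem ae_sphereMeasure_apply_ne_zero (hn : 0 < n) {B : E n →L[ℝ] E n} (hB : B ≠ 0) :
    ∀ᵐ u ∂(sphereMeasure n), B u ≠ 0 := by
  have hm : MeasurableSet {u : E n | B u ≠ 0} :=
    (isOpen_ne.preimage B.continuous).measurableSet
  refine ae_sphereMeasure_of_ae hn hm ?_
  have hker : LinearMap.ker (B : E n →ₗ[ℝ] E n) ≠ ⊤ := by
    intro h
    apply hB
    ext1 x
    have : x ∈ LinearMap.ker (B : E n →ₗ[ℝ] E n) := h ▸ Submodule.mem_top
    simpa using this
  have := Measure.addHaar_submodule (volume : Measure (E n)) _ hker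
  rw [ae_iff]
  refine measure_mono_null (fun x hx => ?_) this
  simp only [not_not, mem_ofPred_eq] at hx
  change B x = 0
  rw [← norm_smul_nrm x, map_smul, hx, smul_zero]

theorem sphereMeasure_pos_of_isOpen (hn : 0 < n) {G : Set (E n)} (hG : IsOpen G) {u : E n}
    (hu : ‖u‖ = 1) (huG : u ∈ G) : 0 < sphereMeasure n G := by
  have hu0 : u ≠ 0 := by rintro rfl; simp at hu
  have hc : ContinuousAt nrm ((1 / 2 : ℝ) • u) := continuousAt_nrm (by simpa using hu0)
  have hmem : G ∈ 𝓝 (nrm ((1 / 2 : ℝ) • u)) := by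
    rw [nrm_smul (by norm_num), nrm_of_norm_eq_one hu]; exact hG.mem_nhds huG
  have h1 : nrm ⁻¹' G ∩ Metric.ball 0 1 ∈ 𝓝 ((1 / 2 : ℝ) • u) :=
    inter_mem (hc hmem) (Metric.isOpen_ball.mem_nhds (by simp [norm_smul, hu]; norm_num))
  have h2 : 0 < ballMeasure n G := by
    rw [ballMeasure, Measure.map_apply measurable_nrm hG.measurableSet,
      Measure.restrict_apply (measurable_nrm hG.measurableSet)]
    exact (Measure.measure_pos_of_mem_nhds volume h1).trans_le
      (measure_mono (inter_subset_inter_right _ Metric.ball_subset_closedBall))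
  by_contra h0
  rw [not_lt, nonpos_iff_eq_zero] at h0
  have := (ballMeasure_bounds hn).1 G
  rw [Measure.smul_apply, h0, smul_zero] at this
  exact absurd h2 (not_lt.2 this)

section Limit

variable {Bs : ℕ → E n →L[ℝ] E n} {B : E n →L[ℝ] E n} {p : ℝ}

theorem tendsto_apply_of_tendsto (hBs : Tendsto Bs atTop (𝓝 B)) (u : E n) :
    Tendsto (fun m => Bs m u) atTop (𝓝 (B u)) :=
  ((ContinuousLinearMap.apply ℝ (E n) u).continuous.tendsto B).comp hBs

/-- Dominated convergence with the constant `R ^ p`. The normalization is discontinuous at zero, so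
pointwise convergence is only claimed off the kernel of `B`; `p ≥ 0` makes the power continuous
where the limiting support function vanishes. -/
theorem tendsto_lintegral_sphere (hn : 0 < n) (h : BodyTendsto Ks K)
    (hKs : ∀ m, IsBody (Ks m)) (hK : IsBody K) {R : ℝ} (hR : ∀ m, ∀ x ∈ Ks m, ‖x‖ ≤ R)
    (hp : 0 ≤ p) (hBs : Tendsto Bs atTop (𝓝 B)) (hBn : ∀ m, ‖Bs m‖ ≤ 1) (hB : B ≠ 0)
    {φ : E n → ℝ≥0} (hφ : Continuous φ) (hφ1 : ∀ x, φ x ≤ 1) :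
    Tendsto (fun m => ∫⁻ u, (φ (nrm (Bs m u)) : ℝ≥0∞) *
        ENNReal.ofReal (supportFunction (Ks m) (Bs m u) ^ p) ∂(sphereMeasure n)) atTop
      (𝓝 (∫⁻ u, (φ (nrm (B u)) : ℝ≥0∞) *
        ENNReal.ofReal (supportFunction K (B u) ^ p) ∂(sphereMeasure n))) := by
  have := isFiniteMeasure_sphereMeasure hn
  have hR0 : 0 ≤ R := by simpa using hR 0 0 (hKs 0).zero_mem
  refine tendsto_lintegral_of_dominated_convergence (fun _ => ENNReal.ofReal (R ^ p))
    (fun m => ?_) (fun m => ?_) ?_ ?_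
  · have h1 := (hKs m).continuous_supportFunction.measurable
    have h2 : Measurable fun u => supportFunction (Ks m) (Bs m u) :=
      h1.comp (Bs m).continuous.measurable
    have h3 : Measurable fun u => (φ (nrm (Bs m u)) : ℝ≥0∞) :=
      (hφ.measurable.comp (measurable_nrm.comp (Bs m).continuous.measurable)).coe_nnreal_ennreal
    exact h3.mul (by fun_prop)
  · filter_upwards [ae_sphereMeasure_norm n] with u hu
    refine (mul_le_mul' (ENNReal.coe_le_coe.2 (hφ1 _)) le_rfl).trans ?_
    rw [ENNReal.coe_one, one_mul]
    refine ENNReal.ofReal_le_ofReal (Real.rpow_le_rpow ((hKs m).supportFunction_nonneg _) ?_ hp)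
    refine (supportFunction_le_mul_norm (hKs m) (hR m) _).trans ?_
    have : ‖Bs m u‖ ≤ 1 := by
      refine ((Bs m).le_opNorm u).trans ?_
      rw [hu, mul_one]; exact hBn m
    nlinarith
  · rw [lintegral_const]
    finiteness
  · filter_upwards [ae_sphereMeasure_apply_ne_zero hn hB] with u hu
    have hl := tendsto_apply_of_tendsto hBs u
    have h1 : Tendsto (fun m => (φ (nrm (Bs m u)) : ℝ≥0∞)) atTop (𝓝 (φ (nrm (B u)))) :=
      ((ENNReal.continuous_coe.comp hφ).tendsto _).comp ((continuousAt_nrm hu).tendsto.comp hl)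
    have h2 : Tendsto (fun m => ENNReal.ofReal (supportFunction (Ks m) (Bs m u) ^ p)) atTop
        (𝓝 (ENNReal.ofReal (supportFunction K (B u) ^ p))) :=
      ((ENNReal.continuous_ofReal.comp (Real.continuous_rpow_const hp)).tendsto _).comp
        (h.tendsto_supportFunction hKs hK hl)
    exact ENNReal.Tendsto.mul h1 (Or.inr ENNReal.ofReal_ne_top) h2 (Or.inr ENNReal.coe_ne_top)

/-- Positivity of the total mass of the limit. -/
theorem lintegral_sphere_pos (hn : 0 < n) (hK : IsBody K) (hB : B ≠ 0) :
    0 < ∫⁻ u, ENNReal.ofReal (supportFunction K (B u) ^ p) ∂(sphereMeasure n) := by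
  obtain ⟨x, hx⟩ : ∃ x, B x ≠ 0 := by
    by_contra! h
    exact hB (ContinuousLinearMap.ext fun x => by simpa using h x)
  obtain ⟨z, hz⟩ := hK.interior_nonempty
  -- If `h` were nonpositive at both `B x` and `-B x`, the body would lie in a hyperplane and have
  -- no interior.
  have key : ∃ u, u ≠ 0 ∧ 0 < supportFunction K (B u) := by
    by_contra! h
    have hx0 : x ≠ 0 := by rintro rfl; simp at hx
    have h1 := h x hx0
    have h2 := h (-x) (neg_ne_zero.2 hx0)
    obtain ⟨δ, hδ, hm⟩ := IsBody.exists_add_smul_mem hz (B x)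
    have h3 := (inner_le_supportFunction hK.isCompact hm (B x)).trans h1
    have h4 := (inner_le_supportFunction hK.isCompact (interior_subset hz) (B (-x))).trans h2
    rw [map_neg, inner_neg_right] at h4
    rw [inner_add_left, inner_smul_left] at h3
    have h5 : 0 < δ * inner ℝ (B x) (B x) := mul_pos hδ (real_inner_self_pos.2 hx)
    simp only [conj_trivial] at h3
    linarith
  obtain ⟨u, hu0, hu⟩ := key
  have hcont : Continuous fun u => supportFunction K (B u) :=
    hK.continuous_supportFunction.comp B.continuous
  have hG : IsOpen {u | 0 < supportFunction K (B u)} := isOpen_lt continuous_const hcont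
  have hGpos := sphereMeasure_pos_of_isOpen hn hG (norm_nrm hu0) (by
    change 0 < supportFunction K (B (nrm u))
    rw [nrm, map_smul, supportFunction_smul (by positivity)]
    positivity)
  have hmeas : Measurable fun u => ENNReal.ofReal (supportFunction K (B u) ^ p) := by
    have := hcont.measurable
    fun_prop
  rw [lintegral_pos_iff_support hmeas]
  refine hGpos.trans_le (measure_mono fun u hu => ?_)
  rw [Function.mem_support]
  have hu : 0 < supportFunction K (B u) := hu
  have : 0 < supportFunction K (B u) ^ p := Real.rpow_pos_of_pos hu _
  simpa using this

end Limit

end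

/-! ### Normalized linear images of the spherical measure. -/

section

variable {n : ℕ}

section Subsphere

/-- The spherical measure of a subspace, viewed as a measure on the ambient space. -/
def subsphereMeasureAmbient (H : Submodule ℝ (E n)) : Measure (E n) :=
  Measure.map Subtype.val (subsphereMeasure H)

/-- An isometric parametrization of a subspace by a Euclidean space. -/
def subspaceParam (H : Submodule ℝ (E n)) : E (Module.finrank ℝ H) →ₗᵢ[ℝ] E n :=
  H.subtypeₗᵢ.comp (stdOrthonormalBasis ℝ H).repr.symm.toLinearIsometry

theorem subspaceParam_repr (H : Submodule ℝ (E n)) (x : H) :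
    subspaceParam H ((stdOrthonormalBasis ℝ H).repr x) = x := by
  simp [subspaceParam]

theorem subspaceParam_mem (H : Submodule ℝ (E n)) (y : E (Module.finrank ℝ H)) :
    subspaceParam H y ∈ H := by
  simp [subspaceParam]

/-- Isometries preserve Hausdorff measure. This reduces the subsphere of `H` to a full sphere in
dimension `finrank ℝ H`, where `ballMeasure_bounds` is available. -/
theorem map_subspaceParam_sphereMeasure (H : Submodule ℝ (E n)) :
    Measure.map (subspaceParam H) (sphereMeasure (Module.finrank ℝ H)) =
      subsphereMeasureAmbient H := by
  have hj : Measurable (subspaceParam H) := (subspaceParam H).continuous.measurable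
  have hH : MeasurableSet (subsphere H) := by
    have : IsClosed (H : Set (E n)) := H.closed_of_finiteDimensional
    exact (this.preimage continuous_subtype_val).measurableSet
  have hval : ∀ {m : ℕ} (d : ℕ) (t : Set (Sphere m)), (μHE[d] : Measure (Sphere m)) t =
      (μHE[d] : Measure (E m)) (Subtype.val '' t) := fun d t =>
    (isometry_subtype_coe.euclideanHausdorffMeasure_image t).symm
  ext s hs
  rw [Measure.map_apply hj hs, sphereMeasure, Measure.map_apply measurable_subtype_coe (hj hs),
    subsphereMeasureAmbient, Measure.map_apply measurable_subtype_coe hs, subsphereMeasure,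
    Measure.restrict_apply (measurable_subtype_coe hs), sphericalMeasure,
    hval, hval, ← (subspaceParam H).isometry.euclideanHausdorffMeasure_image]
  congr 1
  ext x
  constructor
  · rintro ⟨_, ⟨y, hy, rfl⟩, rfl⟩
    refine ⟨⟨subspaceParam H y, by simp⟩, ⟨hy, ?_⟩, rfl⟩
    exact subspaceParam_mem H _
  · rintro ⟨y, ⟨hy, hyH⟩, rfl⟩
    have hyH : (y : E n) ∈ H := hyH
    refine ⟨(stdOrthonormalBasis ℝ H).repr ⟨y, hyH⟩,
      ⟨⟨(stdOrthonormalBasis ℝ H).repr ⟨y, hyH⟩, by simp⟩, ?_, rfl⟩, subspaceParam_repr H ⟨y, hyH⟩⟩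
    change subspaceParam H ((stdOrthonormalBasis ℝ H).repr ⟨y, hyH⟩) ∈ s
    rw [subspaceParam_repr]
    exact hy

theorem nrm_linearIsometry {k : ℕ} (j : E k →ₗᵢ[ℝ] E n) (y : E k) : nrm (j y) = j (nrm y) := by
  simp [nrm]

end Subsphere

section Projection

/-- The image of Lebesgue measure on the unit ball under a surjective linear map is comparable to
Lebesgue measure near the origin. -/
theorem exists_projection_bounds {k : ℕ} (B : E n →L[ℝ] E k) (hB : Function.Surjective B) :
    ∃ c c' : ℝ≥0∞, c ≠ ⊤ ∧ c' ≠ ⊤ ∧ ∃ δ : ℝ, 0 < δ ∧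
      (∀ T : Set (E k), MeasurableSet T →
        volume (Metric.closedBall (0 : E n) 1 ∩ B ⁻¹' T) ≤ c * volume T) ∧
      ∀ T : Set (E k), MeasurableSet T → T ⊆ Metric.closedBall 0 δ →
        volume T ≤ c' * volume (Metric.closedBall (0 : E n) 1 ∩ B ⁻¹' T) := by
  obtain ⟨s0, hs0⟩ := LinearMap.exists_rightInverse_of_surjective (B : E n →ₗ[ℝ] E k)
    (LinearMap.range_eq_top.2 hB)
  set s : E k →L[ℝ] E n := LinearMap.toContinuousLinearMap s0
  have hs : ∀ y, B (s y) = y := fun y => LinearMap.congr_fun hs0 y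
  set N := LinearMap.ker (B : E n →ₗ[ℝ] E k) with hN
  have hw : ∀ w : N, B (w : E n) = 0 := fun w => w.2
  let e : (E k × N) ≃ₗ[ℝ] E n :=
    { toFun := fun q => s q.1 + q.2
      map_add' := fun q r => by simp only [Prod.fst_add, Prod.snd_add, map_add, Submodule.coe_add]; abel
      map_smul' := fun a q => by simp
      invFun := fun x => (B x, ⟨x - s (B x), by
        rw [hN, LinearMap.mem_ker]; simp [hs]⟩)
      left_inv := fun q => by
        ext1
        · simp [hs, hw]
        · ext1; simp [hs, hw]
      right_inv := fun x => by simp }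
  let e' : (E k × N) ≃L[ℝ] E n := e.toContinuousLinearEquiv
  have he : ∀ q, e' q = s q.1 + q.2 := fun q => rfl
  set P : Measure (E k × N) := (volume : Measure (E k)).prod (volume : Measure N) with hP
  have hHaar : (Measure.map e' P).IsAddHaarMeasure := e'.isAddHaarMeasure_map P
  set a : ℝ≥0 := (volume : Measure (E n)).addHaarScalarFactor (Measure.map e' P) with ha
  have hvol : (volume : Measure (E n)) = a • Measure.map e' P :=
    Measure.isAddLeftInvariant_eq_smul _ _
  have ha0 : 0 < a := Measure.addHaarScalarFactor_pos_of_isAddHaarMeasure _ _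
  have hvolS : ∀ S : Set (E n), volume S = a * P (e' ⁻¹' S) := fun S => by
    have h2 := congrArg (fun μ : Measure (E n) => μ S) hvol
    simp only [Measure.smul_apply] at h2
    rw [h2, ENNReal.smul_def, smul_eq_mul]
    congr 1
    exact e'.toHomeomorph.toMeasurableEquiv.map_apply S
  set R : ℝ := 1 + ‖s‖ * ‖B‖
  set b : ℝ≥0∞ := volume (Metric.closedBall (0 : N) (1 / 2)) with hb
  have hb0 : b ≠ 0 := (Metric.measure_closedBall_pos volume _ (by norm_num)).ne'
  have hbt : b ≠ ⊤ := measure_closedBall_lt_top.ne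
  -- The radius `R` bounds the kernel component of any point of the unit ball. The choice of `δ`
  -- gives `‖s y‖ ≤ 1/2` for `‖y‖ ≤ δ`, leaving room for a kernel component of norm `1/2`.
  refine ⟨a * volume (Metric.closedBall (0 : N) R), (a * b)⁻¹, ?_, ?_, 1 / (2 * (‖s‖ + 1)),
    by positivity, fun T hT => ?_, fun T hT hTδ => ?_⟩
  · exact ENNReal.mul_ne_top ENNReal.coe_ne_top measure_closedBall_lt_top.ne
  · exact ENNReal.inv_ne_top.2 (mul_ne_zero (by exact_mod_cast ha0.ne') hb0)
  · rw [hvolS, mul_assoc, mul_comm (volume (Metric.closedBall (0 : N) R)), hP, ← Measure.prod_prod]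
    gcongr
    rintro ⟨y, w⟩ ⟨h1, h2⟩
    rw [he] at h1
    simp only [mem_preimage, he, map_add, hs, hw, add_zero] at h2
    refine ⟨h2, ?_⟩
    rw [mem_closedBall_zero_iff] at h1 ⊢
    simp only at h1
    have e1 : (w : E n) = (s y + w) - s (B (s y + w)) := by simp [hs, hw]
    calc ‖w‖ = ‖(s y + w) - s (B (s y + w))‖ := by rw [← e1]; rfl
      _ ≤ ‖s y + w‖ + ‖s (B (s y + w))‖ := norm_sub_le _ _
      _ ≤ 1 + ‖s‖ * (‖B‖ * 1) := by
          gcongr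
          refine (s.le_opNorm _).trans ?_
          gcongr
          refine (B.le_opNorm _).trans ?_
          gcongr
      _ = R := by simp [R]
  · have hsub : T ×ˢ Metric.closedBall (0 : N) (1 / 2) ⊆
        e' ⁻¹' (Metric.closedBall (0 : E n) 1 ∩ B ⁻¹' T) := by
      rintro ⟨y, w⟩ ⟨hy, hw'⟩
      have hyδ := hTδ hy
      simp only at hy hw' hyδ
      rw [mem_closedBall_zero_iff] at hyδ hw'
      refine ⟨?_, ?_⟩
      · rw [he, mem_closedBall_zero_iff]
        have h1 : ‖s y‖ ≤ 1 / 2 := by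
          refine (s.le_opNorm y).trans ?_
          calc ‖s‖ * ‖y‖ ≤ (‖s‖ + 1) * (1 / (2 * (‖s‖ + 1))) := by
                gcongr; linarith
            _ = 1 / 2 := by field_simp
        have h2 : ‖(w : E n)‖ ≤ 1 / 2 := hw'
        refine (norm_add_le _ _).trans ?_
        simp only
        linarith
      · simpa [he, hs, hw] using hy
    have h1 : volume T * b ≤ P (e' ⁻¹' (Metric.closedBall (0 : E n) 1 ∩ B ⁻¹' T)) := by
      rw [hb, ← Measure.prod_prod]; exact measure_mono hsub
    rw [hvolS]
    have hab : (a : ℝ≥0∞) * b ≠ 0 := mul_ne_zero (by exact_mod_cast ha0.ne') hb0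
    have habt : (a : ℝ≥0∞) * b ≠ ⊤ := ENNReal.mul_ne_top ENNReal.coe_ne_top hbt
    calc volume T = (a * b)⁻¹ * (a * (volume T * b)) := by
          rw [mul_left_comm (a : ℝ≥0∞), mul_comm, mul_assoc, ENNReal.mul_inv_cancel hab habt, mul_one]
      _ ≤ _ := by gcongr

theorem volume_cone_inter_closedBall {k : ℕ} {s : Set (E k)} (hs : MeasurableSet s) {δ : ℝ}
    (hδ : 0 < δ) :
    volume (nrm ⁻¹' s ∩ Metric.closedBall 0 δ) = ENNReal.ofReal (δ ^ k) * ballMeasure k s := by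
  rw [ballMeasure, Measure.map_apply measurable_nrm hs,
    Measure.restrict_apply (measurable_nrm hs)]
  have : nrm ⁻¹' s ∩ Metric.closedBall (0 : E k) δ =
      δ • (nrm ⁻¹' s ∩ Metric.closedBall (0 : E k) 1) := by
    ext x
    rw [mem_smul_set_iff_inv_smul_mem₀ hδ.ne']
    simp only [mem_inter_iff, mem_preimage, mem_closedBall_zero_iff, nrm_smul (inv_pos.2 hδ),
      norm_smul, norm_inv, Real.norm_eq_abs, abs_of_pos hδ]
    rw [inv_mul_le_iff₀ hδ, mul_one]
  rw [this, Measure.addHaar_smul, finrank_euclideanSpace_fin, abs_of_pos (by positivity)]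

/-- The part of the cone in the ball of radius `δ / 2` has a fraction `2⁻ᵏ ≤ 1/2` of the volume.
Working in the shell keeps the weight `‖B u‖ ^ p` away from zero. -/
theorem volume_cone_le_shell {k : ℕ} (hk : 0 < k) {s : Set (E k)} (hs : MeasurableSet s) {δ : ℝ}
    (hδ : 0 < δ) :
    ENNReal.ofReal (δ ^ k) * ballMeasure k s ≤
      2 * volume (nrm ⁻¹' s ∩ {y | δ / 2 ≤ ‖y‖ ∧ ‖y‖ ≤ δ}) := by
  set V := ENNReal.ofReal (δ ^ k) * ballMeasure k s with hV
  set S := volume (nrm ⁻¹' s ∩ {y : E k | δ / 2 ≤ ‖y‖ ∧ ‖y‖ ≤ δ})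
  have h1 : volume (nrm ⁻¹' s ∩ Metric.closedBall 0 δ) = V := volume_cone_inter_closedBall hs hδ
  have h2 := volume_cone_inter_closedBall hs (half_pos hδ)
  have hfin : V ≠ ⊤ := by
    rw [← h1]
    exact ((measure_mono inter_subset_right).trans_lt measure_closedBall_lt_top).ne
  have hsub : nrm ⁻¹' s ∩ Metric.closedBall (0 : E k) δ ⊆
      (nrm ⁻¹' s ∩ {y : E k | δ / 2 ≤ ‖y‖ ∧ ‖y‖ ≤ δ}) ∪
        (nrm ⁻¹' s ∩ Metric.closedBall (0 : E k) (δ / 2)) := by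
    rintro x ⟨hx1, hx2⟩
    rw [mem_closedBall_zero_iff] at hx2
    rcases le_total (δ / 2) ‖x‖ with h | h
    · exact Or.inl ⟨hx1, h, hx2⟩
    · exact Or.inr ⟨hx1, by simpa using h⟩
  have h3 : V ≤ S + ENNReal.ofReal ((δ / 2) ^ k) * ballMeasure k s := by
    rw [← h1, ← h2]
    exact (measure_mono hsub).trans (measure_union_le _ _)
  have h4 : ENNReal.ofReal ((δ / 2) ^ k) * ballMeasure k s ≤ V / 2 := by
    have : ENNReal.ofReal ((δ / 2) ^ k) ≤ ENNReal.ofReal (δ ^ k) * 2⁻¹ := by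
      have h2 : (2⁻¹ : ℝ≥0∞) = ENNReal.ofReal (2⁻¹) := by
        rw [ENNReal.ofReal_inv_of_pos two_pos]; simp
      rw [h2, ← ENNReal.ofReal_mul (by positivity)]
      refine ENNReal.ofReal_le_ofReal ?_
      rw [div_pow, div_eq_mul_inv]
      gcongr
      exact le_self_pow₀ one_le_two hk.ne'
    calc _ ≤ ENNReal.ofReal (δ ^ k) * 2⁻¹ * ballMeasure k s := by gcongr
      _ = V / 2 := by rw [hV, div_eq_mul_inv]; ring
  have h5 : V ≤ S + V / 2 := h3.trans (by gcongr)
  have h6 : V / 2 ≤ S := by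
    have h7 : V / 2 + V / 2 ≤ S + V / 2 := by rwa [ENNReal.add_halves]
    exact (ENNReal.add_le_add_iff_right (ENNReal.div_ne_top hfin two_ne_zero)).1 h7
  rw [mul_comm]
  exact (ENNReal.div_le_iff_le_mul (Or.inl two_ne_zero) (Or.inl ENNReal.ofNat_ne_top)).1 h6

end Projection

section Range

theorem nrm_apply_nrm {k : ℕ} (B : E n →L[ℝ] E k) (x : E n) : nrm (B (nrm x)) = nrm (B x) := by
  by_cases hx : x = 0
  · simp [hx, nrm_zero]
  · rw [show nrm x = ‖x‖⁻¹ • x from rfl, map_smul]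
    exact nrm_smul (inv_pos.2 (norm_pos_iff.2 hx))

/-- The normalized linear image of the spherical measure is comparable to the spherical measure of
the range. -/
theorem exists_rangeMeasure_bounds (hn : 0 < n) {B : E n →L[ℝ] E n} (hB0 : B ≠ 0)
    (hB1 : ‖B‖ ≤ 1) {p : ℝ} (hp : 0 ≤ p) :
    ∃ a b : ℝ≥0∞, a ≠ ⊤ ∧ b ≠ ⊤ ∧
      rangeMeasure p B ≤ a • subsphereMeasureAmbient (LinearMap.range (B : E n →ₗ[ℝ] E n)) ∧
      subsphereMeasureAmbient (LinearMap.range (B : E n →ₗ[ℝ] E n)) ≤ b • rangeMeasure p B := by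
  set H := LinearMap.range (B : E n →ₗ[ℝ] E n) with hH
  set k := Module.finrank ℝ H with hkdef
  have hk : 0 < k := by
    rw [hkdef, Module.finrank_pos_iff, Submodule.nontrivial_iff_ne_bot]
    intro h
    apply hB0
    ext1 x
    have : B x ∈ H := ⟨x, rfl⟩
    rw [h] at this
    simpa using this
  set j := subspaceParam H
  let B' : E n →L[ℝ] E k := LinearMap.toContinuousLinearMap
    ((stdOrthonormalBasis ℝ H).repr.toLinearEquiv.toLinearMap ∘ₗ
      (B : E n →ₗ[ℝ] E n).rangeRestrict)
  have hjB : ∀ x, j (B' x) = B x := fun x => subspaceParam_repr H _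
  have hB's : Function.Surjective B' := fun y => by
    obtain ⟨⟨z, x, hx⟩, hz⟩ := (stdOrthonormalBasis ℝ H).repr.surjective y
    refine ⟨x, ?_⟩
    apply j.injective
    rw [hjB, ← hz, subspaceParam_repr]
    exact hx
  obtain ⟨c, c', hc, hc', δ, hδ, hup, hlo⟩ := exists_projection_bounds B' hB's
  have hjm : Measurable j := j.continuous.measurable
  have hBm : Measurable fun u => nrm (B u) := measurable_nrm.comp B.continuous.measurable
  have hdm : Measurable fun u => ENNReal.ofReal (‖B u‖ ^ p) := by fun_prop
  set ρ : ℝ := ‖B'‖ + 1 with hρ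
  have hρ0 : 0 < ρ := by positivity
  have hnB : ∀ x, nrm (B (nrm x)) = j (nrm (B' x)) := fun x => by
    rw [nrm_apply_nrm, ← hjB, nrm_linearIsometry]
  have hδk : ENNReal.ofReal (δ ^ k) ≠ 0 := by simp; positivity
  have hδp : ENNReal.ofReal ((δ / 2) ^ p) ≠ 0 := by simp; positivity
  refine ⟨8 ^ n * (c * (ENNReal.ofReal (ρ ^ k) * 8 ^ k)),
    8 ^ k * ((ENNReal.ofReal (δ ^ k))⁻¹ * (2 * (c' * ((ENNReal.ofReal ((δ / 2) ^ p))⁻¹ * 8 ^ n)))),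
    ?_, ?_, ?_, ?_⟩
  · finiteness
  · finiteness
  · refine Measure.le_iff.2 fun s hs => ?_
    rw [Measure.smul_apply, smul_eq_mul, ← map_subspaceParam_sphereMeasure,
      Measure.map_apply hjm hs]
    have hjs := hjm hs
    -- For the upper bound the weight `‖B u‖ ^ p` is at most one on the sphere.
    have h1 : rangeMeasure p B s ≤ sphereMeasure n ((fun u => nrm (B u)) ⁻¹' s) := by
      rw [rangeMeasure, Measure.map_apply hBm hs, withDensity_apply _ (hBm hs)]
      conv_rhs => rw [← setLIntegral_one]
      refine lintegral_mono_ae (ae_restrict_of_ae ?_)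
      filter_upwards [ae_sphereMeasure_norm n] with u hu
      rw [ENNReal.ofReal_le_one]
      refine Real.rpow_le_one (norm_nonneg _) ?_ hp
      refine (B.le_opNorm u).trans ?_
      rw [hu, mul_one]; exact hB1
    have h2 : ballMeasure n ((fun u => nrm (B u)) ⁻¹' s) ≤
        c * (ENNReal.ofReal (ρ ^ k) * ballMeasure k (j ⁻¹' s)) := by
      rw [← volume_cone_inter_closedBall hjs hρ0]
      refine le_trans ?_ (hup _ ((measurable_nrm hjs).inter Metric.isClosed_closedBall.measurableSet))
      rw [ballMeasure, Measure.map_apply measurable_nrm (hBm hs),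
        Measure.restrict_apply (measurable_nrm (hBm hs))]
      refine measure_mono ?_
      rintro x ⟨hx1, hx2⟩
      refine ⟨hx2, ?_, ?_⟩
      · simp only [mem_preimage] at hx1 ⊢
        rwa [hnB] at hx1
      · rw [mem_closedBall_zero_iff] at hx2 ⊢
        refine (B'.le_opNorm x).trans ?_
        nlinarith [norm_nonneg B']
    calc rangeMeasure p B s ≤ sphereMeasure n ((fun u => nrm (B u)) ⁻¹' s) := h1
      _ ≤ 8 ^ n * ballMeasure n ((fun u => nrm (B u)) ⁻¹' s) := (ballMeasure_bounds hn).2 _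
      _ ≤ 8 ^ n * (c * (ENNReal.ofReal (ρ ^ k) * (8 ^ k * sphereMeasure k (j ⁻¹' s)))) := by
          gcongr
          refine h2.trans ?_
          gcongr
          exact (ballMeasure_bounds hk).1 _
      _ = _ := by ring
  · refine Measure.le_iff.2 fun s hs => ?_
    rw [Measure.smul_apply, smul_eq_mul, ← map_subspaceParam_sphereMeasure,
      Measure.map_apply hjm hs]
    have hjs := hjm hs
    set Sh : Set (E k) := {y | δ / 2 ≤ ‖y‖ ∧ ‖y‖ ≤ δ} with hSh
    have hShm : MeasurableSet Sh :=
      (measurableSet_le measurable_const measurable_norm).inter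
        (measurableSet_le measurable_norm measurable_const)
    set X : Set (E n) := Metric.closedBall (0 : E n) 1 ∩ B' ⁻¹' (nrm ⁻¹' (j ⁻¹' s) ∩ Sh) with hX
    have hXm : MeasurableSet X := Metric.isClosed_closedBall.measurableSet.inter
      (B'.continuous.measurable ((measurable_nrm hjs).inter hShm))
    have h1 : ballMeasure k (j ⁻¹' s) ≤
        (ENNReal.ofReal (δ ^ k))⁻¹ * (2 * (c' * volume X)) := by
      have := volume_cone_le_shell hk hjs hδ
      have h2 := hlo _ ((measurable_nrm hjs).inter hShm) (fun y hy => by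
        rw [mem_closedBall_zero_iff]; exact hy.2.2)
      rw [mul_comm, ← div_eq_mul_inv, ENNReal.le_div_iff_mul_le (Or.inl hδk)
        (Or.inl ENNReal.ofReal_ne_top), mul_comm]
      exact this.trans (by gcongr)
    have h3 : volume X ≤ (ENNReal.ofReal ((δ / 2) ^ p))⁻¹ * (8 ^ n * rangeMeasure p B s) := by
      rw [mul_comm, ← div_eq_mul_inv, ENNReal.le_div_iff_mul_le (Or.inl hδp)
        (Or.inl ENNReal.ofReal_ne_top), mul_comm]
      have h4 : ((ballMeasure n).withDensity fun u => ENNReal.ofReal (‖B u‖ ^ p)) ≤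
          (8 ^ n : ℝ≥0∞) • (sphereMeasure n).withDensity fun u => ENNReal.ofReal (‖B u‖ ^ p) := by
        rw [← withDensity_smul_measure]
        exact withDensity_le_withDensity_of_le (ballMeasure_bounds hn).1 _
      have h5 := h4 ((fun u => nrm (B u)) ⁻¹' s)
      rw [Measure.smul_apply, smul_eq_mul] at h5
      rw [rangeMeasure, Measure.map_apply hBm hs]
      refine le_trans ?_ h5
      rw [ballMeasure, withDensity_map measurable_nrm hdm,
        Measure.map_apply measurable_nrm (hBm hs), withDensity_apply _ (measurable_nrm (hBm hs)),
        Measure.restrict_restrict (measurable_nrm (hBm hs)), ← setLIntegral_const]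
      refine (setLIntegral_mono' hXm fun x hx => ?_).trans (lintegral_mono_set fun x hx => ?_)
      -- As `‖x‖ ≤ 1`, normalizing `x` only enlarges its image, so the lower bound `δ / 2` from the
      -- shell persists.
      · refine ENNReal.ofReal_le_ofReal (Real.rpow_le_rpow (by positivity) ?_ hp)
        have h6 : δ / 2 ≤ ‖B' x‖ := hx.2.2.1
        have h7 : ‖B x‖ = ‖B' x‖ := by rw [← hjB]; exact j.norm_map _
        have h8 : ‖B x‖ = ‖x‖ * ‖B (nrm x)‖ := by
          conv_lhs => rw [← norm_smul_nrm x, map_smul, norm_smul, norm_norm]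
        have h9 : ‖x‖ ≤ 1 := by simpa using hx.1
        rw [h7] at h8
        refine h6.trans (h8.le.trans ?_)
        exact mul_le_of_le_one_left (norm_nonneg _) h9
      · refine ⟨?_, hx.1⟩
        simp only [mem_preimage]
        rw [hnB]
        exact hx.2.1
    calc sphereMeasure k (j ⁻¹' s) ≤ 8 ^ k * ballMeasure k (j ⁻¹' s) := (ballMeasure_bounds hk).2 _
      _ ≤ 8 ^ k * ((ENNReal.ofReal (δ ^ k))⁻¹ * (2 * (c' *
          ((ENNReal.ofReal ((δ / 2) ^ p))⁻¹ * (8 ^ n * rangeMeasure p B s))))) := by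
          gcongr
          exact h1.trans (by gcongr)
      _ = _ := by ring

end Range

end

/-! ### Normalized sequences and the cone-volume measure of their limit. -/

section

variable {n : ℕ} {K : Set (E n)} {p : ℝ}

/-- A convergent sequence of normalized bodies `Ks`, together with linear maps `Ms` such that the
images `Ms m '' Ks m` have `L_p` surface area densities bounded by `l` and `l⁻¹`, and whose adjoints
converge up to scaling. -/
structure NormalizedSequence (p l : ℝ) (Ks : ℕ → Set (E n)) (K : Set (E n))
    (Ms : ℕ → E n ≃L[ℝ] E n) (ts : ℕ → ℝ) (Bs : ℕ → E n →L[ℝ] E n) (B : E n →L[ℝ] E n)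
    (R : ℝ) (z : E n) (r : ℝ) : Prop where
  one_lt : 1 < l
  isBody : ∀ m, IsBody (Ks m)
  zero_mem_interior : ∀ m, (0 : E n) ∈ interior (Ks m)
  norm_le : ∀ m, ∀ x ∈ Ks m, ‖x‖ ≤ R
  r_pos : 0 < r
  closedBall_subset : ∀ m, Metric.closedBall z r ⊆ Ks m
  density : ∀ m, ∃ f : Sphere n → ℝ,
    HasDensity (surfaceAreaMeasure (Ms m '' Ks m)) (sphericalMeasure n) f ∧
    ∀ᵐ u : Sphere n ∂(sphericalMeasure n),
      l⁻¹ ≤ supportFunction (Ms m '' Ks m) (u : E n) ^ (1 - p) * f u ∧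
      supportFunction (Ms m '' Ks m) (u : E n) ^ (1 - p) * f u ≤ l
  ts_pos : ∀ m, 0 < ts m
  adjoint_eq : ∀ m, (Ms m : E n →L[ℝ] E n).adjoint = ts m • Bs m
  norm_eq : ∀ m, ‖Bs m‖ = 1
  limit_isBody : IsBody K
  tendsto_body : BodyTendsto Ks K
  tendsto_map : Tendsto Bs atTop (𝓝 B)

namespace NormalizedSequence

variable {l R r : ℝ} {Ks : ℕ → Set (E n)} {Ms : ℕ → E n ≃L[ℝ] E n} {ts : ℕ → ℝ}
  {Bs : ℕ → E n →L[ℝ] E n} {B : E n →L[ℝ] E n} {z : E n}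

/-- The scaling factor between cone volumes and normalized images of the spherical measure. -/
def scale (p : ℝ) (Ms : ℕ → E n ≃L[ℝ] E n) (ts : ℕ → ℝ) (m : ℕ) : ℝ≥0∞ :=
  ENNReal.ofReal (ts m ^ p / |LinearMap.det (Ms m : E n →ₗ[ℝ] E n)|)

theorem norm_limit (h : NormalizedSequence p l Ks K Ms ts Bs B R z r) : ‖B‖ = 1 := by
  have h1 := h.tendsto_map.norm
  simp only [h.norm_eq] at h1
  exact tendsto_nhds_unique h1 tendsto_const_nhds |>.symm ▸ rfl

theorem limit_ne_zero (h : NormalizedSequence p l Ks K Ms ts Bs B R z r) : B ≠ 0 := by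
  rintro rfl
  simpa using h.norm_limit

theorem lintegral_bounds (hn : 0 < n) (h : NormalizedSequence p l Ks K Ms ts Bs B R z r) (m : ℕ)
    {φ : E n → ℝ≥0∞} (hφ : Measurable φ) :
    (∫⁻ u, φ u ∂(coneVolume (Ks m)) ≤ 8 ^ n * ENNReal.ofReal l * (scale p Ms ts m *
      ∫⁻ u, φ (nrm (Bs m u)) * ENNReal.ofReal (supportFunction (Ks m) (Bs m u) ^ p)
        ∂(sphereMeasure n))) ∧
    scale p Ms ts m *
      ∫⁻ u, φ (nrm (Bs m u)) * ENNReal.ofReal (supportFunction (Ks m) (Bs m u) ^ p)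
        ∂(sphereMeasure n) ≤ 8 ^ n * ENNReal.ofReal l * ∫⁻ u, φ u ∂(coneVolume (Ks m)) := by
  obtain ⟨f, hf, hb⟩ := h.density m
  exact (h.isBody m).coneVolume_linear_bounds hn (h.zero_mem_interior m) h.one_lt (Ms m) hf hb
    (h.ts_pos m) (h.adjoint_eq m) hφ

theorem volume_limit_pos (h : NormalizedSequence p l Ks K Ms ts Bs B R z r) : 0 < volume K :=
  (isOpen_interior.measure_pos volume h.limit_isBody.interior_nonempty).trans_le
    (measure_mono interior_subset)

theorem volume_limit_ne_top (h : NormalizedSequence p l Ks K Ms ts Bs B R z r) : volume K ≠ ⊤ :=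
  h.limit_isBody.isCompact.measure_lt_top.ne

theorem tendsto_volume (hn : 0 < n) (h : NormalizedSequence p l Ks K Ms ts Bs B R z r) :
    Tendsto (fun m => volume (Ks m)) atTop (𝓝 (volume K)) := by
  have h1 := h.tendsto_body.tendsto_lintegral_coneVolume hn h.isBody h.limit_isBody h.norm_le
    (φ := fun _ => 1) continuous_const fun _ => le_rfl
  simpa [(h.isBody _).coneVolume_univ hn, h.limit_isBody.coneVolume_univ hn] using h1

theorem lintegral_limit_ne_top (hn : 0 < n) (hp : 0 ≤ p)
    (h : NormalizedSequence p l Ks K Ms ts Bs B R z r) :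
    ∫⁻ u, ENNReal.ofReal (supportFunction K (B u) ^ p) ∂(sphereMeasure n) ≠ ⊤ := by
  have := isFiniteMeasure_sphereMeasure hn
  obtain ⟨R', hR'0, hR'⟩ := h.limit_isBody.exists_norm_le
  have hle : ∫⁻ u, ENNReal.ofReal (supportFunction K (B u) ^ p) ∂(sphereMeasure n) ≤
      ∫⁻ _, ENNReal.ofReal (R' ^ p) ∂(sphereMeasure n) := by
    refine lintegral_mono_ae ?_
    filter_upwards [ae_sphereMeasure_norm n] with u hu
    refine ENNReal.ofReal_le_ofReal
      (Real.rpow_le_rpow (h.limit_isBody.supportFunction_nonneg _) ?_ hp)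
    refine (supportFunction_le_mul_norm h.limit_isBody hR' _).trans ?_
    have h1 := B.le_opNorm u
    rw [hu, h.norm_limit, mul_one] at h1
    nlinarith
  refine (hle.trans_lt ?_).ne
  rw [lintegral_const]
  finiteness

/-- Take the test function `1`: the scale is comparable to the quotient of the volume of `Ks m` by
an integral `I m`, and both have positive finite limits. Halving and adding one turn the limits into
bounds that hold eventually. -/
theorem exists_scale_bounds (hn : 0 < n) (hp : 0 ≤ p)
    (h : NormalizedSequence p l Ks K Ms ts Bs B R z r) :
    ∃ Q₁ Q₂ : ℝ≥0∞, Q₁ ≠ 0 ∧ Q₁ ≠ ⊤ ∧ Q₂ ≠ ⊤ ∧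
      ∀ᶠ m in atTop, Q₁ ≤ scale p Ms ts m ∧ scale p Ms ts m ≤ Q₂ := by
  set C : ℝ≥0∞ := 8 ^ n * ENNReal.ofReal l with hC
  have hl0 : 0 < l := by linarith [h.one_lt]
  have hC0 : C ≠ 0 := by simp [hC, hl0]
  have hCt : C ≠ ⊤ := by finiteness
  set I : ℕ → ℝ≥0∞ := fun m => ∫⁻ u, ENNReal.ofReal (supportFunction (Ks m) (Bs m u) ^ p)
    ∂(sphereMeasure n) with hI
  set I' := ∫⁻ u, ENNReal.ofReal (supportFunction K (B u) ^ p) ∂(sphereMeasure n) with hI'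
  have hIlim : Tendsto I atTop (𝓝 I') := by
    have := tendsto_lintegral_sphere hn h.tendsto_body h.isBody h.limit_isBody h.norm_le hp
      h.tendsto_map (fun m => (h.norm_eq m).le) h.limit_ne_zero (φ := fun _ => 1) continuous_const
      fun _ => le_rfl
    simpa using this
  have hI0 : I' ≠ 0 := (lintegral_sphere_pos hn h.limit_isBody h.limit_ne_zero).ne'
  have hIt : I' ≠ ⊤ := h.lintegral_limit_ne_top hn hp
  have hJlim := h.tendsto_volume hn
  have hb : ∀ m, volume (Ks m) ≤ C * (scale p Ms ts m * I m) ∧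
      scale p Ms ts m * I m ≤ C * volume (Ks m) := by
    intro m
    have := h.lintegral_bounds hn m (φ := fun _ => 1) measurable_const
    simpa [(h.isBody m).coneVolume_univ hn] using this
  have hup : Tendsto (fun m => C * volume (Ks m) / I m) atTop (𝓝 (C * volume K / I')) :=
    ENNReal.Tendsto.div (ENNReal.Tendsto.const_mul hJlim (Or.inr hCt)) (Or.inr hI0) hIlim
      (Or.inr (ENNReal.mul_ne_top hCt h.volume_limit_ne_top))
  have hlo : Tendsto (fun m => volume (Ks m) / (C * I m)) atTop (𝓝 (volume K / (C * I'))) :=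
    ENNReal.Tendsto.div hJlim (Or.inr (mul_ne_zero hC0 hI0))
      (ENNReal.Tendsto.const_mul hIlim (Or.inr hCt)) (Or.inr h.volume_limit_ne_top)
  have hupf : C * volume K / I' ≠ ⊤ :=
    ENNReal.div_ne_top (ENNReal.mul_ne_top hCt h.volume_limit_ne_top) hI0
  have hlof : volume K / (C * I') ≠ 0 :=
    ENNReal.div_ne_zero.2 ⟨h.volume_limit_pos.ne', ENNReal.mul_ne_top hCt hIt⟩
  have hlot : volume K / (C * I') ≠ ⊤ :=
    ENNReal.div_ne_top h.volume_limit_ne_top (mul_ne_zero hC0 hI0)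
  refine ⟨volume K / (C * I') / 2, C * volume K / I' + 1, ?_, ?_, ?_, ?_⟩
  · exact (ENNReal.half_pos hlof).ne'
  · exact ENNReal.div_ne_top hlot two_ne_zero
  · finiteness
  · filter_upwards [hup.eventually_lt_const (ENNReal.lt_add_right hupf one_ne_zero),
      hlo.eventually_const_lt (ENNReal.half_lt_self hlof hlot),
      hIlim.eventually_const_lt (pos_iff_ne_zero.2 hI0),
      hIlim.eventually_lt_const (lt_top_iff_ne_top.2 hIt)] with m h1 h2 h3 h4
    constructor
    · refine h2.le.trans ?_
      refine ENNReal.div_le_of_le_mul ?_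
      calc volume (Ks m) ≤ C * (scale p Ms ts m * I m) := (hb m).1
        _ = scale p Ms ts m * (C * I m) := by ring
    · refine le_trans ?_ h1.le
      rw [ENNReal.le_div_iff_mul_le (Or.inl h3.ne') (Or.inl h4.ne)]
      exact (hb m).2

/-- The cone-volume measure of the limit body. -/
theorem exists_coneVolume_bounds (hn : 0 < n) (hp : 0 ≤ p)
    (h : NormalizedSequence p l Ks K Ms ts Bs B R z r) :
    ∃ c₁ c₂ : ℝ≥0∞, c₁ ≠ ⊤ ∧ c₂ ≠ ⊤ ∧
      coneVolume K ≤ c₁ • (rangeMeasure p B).withDensity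
        (fun u => ENNReal.ofReal (supportFunction K u ^ p)) ∧
      (rangeMeasure p B).withDensity (fun u => ENNReal.ofReal (supportFunction K u ^ p)) ≤
        c₂ • coneVolume K := by
  obtain ⟨Q₁, Q₂, hQ10, hQ1t, hQ2t, hQ⟩ := h.exists_scale_bounds hn hp
  set C : ℝ≥0∞ := 8 ^ n * ENNReal.ofReal l with hC
  have hCt : C ≠ ⊤ := by finiteness
  set σ := (rangeMeasure p B).withDensity (fun u => ENNReal.ofReal (supportFunction K u ^ p))
    with hσ
  have hσfin : IsFiniteMeasure σ := by
    refine ⟨?_⟩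
    have := lintegral_rangeMeasure h.limit_isBody p B (φ := fun _ => 1) measurable_const
    rw [lintegral_one] at this
    rw [hσ, this]
    simpa using (h.lintegral_limit_ne_top hn hp).lt_top
  have hVfin : IsFiniteMeasure (coneVolume K) :=
    ⟨by rw [h.limit_isBody.coneVolume_univ hn]; exact h.volume_limit_ne_top.lt_top⟩
  -- The two-sided comparison passes to the limit for continuous test functions, and these determine
  -- the order of finite Borel measures.
  have hlim : ∀ φ : E n → ℝ≥0, Continuous φ → (∀ x, φ x ≤ 1) →
      ∫⁻ u, (φ u : ℝ≥0∞) ∂(coneVolume K) ≤ C * Q₂ * ∫⁻ u, (φ u : ℝ≥0∞) ∂σ ∧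
      Q₁ * ∫⁻ u, (φ u : ℝ≥0∞) ∂σ ≤ C * ∫⁻ u, (φ u : ℝ≥0∞) ∂(coneVolume K) := by
    intro φ hφ hφ1
    have hφm : Measurable fun u => (φ u : ℝ≥0∞) := hφ.measurable.coe_nnreal_ennreal
    have hV := h.tendsto_body.tendsto_lintegral_coneVolume hn h.isBody h.limit_isBody h.norm_le
      hφ hφ1
    have hS := tendsto_lintegral_sphere hn h.tendsto_body h.isBody h.limit_isBody h.norm_le hp
      h.tendsto_map (fun m => (h.norm_eq m).le) h.limit_ne_zero hφ hφ1
    rw [← lintegral_rangeMeasure h.limit_isBody p B hφm] at hS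
    constructor
    · refine le_of_tendsto_of_tendsto hV
        (ENNReal.Tendsto.const_mul hS (Or.inr (ENNReal.mul_ne_top hCt hQ2t))) ?_
      filter_upwards [hQ] with m hm
      refine (h.lintegral_bounds hn m hφm).1.trans ?_
      rw [mul_assoc C Q₂]
      gcongr
      exact hm.2
    · refine le_of_tendsto_of_tendsto (ENNReal.Tendsto.const_mul hS (Or.inr hQ1t))
        (ENNReal.Tendsto.const_mul hV (Or.inr hCt)) ?_
      filter_upwards [hQ] with m hm
      refine le_trans ?_ (h.lintegral_bounds hn m hφm).2
      gcongr
      exact hm.1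
  have hc2 : Q₁⁻¹ * C ≠ ⊤ := ENNReal.mul_ne_top (ENNReal.inv_ne_top.2 hQ10) hCt
  refine ⟨C * Q₂, Q₁⁻¹ * C, ENNReal.mul_ne_top hCt hQ2t, hc2, ?_, ?_⟩
  · have := Measure.smul_finite σ (ENNReal.mul_ne_top hCt hQ2t)
    refine measure_le_of_forall_lintegral_le fun φ hφ hφ1 => ?_
    rw [lintegral_smul_measure, smul_eq_mul]
    exact (hlim φ hφ hφ1).1
  · have := Measure.smul_finite (coneVolume K) hc2
    refine measure_le_of_forall_lintegral_le fun φ hφ hφ1 => ?_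
    rw [lintegral_smul_measure, smul_eq_mul, mul_assoc, ← ENNReal.mul_le_iff_le_inv hQ10 hQ1t]
    exact (hlim φ hφ hφ1).2

/-- The support function of the limit body is positive almost everywhere on the image of the
spherical measure. -/
theorem ae_supportFunction_pos (hn : 0 < n) (hp : 0 ≤ p) (hp1 : p < 1)
    (h : NormalizedSequence p l Ks K Ms ts Bs B R z r) :
    ∀ᵐ u ∂(sphereMeasure n), 0 < supportFunction K (B u) := by
  obtain ⟨Q₁, Q₂, hQ10, hQ1t, hQ2t, hQ⟩ := h.exists_scale_bounds hn hp
  set C : ℝ≥0∞ := 8 ^ n * ENNReal.ofReal l with hC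
  -- This is the integrand for the test function `1 / h`, rewritten by homogeneity. It stays
  -- integrable uniformly in `m`, since `1 / h` against the cone-volume measure is controlled by the
  -- surface area, and that by the common inner ball and the common outer ball.
  set F : ℕ → E n → ℝ≥0∞ := fun m u =>
    ENNReal.ofReal (‖Bs m u‖ * supportFunction (Ks m) (Bs m u) ^ (p - 1)) with hF
  have hinj : ∀ m u, u ≠ 0 → Bs m u ≠ 0 := fun m u hu hBu => by
    apply hu
    apply adjoint_injective (Ms m)
    rw [h.adjoint_eq, smul_apply, hBu, smul_zero]
  have hFm : ∀ m, Measurable (F m) := fun m => by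
    have h1 : Measurable fun u => supportFunction (Ks m) (Bs m u) :=
      ((h.isBody m).continuous_supportFunction.comp (Bs m).continuous).measurable
    fun_prop
  have hrpos : ENNReal.ofReal r ≠ 0 := by simpa using h.r_pos
  set W : ℝ≥0∞ := C * (8 ^ n * ((ENNReal.ofReal r)⁻¹ *
    (8 ^ n * volume (Metric.closedBall (0 : E n) R)))) with hW
  have hWt : W ≠ ⊤ := by
    have : volume (Metric.closedBall (0 : E n) R) ≠ ⊤ := measure_closedBall_lt_top.ne
    finiteness
  have hbound : ∀ m, scale p Ms ts m * ∫⁻ u, F m u ∂(sphereMeasure n) ≤ W := by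
    intro m
    have hh := (h.isBody m).continuous_supportFunction.measurable
    have hφ : Measurable fun u => (ENNReal.ofReal (supportFunction (Ks m) u))⁻¹ := by fun_prop
    have h1 := (h.lintegral_bounds hn m hφ).2
    have h2 := (h.isBody m).lintegral_inv_supportFunction_le hn
    have h3 := (h.isBody m).surfaceMeasure_univ_le hn h.r_pos (h.closedBall_subset m)
    have h4 : surfaceMeasure (Ks m) univ ≤ (ENNReal.ofReal r)⁻¹ *
        (8 ^ n * volume (Metric.closedBall (0 : E n) R)) := by
      rw [← ENNReal.mul_le_iff_le_inv hrpos ENNReal.ofReal_ne_top]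
      refine h3.trans ?_
      gcongr
      exact fun x hx => by simpa using h.norm_le m x hx
    have h5 : ∫⁻ u, F m u ∂(sphereMeasure n) =
        ∫⁻ u, (ENNReal.ofReal (supportFunction (Ks m) (nrm (Bs m u))))⁻¹ *
          ENNReal.ofReal (supportFunction (Ks m) (Bs m u) ^ p) ∂(sphereMeasure n) := by
      refine lintegral_congr_ae ?_
      filter_upwards [ae_sphereMeasure_norm n] with u hu
      have hu0 : u ≠ 0 := by rintro rfl; simp at hu
      have hv := hinj m u hu0
      have hv' : 0 < ‖Bs m u‖ := norm_pos_iff.2 hv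
      have hpos := (h.isBody m).supportFunction_pos (h.zero_mem_interior m) hv
      have hs : supportFunction (Ks m) (nrm (Bs m u)) =
          ‖Bs m u‖⁻¹ * supportFunction (Ks m) (Bs m u) := by
        rw [nrm, supportFunction_smul (by positivity)]
      simp only [hF]
      rw [hs, ← ENNReal.ofReal_inv_of_pos (by positivity), ← ENNReal.ofReal_mul (by positivity),
        mul_inv, inv_inv, Real.rpow_sub hpos, Real.rpow_one]
      congr 1
      field_simp
    rw [h5]
    refine h1.trans ?_
    rw [hW]
    gcongr
    exact h2.trans (by gcongr)
  have hFle : ∀ᶠ m in atTop, ∫⁻ u, F m u ∂(sphereMeasure n) ≤ Q₁⁻¹ * W := by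
    filter_upwards [hQ] with m hm
    rw [← ENNReal.mul_le_iff_le_inv hQ10 hQ1t]
    exact le_trans (by gcongr; exact hm.1) (hbound m)
  have hfatou : ∫⁻ u, liminf (fun m => F m u) atTop ∂(sphereMeasure n) ≤ Q₁⁻¹ * W := by
    refine (lintegral_liminf_le hFm).trans ?_
    exact liminf_le_of_le (by isBoundedDefault) fun b hb =>
      (hb.and hFle).exists.elim fun m hm => hm.1.trans hm.2
  have hfin : ∫⁻ u, liminf (fun m => F m u) atTop ∂(sphereMeasure n) ≠ ⊤ :=
    (hfatou.trans_lt (ENNReal.mul_ne_top (ENNReal.inv_ne_top.2 hQ10) hWt).lt_top).ne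
  filter_upwards [ae_lt_top (Measurable.liminf hFm) hfin, ae_sphereMeasure_norm n,
    ae_sphereMeasure_apply_ne_zero hn h.limit_ne_zero] with u hlt hu hBu
  by_contra hnp
  have hzero : supportFunction K (B u) = 0 :=
    le_antisymm (not_lt.1 hnp) (h.limit_isBody.supportFunction_nonneg _)
  have hu0 : u ≠ 0 := by rintro rfl; simp at hu
  have hl := tendsto_apply_of_tendsto h.tendsto_map u
  have hs := h.tendsto_body.tendsto_supportFunction h.isBody h.limit_isBody hl
  rw [hzero] at hs
  -- Where the limiting support function vanishes, the negative exponent `p - 1` sends `F m u` to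
  -- infinity, as `‖Bs m u‖` tends to `‖B u‖ ≠ 0`. By Fatou's lemma this happens only on a null set.
  have hs' : Tendsto (fun m => supportFunction (Ks m) (Bs m u)) atTop (𝓝[>] 0) :=
    tendsto_nhdsWithin_iff.2 ⟨hs, Eventually.of_forall fun m =>
      (h.isBody m).supportFunction_pos (h.zero_mem_interior m) (hinj m u hu0)⟩
  have hpow := (tendsto_rpow_neg_nhdsGT_zero (y := p - 1) (by linarith)).comp hs'
  have htop : Tendsto (fun m => F m u) atTop (𝓝 ⊤) :=
    ENNReal.tendsto_ofReal_nhds_top.2 (hl.norm.pos_mul_atTop (norm_pos_iff.2 hBu) hpow)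
  rw [htop.liminf_eq] at hlt
  exact lt_irrefl _ hlt

end NormalizedSequence

end

/-! ### The `L_p` surface area measure of the limit, the position of the origin, and degeneracy. -/

section

variable {n : ℕ} {K : Set (E n)} {p : ℝ}

/-- Mutually bounded finite measures have a density bounded from above and from below. -/
theorem exists_density_of_le_smul {α : Type*} [MeasurableSpace α] {μ ν : Measure α}
    [IsFiniteMeasure ν] {a b : ℝ≥0∞} (ha : a ≠ ⊤) (hb : b ≠ ⊤) (h1 : μ ≤ a • ν)
    (h2 : ν ≤ b • μ) :
    μ ≪ ν ∧ ∃ φ : α → ℝ, HasDensity μ ν φ ∧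
      ∃ c d : ℝ, 0 < c ∧ ∀ᵐ u ∂ν, c ≤ φ u ∧ φ u ≤ d := by
  have hac : μ ≪ ν := Measure.absolutelyContinuous_of_le_smul h1
  have hμ : IsFiniteMeasure μ := by
    have := Measure.smul_finite ν ha
    exact isFiniteMeasure_of_le _ h1
  have hm := Measure.measurable_rnDeriv μ ν
  have htop := Measure.rnDeriv_lt_top μ ν
  have heq : ν.withDensity (μ.rnDeriv ν) = μ := Measure.withDensity_rnDeriv_eq μ ν hac
  -- The summand `1` in the lower bound keeps it positive and meaningful when `b` is zero.
  refine ⟨hac, fun x => (μ.rnDeriv ν x).toReal, ⟨hm.ennreal_toReal,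
    fun _ => ENNReal.toReal_nonneg, ?_⟩, (b.toReal + 1)⁻¹, a.toReal, by positivity, ?_⟩
  · nth_rewrite 1 [← heq]
    refine withDensity_congr_ae ?_
    filter_upwards [htop] with x hx
    exact (ENNReal.ofReal_toReal hx.ne).symm
  · have hup : ∀ᵐ u ∂ν, μ.rnDeriv ν u ≤ a := by
      refine ae_le_of_forall_setLIntegral_le_of_sigmaFinite hm fun s hs _ => ?_
      rw [setLIntegral_const]
      exact (Measure.setLIntegral_rnDeriv_le s).trans (h1 s)
    have hlo : ∀ᵐ u ∂ν, 1 ≤ b * μ.rnDeriv ν u := by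
      refine ae_le_of_forall_setLIntegral_le_of_sigmaFinite measurable_const fun s hs _ => ?_
      rw [setLIntegral_const, one_mul, lintegral_const_mul _ hm, Measure.setLIntegral_rnDeriv hac]
      exact h2 s
    filter_upwards [hup, hlo, htop] with u hu hl ht
    refine ⟨?_, ENNReal.toReal_mono ha hu⟩
    have h3 : 1 ≤ b.toReal * (μ.rnDeriv ν u).toReal := by
      have := ENNReal.toReal_mono (ENNReal.mul_ne_top hb ht.ne) hl
      rwa [ENNReal.toReal_mul, ENNReal.toReal_one] at this
    have h4 : 0 ≤ (μ.rnDeriv ν u).toReal := ENNReal.toReal_nonneg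
    rw [inv_le_iff_one_le_mul₀' (by positivity)]
    linarith

theorem smul_measure_mono {α : Type*} [MeasurableSpace α] {μ ν : Measure α} (c : ℝ≥0∞)
    (h : μ ≤ ν) : c • μ ≤ c • ν := fun s => by
  rw [Measure.smul_apply, Measure.smul_apply, smul_eq_mul, smul_eq_mul]
  exact mul_le_mul_right (h s) c

theorem map_val_lpSurfaceAreaMeasure (hK : IsBody K) (p : ℝ) :
    Measure.map Subtype.val (lpSurfaceAreaMeasure p K) =
      (surfaceMeasure K).withDensity fun u => ENNReal.ofReal (supportFunction K u ^ (1 - p)) := by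
  have hh : Measurable (supportFunction K) := hK.continuous_supportFunction.measurable
  have hg : Measurable fun u => ENNReal.ofReal (supportFunction K u ^ (1 - p)) := by fun_prop
  rw [surfaceMeasure, withDensity_map measurable_subtype_coe hg]
  rfl

theorem le_smul_of_map_val_le {μ ν : Measure (Sphere n)} {a : ℝ≥0∞}
    (h : Measure.map Subtype.val μ ≤ a • Measure.map Subtype.val ν) : μ ≤ a • ν := by
  have he : MeasurableEmbedding (Subtype.val : Sphere n → E n) :=
    MeasurableEmbedding.subtype_coe Metric.isClosed_sphere.measurableSet
  intro s
  have := h (Subtype.val '' s)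
  rwa [Measure.smul_apply, he.map_apply, he.map_apply,
    preimage_image_eq _ Subtype.val_injective] at this

theorem isFiniteMeasure_subsphereMeasure {H : Submodule ℝ (E n)} (hH : H ≠ ⊥) :
    IsFiniteMeasure (subsphereMeasure H) := by
  have hk : 0 < Module.finrank ℝ H := by
    rwa [Module.finrank_pos_iff, Submodule.nontrivial_iff_ne_bot]
  have := isFiniteMeasure_sphereMeasure hk
  have hj : Measurable (subspaceParam H) := (subspaceParam H).continuous.measurable
  have h1 := map_subspaceParam_sphereMeasure H
  refine ⟨?_⟩
  have h2 : subsphereMeasureAmbient H univ < ⊤ := by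
    rw [← h1, Measure.map_apply hj MeasurableSet.univ]
    exact measure_lt_top _ _
  rwa [subsphereMeasureAmbient, Measure.map_apply measurable_subtype_coe MeasurableSet.univ] at h2

theorem measurableSet_subsphere (H : Submodule ℝ (E n)) : MeasurableSet (subsphere H) :=
  (H.closed_of_finiteDimensional.preimage continuous_subtype_val).measurableSet

theorem subsphereMeasure_compl (H : Submodule ℝ (E n)) :
    subsphereMeasure H (subsphere H)ᶜ = 0 := by
  rw [subsphereMeasure, Measure.restrict_apply (measurableSet_subsphere H).compl]
  simp

namespace NormalizedSequence

variable {l R r : ℝ} {Ks : ℕ → Set (E n)} {Ms : ℕ → E n ≃L[ℝ] E n} {ts : ℕ → ℝ}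
  {Bs : ℕ → E n →L[ℝ] E n} {B : E n →L[ℝ] E n} {z : E n}

theorem ae_rangeMeasure_supportFunction_pos (hn : 0 < n) (hp : 0 ≤ p) (hp1 : p < 1)
    (h : NormalizedSequence p l Ks K Ms ts Bs B R z r) :
    ∀ᵐ u ∂(rangeMeasure p B), 0 < supportFunction K u := by
  have hh : Measurable (supportFunction K) := h.limit_isBody.continuous_supportFunction.measurable
  have hBm : Measurable fun u => nrm (B u) := measurable_nrm.comp B.continuous.measurable
  rw [rangeMeasure, ae_map_iff hBm.aemeasurable (measurableSet_lt measurable_const hh)]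
  refine (withDensity_absolutelyContinuous _ _).ae_le ?_
  filter_upwards [h.ae_supportFunction_pos hn hp hp1] with u hu
  rw [← supportFunction_nrm] at hu
  exact pos_of_mul_pos_right hu (norm_nonneg _)

/-- The `L_p` surface area measure of the limit body is comparable to the spherical measure of a
great subsphere. -/
theorem exists_lpSurfaceAreaMeasure_bounds (hn : 0 < n) (hp : 0 ≤ p) (hp1 : p < 1)
    (h : NormalizedSequence p l Ks K Ms ts Bs B R z r) :
    ∃ a b : ℝ≥0∞, a ≠ ⊤ ∧ b ≠ ⊤ ∧
      lpSurfaceAreaMeasure p K ≤ a • subsphereMeasure (LinearMap.range (B : E n →ₗ[ℝ] E n)) ∧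
      subsphereMeasure (LinearMap.range (B : E n →ₗ[ℝ] E n)) ≤ b • lpSurfaceAreaMeasure p K := by
  have hK := h.limit_isBody
  obtain ⟨c₁, c₂, hc₁, hc₂, hV1, hV2⟩ := h.exists_coneVolume_bounds hn hp
  obtain ⟨a, b, ha, hb, hR1, hR2⟩ :=
    exists_rangeMeasure_bounds hn h.limit_ne_zero h.norm_limit.le hp
  have hh : Measurable (supportFunction K) := hK.continuous_supportFunction.measurable
  have h0 := hK.supportFunction_nonneg
  set w : E n → ℝ≥0∞ := fun u => ENNReal.ofReal (supportFunction K u ^ (-p)) with hw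
  have hwm : Measurable w := by fun_prop
  have hm1 : Measurable fun u => ENNReal.ofReal (supportFunction K u) := by fun_prop
  have hmp : Measurable fun u => ENNReal.ofReal (supportFunction K u ^ p) := by fun_prop
  -- Multiplying by `w = h ^ (-p)` turns `h` into `h ^ (1 - p)`. At zeros of `h` both sides vanish
  -- because `1 - p > 0`.
  have hS : (surfaceMeasure K).withDensity
      (fun u => ENNReal.ofReal (supportFunction K u ^ (1 - p))) =
      ((surfaceMeasure K).withDensity fun u => ENNReal.ofReal (supportFunction K u)).withDensity
        w := by
    rw [← withDensity_mul _ hm1 hwm]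
    congr 1
    ext u
    rw [Pi.mul_apply, hw, ← ENNReal.ofReal_mul (h0 u)]
    congr 1
    rcases (h0 u).eq_or_lt with hu | hu
    · rw [← hu, Real.zero_rpow (by linarith), zero_mul]
    · rw [sub_eq_add_neg, Real.rpow_add hu, Real.rpow_one]
  -- Cancelling `h ^ p` against `h ^ (-p)` is where almost everywhere positivity of `h` is needed.
  have hσ : ((rangeMeasure p B).withDensity
      fun u => ENNReal.ofReal (supportFunction K u ^ p)).withDensity w = rangeMeasure p B := by
    rw [← withDensity_mul _ hmp hwm]
    conv_rhs => rw [← withDensity_one (μ := rangeMeasure p B)]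
    refine withDensity_congr_ae ?_
    filter_upwards [h.ae_rangeMeasure_supportFunction_pos hn hp hp1] with u hu
    rw [Pi.mul_apply, hw, ← ENNReal.ofReal_mul (by positivity), ← Real.rpow_add hu]
    simp
  obtain ⟨hC1, hC2⟩ := hK.coneVolume_bounds hn
  have mono : ∀ {μ ν : Measure (E n)} {c : ℝ≥0∞}, μ ≤ c • ν →
      μ.withDensity w ≤ c • ν.withDensity w := fun {μ ν c} hle => by
    rw [← withDensity_smul_measure]
    exact withDensity_le_withDensity_of_le hle w
  have h8 : (8 ^ n : ℝ≥0∞) ≠ ⊤ := by finiteness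
  refine ⟨8 ^ n * (c₁ * a), b * (c₂ * 8 ^ n), by finiteness, by finiteness,
    le_smul_of_map_val_le ?_, le_smul_of_map_val_le ?_⟩
  · rw [map_val_lpSurfaceAreaMeasure hK, hS, mul_smul, mul_smul]
    refine (mono hC2).trans (smul_measure_mono _ ?_)
    refine (mono hV1).trans (smul_measure_mono _ ?_)
    rw [hσ]
    exact hR1
  · rw [map_val_lpSurfaceAreaMeasure hK, hS, mul_smul, mul_smul]
    refine hR2.trans (smul_measure_mono _ ?_)
    rw [← hσ]
    exact (mono hV2).trans (smul_measure_mono _ (mono hC1))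

/-- If the limit map is not surjective, the origin lies on the boundary of the limit body. -/
theorem zero_mem_frontier (hn : 0 < n) (hp : 0 ≤ p)
    (h : NormalizedSequence p l Ks K Ms ts Bs B R z r)
    (hH : LinearMap.range (B : E n →ₗ[ℝ] E n) ≠ ⊤) : (0 : E n) ∈ frontier K := by
  have hK := h.limit_isBody
  set H := LinearMap.range (B : E n →ₗ[ℝ] E n) with hHd
  rw [hK.isClosed.frontier_eq]
  refine ⟨hK.zero_mem, fun h0 => ?_⟩
  have hHm : MeasurableSet (H : Set (E n)) := H.closed_of_finiteDimensional.measurableSet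
  obtain ⟨c₁, c₂, hc₁, hc₂, hV1, -⟩ := h.exists_coneVolume_bounds hn hp
  have hBm : Measurable fun u => nrm (B u) := measurable_nrm.comp B.continuous.measurable
  have hR0 : rangeMeasure p B (H : Set (E n))ᶜ = 0 := by
    rw [rangeMeasure, Measure.map_apply hBm hHm.compl]
    have hemp : (fun u => nrm (B u)) ⁻¹' (H : Set (E n))ᶜ = ∅ :=
      eq_empty_of_forall_notMem fun u hu => hu (H.smul_mem _ ⟨u, rfl⟩)
    rw [hemp, measure_empty]
  have hV0 : coneVolume K (H : Set (E n))ᶜ = 0 :=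
    Measure.absolutelyContinuous_of_le_smul hV1 (withDensity_absolutelyContinuous _ _ hR0)
  rw [coneVolume, Measure.map_apply (measurable_normalMap K) hHm.compl,
    Measure.restrict_apply (measurable_normalMap K hHm.compl)] at hV0
  obtain ⟨e, heH, he⟩ : ∃ e ∈ Hᗮ, ‖e‖ = 1 := by
    obtain ⟨v, hv, hv0⟩ := Submodule.exists_mem_ne_zero_of_ne_bot
      (mt Submodule.orthogonal_eq_bot_iff.1 hH)
    exact ⟨nrm v, Hᗮ.smul_mem _ hv, norm_nrm hv0⟩
  obtain ⟨ρ, hρ, hball⟩ := Metric.nhds_basis_closedBall.mem_iff.1 (mem_interior_iff_mem_nhds.1 h0)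
  obtain ⟨R', hR'0, hR'⟩ := hK.exists_norm_le
  -- A thin cone around a direction `e` orthogonal to `H`. A normal `N ∈ H` seen from such a point
  -- would give the exit point height below `ρ`, whereas the ball of radius `ρ` inside `K` forces
  -- height at least `ρ`. So this open set has normals outside `H`, contradicting `hV0`.
  set U : Set (E n) := interior K ∩ {x | ‖x - ‖x‖ • e‖ < ρ / R' * ‖x‖} with hU
  have hUo : IsOpen U := isOpen_interior.inter (isOpen_lt (by fun_prop) (by fun_prop))
  have hUne : U.Nonempty := by
    obtain ⟨δ, hδ, hδb⟩ := Metric.nhds_basis_closedBall.mem_iff.1 (isOpen_interior.mem_nhds h0)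
    have hne : ‖δ • e‖ = δ := by rw [norm_smul, he, mul_one, Real.norm_of_nonneg hδ.le]
    refine ⟨δ • e, hδb (by simp [hne]), ?_⟩
    rw [mem_ofPred_eq, hne, sub_self, norm_zero]
    positivity
  refine (hUo.measure_pos volume hUne).ne' (measure_mono_null ?_
    (measure_union_null hK.ae_differentiableAt_gauge hV0))
  intro x hx
  have hx0 : x ≠ 0 := by
    rintro rfl
    simpa using hx.2
  by_cases hxd : x ∈ gaugeDiffSet K
  · right
    refine ⟨fun hxN => ?_, hxd⟩
    obtain ⟨hN1, hN⟩ := hK.norm_normalMap hxd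
    set N := normalMap K x
    have hxK := interior_subset hx.1
    have hg := hK.gauge_pos hxK hx0
    have h1 : ρ ≤ (gauge K x)⁻¹ * inner ℝ x N := by
      have := hN (ρ • N) (hball (by simp [norm_smul, hN1, abs_of_pos hρ]))
      rwa [real_inner_smul_left, real_inner_smul_left, real_inner_self_eq_norm_sq, hN1, one_pow,
        mul_one] at this
    rw [le_inv_mul_iff₀ hg] at h1
    have h2 : inner ℝ x N = inner ℝ (x - ‖x‖ • e) N := by
      rw [inner_sub_left, real_inner_smul_left,
        Submodule.inner_left_of_mem_orthogonal (SetLike.mem_coe.1 hxN) heH]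
      ring
    have h3 : inner ℝ (x - ‖x‖ • e) N ≤ ‖x - ‖x‖ • e‖ := by
      simpa [hN1] using real_inner_le_norm (x - ‖x‖ • e) N
    have h4 : ‖x - ‖x‖ • e‖ < ρ / R' * ‖x‖ := hx.2
    have h5 := hK.norm_le_gauge_mul hR' hxK
    have h6 : ρ / R' * ‖x‖ ≤ ρ / R' * (gauge K x * R') := by gcongr
    have h7 : ρ / R' * (gauge K x * R') = gauge K x * ρ := by field_simp
    linarith
  · exact Or.inl ⟨⟨hx.1, hx0⟩, hxd⟩

theorem abs_det_eq (h : NormalizedSequence p l Ks K Ms ts Bs B R z r) (m : ℕ) :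
    |LinearMap.det (Ms m : E n →ₗ[ℝ] E n)| = ts m ^ n * |(Bs m).det| := by
  have h1 : ((Ms m : E n →L[ℝ] E n).adjoint).det = ts m ^ n * (Bs m).det := by
    rw [h.adjoint_eq, ContinuousLinearMap.det, ContinuousLinearMap.toLinearMap_smul,
      LinearMap.det_smul]
    simp
  have h2 : ((Ms m : E n →L[ℝ] E n).adjoint).det = LinearMap.det (Ms m : E n →ₗ[ℝ] E n) := by
    have hb := (EuclideanSpace.basisFun (Fin n) ℝ)
    have h3 : (((Ms m : E n →L[ℝ] E n).adjoint : E n →L[ℝ] E n) : E n →ₗ[ℝ] E n) =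
      LinearMap.adjoint (Ms m : E n →ₗ[ℝ] E n) := rfl
    rw [ContinuousLinearMap.det, h3, ← LinearMap.det_toMatrix hb.toBasis,
      LinearMap.toMatrix_adjoint, Matrix.det_conjTranspose, LinearMap.det_toMatrix]
    simp
  rw [← h2, h1, abs_mul, abs_of_pos (pow_pos (h.ts_pos m) n)]

/-- If the images `Ms m '' Ks m` degenerate, then the limit map is not surjective. -/
theorem range_ne_top (hn : 0 < n) (hp : 0 ≤ p) (hp1 : p < 1)
    (h : NormalizedSequence p l Ks K Ms ts Bs B R z r) {C : ℕ → ℝ} (hC : Tendsto C atTop atTop)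
    (hdeg : ∀ m, ¬((∀ u : Sphere n, supportFunction (Ms m '' Ks m) u ≤ C m) ∧
      (C m)⁻¹ ≤ (volume (Ms m '' Ks m)).toReal)) :
    LinearMap.range (B : E n →ₗ[ℝ] E n) ≠ ⊤ := by
  intro htop
  have hdet : B.det ≠ 0 := by
    have := (LinearMap.isUnit_iff_range_eq_top (B : E n →ₗ[ℝ] E n)).2 htop
    exact ((LinearMap.isUnit_iff_isUnit_det _).1 this).ne_zero
  obtain ⟨Q₁, Q₂, hQ10, hQ1t, hQ2t, hQ⟩ := h.exists_scale_bounds hn hp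
  set D := |B.det| with hD
  have hD0 : 0 < D := abs_pos.2 hdet
  have hdl : Tendsto (fun m => |(Bs m).det|) atTop (𝓝 D) :=
    ((ContinuousLinearMap.continuous_det.tendsto B).comp h.tendsto_map).abs
  set q₁ := Q₁.toReal
  set q₂ := Q₂.toReal
  have hq1 : 0 < q₁ := ENNReal.toReal_pos hQ10 hQ1t
  have hq2 : 0 ≤ q₂ := ENNReal.toReal_nonneg
  -- The scale equals `1 / (t ^ (n - p) * |det (Bs m)|)`. Since `n - p > 0` and the determinants
  -- converge to a nonzero limit, bounds on the scale confine `t` between `τ₁` and `τ₂`.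
  set e : ℝ := n - p with he
  have hn1 : (1 : ℝ) ≤ n := by exact_mod_cast hn
  have he0 : 0 < e := by linarith
  have hR0 : 0 ≤ R := (norm_nonneg _).trans (h.norm_le 0 z
    (h.closedBall_subset 0 (Metric.mem_closedBall_self h.r_pos.le)))
  set τ₂ := (2 / (q₁ * D)) ^ e⁻¹ with hτ2
  set τ₁ := (1 / (2 * D * (q₂ + 1))) ^ e⁻¹ with hτ1
  have hτ1pos : 0 < τ₁ := by positivity
  set v₀ := (volume (Metric.closedBall z r)).toReal with hv0
  have hv0pos : 0 < v₀ := ENNReal.toReal_pos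
    (Metric.measure_closedBall_pos volume z h.r_pos).ne' measure_closedBall_lt_top.ne
  set V := τ₁ ^ n * (D / 2) * v₀ with hV
  have hVpos : 0 < V := by positivity
  obtain ⟨m, hm1, hm2, hmQ, hmC1, hmC2⟩ := ((hdl.eventually_const_lt (half_lt_self hD0)).and
    ((hdl.eventually_lt_const (show D < 2 * D by linarith)).and (hQ.and
    ((hC.eventually_ge_atTop (R * τ₂)).and (hC.eventually_ge_atTop V⁻¹))))).exists
  have ht := h.ts_pos m
  set t := ts m
  set d := |(Bs m).det|
  have hd0 : 0 < d := (half_pos hD0).trans hm1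
  have hte : 0 < t ^ e := by positivity
  have hsc : t ^ p / |LinearMap.det (Ms m : E n →ₗ[ℝ] E n)| = 1 / (t ^ e * d) := by
    rw [h.abs_det_eq m, he, Real.rpow_sub ht, Real.rpow_natCast]
    have := Real.rpow_pos_of_pos ht p
    field_simp
    exact div_self (mul_pos (pow_pos ht n) hd0).ne'
  rw [scale, hsc] at hmQ
  have hs1 : q₁ ≤ 1 / (t ^ e * d) := ENNReal.toReal_le_of_le_ofReal (by positivity) hmQ.1
  have hs2 : 1 / (t ^ e * d) ≤ q₂ := (ENNReal.ofReal_le_iff_le_toReal hQ2t).1 hmQ.2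
  have ht2 : t ≤ τ₂ := by
    rw [hτ2, Real.le_rpow_inv_iff_of_pos ht.le (by positivity) he0, le_div_iff₀ (by positivity)]
    rw [le_div_iff₀ (by positivity)] at hs1
    nlinarith [mul_pos hq1 hte]
  have ht1 : τ₁ ≤ t := by
    rw [hτ1, Real.rpow_inv_le_iff_of_pos (by positivity) ht.le he0, div_le_iff₀ (by positivity)]
    rw [div_le_iff₀ (by positivity)] at hs2
    have : t ^ e * d ≤ t ^ e * (2 * D) := by gcongr
    nlinarith [mul_pos hte hD0]
  -- With `t` confined, the support function is at most `R * τ₂` and the volume at least `V`; `m`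
  -- was chosen so that `C m` exceeds both `R * τ₂` and `V⁻¹`.
  refine hdeg m ⟨fun u => ?_, ?_⟩
  · refine le_trans ?_ hmC1
    have him : supportFunction (Ms m '' Ks m) (u : E n) =
        supportFunction (Ks m) ((Ms m : E n →L[ℝ] E n).adjoint u) :=
      supportFunction_image (Ms m : E n →L[ℝ] E n) _
    rw [him]
    refine (supportFunction_le_mul_norm (h.isBody m) (h.norm_le m) _).trans ?_
    gcongr
    rw [h.adjoint_eq, smul_apply, norm_smul, Real.norm_of_nonneg ht.le]
    have h1 := (Bs m).le_opNorm (u : E n)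
    rw [h.norm_eq, norm_eq_of_mem_sphere, mul_one] at h1
    nlinarith
  · have hvol : (volume (Ms m '' Ks m)).toReal = t ^ n * d * (volume (Ks m)).toReal := by
      have := Measure.addHaar_image_linearMap volume (Ms m : E n →ₗ[ℝ] E n) (Ks m)
      rw [h.abs_det_eq m] at this
      rw [show Ms m '' Ks m = (Ms m : E n →ₗ[ℝ] E n) '' Ks m from rfl, this, ENNReal.toReal_mul,
        ENNReal.toReal_ofReal (by positivity)]
    rw [hvol]
    have hv : v₀ ≤ (volume (Ks m)).toReal :=
      ENNReal.toReal_mono (h.isBody m).isCompact.measure_lt_top.ne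
        (measure_mono (h.closedBall_subset m))
    calc (C m)⁻¹ ≤ V := inv_le_of_inv_le₀ hVpos hmC2
      _ ≤ t ^ n * d * (volume (Ks m)).toReal := by rw [hV]; gcongr

end NormalizedSequence

end

/-! ### Normalization by linear maps and compactness. -/

section

variable {n : ℕ} {K L : Set (E n)} {p : ℝ}

/-- A compact set that contains a neighbourhood of the origin has a linear image that contains the
standard basis and is contained in the cube `[-1, 1]ⁿ`. -/
theorem exists_equiv_normalizing (hL : IsCompact L) (h0 : (0 : E n) ∈ interior L) :
    ∃ M : E n ≃L[ℝ] E n, (∀ i, M (EuclideanSpace.single i 1) ∈ L) ∧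
      ∀ x, M x ∈ L → ‖x‖ ≤ √n := by
  set b := (EuclideanSpace.basisFun (Fin n) ℝ).toBasis with hb
  have hbi : ∀ i, b i = EuclideanSpace.single i 1 := fun i => by simp [hb]
  have hbr : ∀ (x : E n) i, b.repr x i = x i := fun x i => by simp [hb]
  have hcont : Continuous fun v : Fin n → E n => |b.det v| := by
    have : Continuous fun v : Fin n → E n => b.toMatrix v := by
      refine continuous_matrix fun i j => ?_
      simp only [Module.Basis.toMatrix_apply, hbr]
      fun_prop
    exact (this.matrix_det).abs
  -- Choose `n` points of `L` with maximal absolute determinant and let `M` send the standard basis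
  -- to them.
  obtain ⟨v, hv, hmax⟩ := (isCompact_univ_pi fun _ : Fin n => hL).exists_isMaxOn
    ⟨fun _ => 0, fun _ _ => interior_subset h0⟩ hcont.continuousOn
  have hvL : ∀ i, v i ∈ L := fun i => hv i (mem_univ i)
  have hmax' : ∀ w : Fin n → E n, (∀ i, w i ∈ L) → |b.det w| ≤ |b.det v| := fun w hw =>
    hmax fun i _ => hw i
  obtain ⟨ρ, hρ, hball⟩ := Metric.nhds_basis_closedBall.mem_iff.1 (mem_interior_iff_mem_nhds.1 h0)
  have hdet : b.det v ≠ 0 := by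
    have h1 := hmax' (fun i => ρ • b i) fun i => hball (by simp [hbi, norm_smul, abs_of_pos hρ])
    have h2 : b.det (fun i => ρ • b i) = ρ ^ n := by
      have := b.det.map_smul_univ (fun _ => ρ) b
      rw [this, Module.Basis.det_self]
      simp
    rw [h2] at h1
    have : 0 < |ρ ^ n| := by positivity
    exact abs_pos.1 (this.trans_le h1)
  obtain ⟨hli, hsp⟩ := b.is_basis_iff_det.2 hdet.isUnit
  set c := Module.Basis.mk hli hsp.ge with hc
  set M := (b.equiv c (Equiv.refl _)).toContinuousLinearEquiv with hM
  have hMb : ∀ i, M (b i) = v i := fun i => by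
    simp [hM, hc]
  refine ⟨M, fun i => by rw [← hbi, hMb]; exact hvL i, fun x hx => ?_⟩
  have hcoord : ∀ i, |x i| ≤ 1 := by
    intro i
    have h1 : c.coord i (M x) = x i := by
      have h2 : c.coord i ∘ₗ (M : E n →ₗ[ℝ] E n) = b.coord i := by
        refine b.ext fun j => ?_
        have : (M : E n →ₗ[ℝ] E n) (b j) = c j := by
          rw [hc, Module.Basis.mk_apply]
          exact hMb j
        rw [LinearMap.comp_apply, this]
        simp [Finsupp.single_apply]
      have h3 := LinearMap.congr_fun h2 x
      simpa [hbr] using h3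
    have h4 := LinearMap.congr_fun (Module.Basis.det_smul_mk_coord_eq_det_update b hli hsp.ge i)
      (M x)
    -- Cramer's rule: replacing the `i`-th vector by `M x ∈ L` multiplies the determinant by `x i`,
    -- so maximality gives `|x i| ≤ 1`.
    have h5 : b.det v * x i = b.det (Function.update v i (M x)) := by
      rw [← h1]
      exact h4
    have h6 := hmax' (Function.update v i (M x)) fun j => by
      by_cases hj : j = i
      · subst hj
        simpa using hx
      · simpa [hj] using hvL j
    rw [← h5, abs_mul] at h6
    exact (mul_le_iff_le_one_right (abs_pos.2 hdet)).1 h6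
  rw [EuclideanSpace.norm_eq]
  refine Real.sqrt_le_sqrt ?_
  calc ∑ i, ‖x i‖ ^ 2 ≤ ∑ _i : Fin n, (1 : ℝ) :=
        Finset.sum_le_sum fun i _ => pow_le_one₀ (norm_nonneg _) (hcoord i)
    _ = n := by simp

/-- Convex sets containing the origin and the standard basis contain a common ball. -/
theorem exists_closedBall_subset (n : ℕ) : ∃ (z : E n) (r : ℝ), 0 < r ∧
    ∀ K : Set (E n), Convex ℝ K → (0 : E n) ∈ K → (∀ i, EuclideanSpace.single i 1 ∈ K) →
      Metric.closedBall z r ⊆ K := by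
  -- The common ball is found in the simplex spanned by the origin and the standard basis.
  set S : Set (E n) := insert 0 (range fun i => EuclideanSpace.single i 1) with hS
  have hne : (interior (convexHull ℝ S)).Nonempty := by
    rw [interior_convexHull_nonempty_iff_affineSpan_eq_top, hS]
    have h1 : Submodule.span ℝ (range fun i : Fin n => (EuclideanSpace.single i 1 : E n)) = ⊤ := by
      have heq : (fun i : Fin n => (EuclideanSpace.single i 1 : E n)) =
          (EuclideanSpace.basisFun (Fin n) ℝ).toBasis := by
        funext i
        simp
      rw [heq]
      exact (EuclideanSpace.basisFun (Fin n) ℝ).toBasis.span_eq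
    rw [← AffineSubspace.coe_eq_univ_iff, affineSpan_insert_zero, h1]
    rfl
  obtain ⟨z, hz⟩ := hne
  obtain ⟨r, hr, hball⟩ := Metric.nhds_basis_closedBall.mem_iff.1 (isOpen_interior.mem_nhds hz)
  refine ⟨z, r, hr, fun K hK h0 hi => hball.trans (interior_subset.trans (convexHull_min ?_ hK))⟩
  rintro x (rfl | ⟨i, rfl⟩)
  exacts [h0, hi i]

namespace BodyTendsto

variable {Ks : ℕ → Set (E n)}

theorem mem_of_tendsto (h : BodyTendsto Ks K) (hK : IsClosed K) {x : ℕ → E n} {y : E n}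
    (hx : ∀ m, x m ∈ Ks m) (hxy : Tendsto x atTop (𝓝 y)) : y ∈ K := by
  obtain ⟨d, hd, hdist⟩ := h
  choose w hwK hw using fun m => (hdist m).1 (x m) (hx m)
  refine hK.mem_of_tendsto (f := w) (b := atTop) ?_ (Eventually.of_forall hwK)
  have h1 : Tendsto (fun m => x m - w m) atTop (𝓝 0) := squeeze_zero_norm hw hd
  simpa using hxy.sub h1

theorem exists_tendsto (h : BodyTendsto Ks K) {y : E n} (hy : y ∈ K) :
    ∃ x : ℕ → E n, (∀ m, x m ∈ Ks m) ∧ Tendsto x atTop (𝓝 y) := by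
  obtain ⟨d, hd, hdist⟩ := h
  choose x hxK hx using fun m => (hdist m).2 y hy
  refine ⟨x, hxK, ?_⟩
  have h1 : Tendsto (fun m => x m - y) atTop (𝓝 0) := squeeze_zero_norm hx hd
  simpa using h1.add_const y

/-- The common ball survives in the limit and prevents it from becoming flat. -/
theorem isBody (h : BodyTendsto Ks K) (hKs : ∀ m, IsBody (Ks m)) (hK : IsCompact K) {z : E n}
    {r : ℝ} (hr : 0 < r) (hball : ∀ m, Metric.closedBall z r ⊆ Ks m) : IsBody K where
  convex := by
    intro x hx y hy a b ha hb hab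
    obtain ⟨u, hu, hux⟩ := h.exists_tendsto hx
    obtain ⟨w, hw, hwy⟩ := h.exists_tendsto hy
    exact h.mem_of_tendsto hK.isClosed (fun m => (hKs m).convex (hu m) (hw m) ha hb hab)
      ((hux.const_smul a).add (hwy.const_smul b))
  isCompact := hK
  zero_mem := h.mem_of_tendsto hK.isClosed (fun m => (hKs m).zero_mem) tendsto_const_nhds
  interior_nonempty := by
    refine ⟨z, mem_interior_iff_mem_nhds.2 (mem_of_superset (Metric.closedBall_mem_nhds z hr) ?_)⟩
    exact fun x hx => h.mem_of_tendsto hK.isClosed (fun m => hball m hx) tendsto_const_nhds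

end BodyTendsto

/-- Blaschke selection, simultaneously with the selection of a convergent sequence of maps. -/
theorem exists_subseq_bodyTendsto {Ks : ℕ → Set (E n)} (hKs : ∀ m, IsBody (Ks m)) {R : ℝ}
    (hR : ∀ m, ∀ x ∈ Ks m, ‖x‖ ≤ R) {Bs : ℕ → E n →L[ℝ] E n} (hBs : ∀ m, ‖Bs m‖ = 1) :
    ∃ (K : Set (E n)) (B : E n →L[ℝ] E n) (φ : ℕ → ℕ), IsCompact K ∧ StrictMono φ ∧
      BodyTendsto (fun m => Ks (φ m)) K ∧ Tendsto (fun m => Bs (φ m)) atTop (𝓝 B) := by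
  let S : ℕ → TopologicalSpace.NonemptyCompacts (E n) := fun m =>
    ⟨⟨Ks m, (hKs m).isCompact⟩, ⟨0, (hKs m).zero_mem⟩⟩
  have hc := (TopologicalSpace.NonemptyCompacts.isCompact_subsets_of_isCompact
    (isCompact_closedBall (0 : E n) R)).prod (isCompact_closedBall (0 : E n →L[ℝ] E n) 1)
  obtain ⟨⟨K, B⟩, -, φ, hφ, hlim⟩ := hc.tendsto_subseq (x := fun m => (S m, Bs m)) fun m =>
    ⟨fun x hx => by simpa using hR m x hx, by simp [hBs m]⟩
  have hlimK : Tendsto (fun m => S (φ m)) atTop (𝓝 K) := (continuous_fst.tendsto _).comp hlim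
  have hlimB : Tendsto (fun m => Bs (φ m)) atTop (𝓝 B) := (continuous_snd.tendsto _).comp hlim
  -- The extra `1 / (m + 1)` provides the strict inequality needed to extract nearby points from the
  -- Hausdorff distance.
  refine ⟨K, B, φ, K.isCompact, hφ, ⟨fun m => dist (S (φ m)) K + 1 / ((m : ℝ) + 1), ?_, ?_⟩, hlimB⟩
  · simpa using (tendsto_iff_dist_tendsto_zero.1 hlimK).add
      (tendsto_one_div_add_atTop_nhds_zero_nat (𝕜 := ℝ))
  · intro m
    have hlt : Metric.hausdorffDist (S (φ m) : Set (E n)) K <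
        dist (S (φ m)) K + 1 / ((m : ℝ) + 1) := by
      rw [Metric.NonemptyCompacts.dist_eq]
      have : 0 < 1 / ((m : ℝ) + 1) := by positivity
      linarith
    have hfin : Metric.hausdorffEDist (S (φ m) : Set (E n)) K ≠ ⊤ :=
      Metric.hausdorffEDist_ne_top_of_nonempty_of_bounded (S (φ m)).nonempty K.nonempty
        (S (φ m)).isCompact.isBounded K.isCompact.isBounded
    constructor
    · intro x hx
      obtain ⟨y, hy, hxy⟩ := Metric.exists_dist_lt_of_hausdorffDist_lt (x := x) hx hlt hfin
      exact ⟨y, hy, by rw [← dist_eq_norm]; exact hxy.le⟩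
    · intro y hy
      obtain ⟨x, hx, hxy⟩ := Metric.exists_dist_lt_of_hausdorffDist_lt' hy hlt hfin
      exact ⟨x, hx, by rw [← dist_eq_norm]; exact hxy.le⟩

/-- A failure of the a priori bounds produces a convergent sequence of normalized bodies whose
linear images degenerate. -/
theorem exists_normalizedSequence (hn : 0 < n) (hneg : ¬ BoundedDensityAffirmative n p) :
    ∃ (l : ℝ) (Ks : ℕ → Set (E n)) (K : Set (E n)) (Ms : ℕ → E n ≃L[ℝ] E n) (ts : ℕ → ℝ)
      (Bs : ℕ → E n →L[ℝ] E n) (B : E n →L[ℝ] E n) (R : ℝ) (z : E n) (r : ℝ) (C : ℕ → ℝ),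
      NormalizedSequence p l Ks K Ms ts Bs B R z r ∧ Tendsto C atTop atTop ∧
      ∀ m, ¬((∀ u : Sphere n, supportFunction (Ms m '' Ks m) u ≤ C m) ∧
        (C m)⁻¹ ≤ (volume (Ms m '' Ks m)).toReal) := by
  have : Nonempty (Fin n) := ⟨⟨0, hn⟩⟩
  have : Nontrivial (E n) := inferInstance
  rw [BoundedDensityAffirmative] at hneg
  push Not at hneg
  obtain ⟨l, hl, hneg⟩ := hneg
  choose L hL0 f hf hb hdeg using fun m : ℕ => hneg ((m : ℝ) + 1) (by positivity)
  choose M hMe hMn using fun m => exists_equiv_normalizing (L m).isCompact (hL0 m)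
  obtain ⟨z, r, hr, hball⟩ := exists_closedBall_subset n
  set Ks : ℕ → Set (E n) := fun m => M m ⁻¹' (L m : Set (E n)) with hKs
  have himage : ∀ m, M m '' Ks m = (L m : Set (E n)) := fun m =>
    image_preimage_eq _ (M m).surjective
  have hint : ∀ m, (0 : E n) ∈ interior (Ks m) := fun m => by
    refine preimage_interior_subset_interior_preimage (M m).continuous ?_
    simpa using hL0 m
  have hbody : ∀ m, IsBody (Ks m) := fun m =>
    { convex := (L m).convex.linear_preimage (M m : E n →ₗ[ℝ] E n)
      isCompact := (M m).toHomeomorph.isCompact_preimage.2 (L m).isCompact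
      zero_mem := interior_subset (hint m)
      interior_nonempty := ⟨0, hint m⟩ }
  set ts : ℕ → ℝ := fun m => ‖(M m : E n →L[ℝ] E n).adjoint‖ with hts
  have hts0 : ∀ m, 0 < ts m := fun m => by
    refine norm_pos_iff.2 fun h => ?_
    obtain ⟨u, hu⟩ := exists_ne (0 : E n)
    exact hu (adjoint_injective (M m) (by rw [h]; rfl))
  set Bs : ℕ → E n →L[ℝ] E n := fun m => (ts m)⁻¹ • (M m : E n →L[ℝ] E n).adjoint with hBs
  have hBs1 : ∀ m, ‖Bs m‖ = 1 := fun m => by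
    rw [hBs, norm_smul, norm_inv, Real.norm_of_nonneg (hts0 m).le]
    exact inv_mul_cancel₀ (hts0 m).ne'
  obtain ⟨K, B, φ, hK, hφ, hKlim, hBlim⟩ := exists_subseq_bodyTendsto hbody
    (R := √n) (fun m x hx => hMn m x hx) hBs1
  have hballs : ∀ m, Metric.closedBall z r ⊆ Ks m := fun m =>
    hball _ (hbody m).convex (hbody m).zero_mem (hMe m)
  refine ⟨l, fun m => Ks (φ m), K, fun m => M (φ m), fun m => ts (φ m), fun m => Bs (φ m), B, √n,
    z, r, fun m => (φ m : ℝ) + 1, ⟨hl, fun m => hbody _, fun m => hint _,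
      fun m x hx => hMn _ x hx, hr, fun m => hballs _, fun m => ⟨f (φ m), ?_, ?_⟩, fun m => hts0 _,
      fun m => ?_, fun m => hBs1 _, hKlim.isBody (fun m => hbody _) hK hr fun m => hballs _, hKlim,
      hBlim⟩, ?_, fun m hm => ?_⟩
  · rw [himage]
    exact hf _
  · rw [himage]
    exact hb _
  · rw [hBs, smul_smul, mul_inv_cancel₀ (hts0 _).ne', one_smul]
  · exact tendsto_atTop_add_const_right _ _ (tendsto_natCast_atTop_atTop.comp hφ.tendsto_atTop)
  · rw [himage] at hm
    exact (hdeg (φ m) hm.1).not_ge hm.2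

end

end LpMinkowski

end

theorem proposition4p1 (n : ℕ) (hn : 2 ≤ n) (p : ℝ) (hp : p ∈ Set.Ico (0 : ℝ) 1)
    (hneg : ¬ LpMinkowski.BoundedDensityAffirmative n p) :
    ∃ K : ConvexBody (LpMinkowski.E n),
      (interior (K : Set (LpMinkowski.E n))).Nonempty ∧
      (0 : LpMinkowski.E n) ∈ K ∧
      (0 : LpMinkowski.E n) ∈ frontier (K : Set (LpMinkowski.E n)) ∧
      ∃ H : Submodule ℝ (LpMinkowski.E n), H ≠ ⊤ ∧
        LpMinkowski.lpSurfaceAreaMeasure p (K : Set (LpMinkowski.E n))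
          (LpMinkowski.subsphere H)ᶜ = 0 ∧
        (LpMinkowski.lpSurfaceAreaMeasure p (K : Set (LpMinkowski.E n))).restrict
          (LpMinkowski.subsphere H) ≪ LpMinkowski.subsphereMeasure H ∧
        ∃ φ : LpMinkowski.Sphere n → ℝ,
          LpMinkowski.HasDensity
            ((LpMinkowski.lpSurfaceAreaMeasure p (K : Set (LpMinkowski.E n))).restrict
              (LpMinkowski.subsphere H))
            (LpMinkowski.subsphereMeasure H) φ ∧
          ∃ a b : ℝ, 0 < a ∧
            ∀ᵐ u ∂(LpMinkowski.subsphereMeasure H), a ≤ φ u ∧ φ u ≤ b := by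
  have hn0 : 0 < n := by omega
  obtain ⟨l, Ks, K, Ms, ts, Bs, B, R, z, r, C, h, hC, hdeg⟩ :=
    LpMinkowski.exists_normalizedSequence hn0 hneg
  have hH := h.range_ne_top hn0 hp.1 hp.2 hC hdeg
  have hfr := h.zero_mem_frontier hn0 hp.1 hH
  obtain ⟨a, b, ha, hb, h1, h2⟩ := h.exists_lpSurfaceAreaMeasure_bounds hn0 hp.1 hp.2
  set H := LinearMap.range (B : LpMinkowski.E n →ₗ[ℝ] LpMinkowski.E n) with hHd
  -- A nonzero range makes the spherical measure of `H` finite by comparison with a ball of positive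
  -- dimension; the Radon–Nikodym argument uses this finiteness.
  have hHbot : H ≠ ⊥ := fun hbot => h.limit_ne_zero
    (ContinuousLinearMap.coe_injective (LinearMap.range_eq_bot.1 hbot))
  have hfin := LpMinkowski.isFiniteMeasure_subsphereMeasure hHbot
  have hcompl : LpMinkowski.lpSurfaceAreaMeasure p K (LpMinkowski.subsphere H)ᶜ = 0 :=
    MeasureTheory.Measure.absolutelyContinuous_of_le_smul h1
      (LpMinkowski.subsphereMeasure_compl H)
  have hrestrict : (LpMinkowski.lpSurfaceAreaMeasure p K).restrict (LpMinkowski.subsphere H) =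
      LpMinkowski.lpSurfaceAreaMeasure p K :=
    MeasureTheory.Measure.restrict_eq_self_of_ae_mem (MeasureTheory.mem_ae_iff.2 hcompl)
  obtain ⟨hac, hdens⟩ := LpMinkowski.exists_density_of_le_smul ha hb h1 h2
  have hK := h.limit_isBody
  refine ⟨⟨K, hK.convex, hK.isCompact, ⟨0, hK.zero_mem⟩⟩, hK.interior_nonempty, hK.zero_mem, hfr,
    H, hH, hcompl, ?_⟩
  change (LpMinkowski.lpSurfaceAreaMeasure p K).restrict (LpMinkowski.subsphere H) ≪ _ ∧
    ∃ φ, LpMinkowski.HasDensity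
      ((LpMinkowski.lpSurfaceAreaMeasure p K).restrict (LpMinkowski.subsphere H)) _ φ ∧ _
  rw [hrestrict]
  exact ⟨hac, hdens⟩
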